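/- Let $n\in\mathbb N$ and $T>0$, and write $\Sigma=(0,T)\times\mathbb R^n$. Put $D_0=\{x\in\mathbb R^n:|x|\le 1\}$ and $D_j=\{x\in\mathbb R^n:2^{j-1}<|x|\le 2^j\}$ for $j\ge 1$. For $V:\mathbb R^n\to\mathbb C$ in $L^\infty(\mathbb R^n)$ set $$|||V|||=\sum_{j\ge 0}2^j\|V\|_{L^\infty(D_j)}\in[0,\infty],$$ and let $B^*(\mathbb R^n)$ be the space of (classes of) measurable $f:\mathbb R^n\to\mathbb C$ with $$\|f\|_{B^*(\mathbb R^n)}=\sup_{j\ge 0}2^{-j/2}\|f\|_{L^2(D_j)}<\infty .$$ For $V\in L^\infty(\mathbb R^n)$ the initial-to-final-state map $\mathcal U_T:L^2(\mathbb R^n)\to L^2(\mathbb R^n)$ of $V$ is $\mathcal U_Tf=u(T,\cdot)$, where $u\in C([0,T];L^2(\mathbb R^n))$ is the unique solution of $i\partial_tu=-\Delta u+Vu$ in $\Sigma$ (in the sense of distributions) with $u(0,\cdot)=f$. Let $V_1,V_2\in L^\infty(\mathbb R^n)$ be complex-valued with $|||V_1|||<\infty$ and $|||V_2|||<\infty$,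 and let $\mathcal U_T^1,\mathcal U_T^2$ be their initial-to-final-state maps. If $\mathcal U_T^1=\mathcal U_T^2$, then for all $u_1,v_2\in C(\mathbb R;B^*(\mathbb R^n))$ that solve, in the sense of distributions, $$(i\partial_t+\Delta-V_1)u_1=0,\qquad (i\partial_t+\Delta-\overline{V_2})v_2=0\qquad\text{in }\mathbb R\times\mathbb R^n,$$ the function $(V_1-V_2)u_1\overline{v_2}$ is integrable on $\Sigma$ and $$\int_\Sigma (V_1-V_2)\,u_1\,\overline{v_2}\,dt\,dx=0 .$$ -/

import Mathlib

open MeasureTheory Set Filter Topology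
open scoped ENNReal ContDiff ComplexConjugate

/-- The dyadic shells `D_0 = {|x| ≤ 1}`, `D_j = {2^(j-1) < |x| ≤ 2^j}` for `j ≥ 1`. -/
def dyadicShell (n : ℕ) : ℕ → Set (EuclideanSpace ℝ (Fin n))
  | 0 => {x | ‖x‖ ≤ 1}
  | j + 1 => {x | 2 ^ j < ‖x‖ ∧ ‖x‖ ≤ 2 ^ (j + 1)}

/-- The quantity `∑_j 2^j ‖V‖_{L^∞(D_j)}`, with values in `[0, ∞]`. -/
noncomputable def tripleNorm {n : ℕ} (V : EuclideanSpace ℝ (Fin n) → ℂ) : ℝ≥0∞ :=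
  ∑' j : ℕ, 2 ^ j * eLpNorm V ⊤ (volume.restrict (dyadicShell n j))

/-- The norm `sup_j 2^(-j/2) ‖f‖_{L²(D_j)}` of the space `B*`, with values in `[0, ∞]`. -/
noncomputable def bStarNorm {n : ℕ} (f : EuclideanSpace ℝ (Fin n) → ℂ) : ℝ≥0∞ :=
  ⨆ j : ℕ, (2 : ℝ≥0∞) ^ (-(j : ℝ) / 2) * eLpNorm f 2 (volume.restrict (dyadicShell n j))

/-- The function `f` represents an element of `B*(ℝⁿ)`. -/
def MemBStar {n : ℕ} (f : EuclideanSpace ℝ (Fin n) → ℂ) : Prop :=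
  AEStronglyMeasurable f volume ∧ bStarNorm f < ⊤

/-- The function `u` on `ℝ × ℝⁿ` is a (jointly measurable) representative of an element of
`C(ℝ; B*(ℝⁿ))`: every time slice is in `B*`, and `t ↦ u(t, ·)` is continuous for the norm
of `B*`. -/
structure IsContinuousBStarCurve {n : ℕ} (u : ℝ × EuclideanSpace ℝ (Fin n) → ℂ) : Prop where
  aestronglyMeasurable : AEStronglyMeasurable u volume
  memBStar : ∀ t : ℝ, MemBStar (fun x => u (t, x))
  continuous : ∀ t : ℝ,
    Tendsto (fun s : ℝ => bStarNorm (fun x => u (s, x) - u (t, x))) (𝓝 t) (𝓝 0)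

/-- The formal (real) transpose `-i ∂_t φ + Δ φ - V φ` of `i ∂_t + Δ - V`, where `Δ` acts in the
space variable. -/
noncomputable def schrodingerTranspose {n : ℕ} (V : EuclideanSpace ℝ (Fin n) → ℂ)
    (φ : ℝ × EuclideanSpace ℝ (Fin n) → ℂ) (t : ℝ) (x : EuclideanSpace ℝ (Fin n)) : ℂ :=
  -Complex.I * deriv (fun s => φ (s, x)) t + Laplacian.laplacian (fun y => φ (t, y)) x
    - V x * φ (t, x)

/-- `(i ∂_t + Δ - V) u = 0` in `J × ℝⁿ` in the sense of distributions, for an open set `J` of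
times and a family `u t`, `t ∈ J`, of functions on `ℝⁿ`. -/
def SolvesSchrodinger {n : ℕ} (J : Set ℝ) (V : EuclideanSpace ℝ (Fin n) → ℂ)
    (u : ℝ → EuclideanSpace ℝ (Fin n) → ℂ) : Prop :=
  ∀ φ : ℝ × EuclideanSpace ℝ (Fin n) → ℂ, ContDiff ℝ ∞ φ → HasCompactSupport φ →
    tsupport φ ⊆ J ×ˢ univ →
    ∫ t, ∫ x, u t x * schrodingerTranspose V φ t x = 0

/-- The space `L²(ℝⁿ)` of complex-valued functions. -/
abbrev L2Space (n : ℕ) : Type := Lp ℂ 2 (volume : Measure (EuclideanSpace ℝ (Fin n)))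

/-- `u ∈ C([0, T]; L²(ℝⁿ))` solves `i ∂_t u = -Δ u + V u` in `(0, T) × ℝⁿ`, `u(0) = f`.
(The values of `u` outside `[0, T]` play no role.) -/
structure IsPhysicalSolution {n : ℕ} (T : ℝ) (V : EuclideanSpace ℝ (Fin n) → ℂ)
    (f : L2Space n) (u : ℝ → L2Space n) : Prop where
  continuousOn : ContinuousOn u (Icc 0 T)
  equation : SolvesSchrodinger (Ioo 0 T) V (fun t x => u t x)
  initial : u 0 = f

/-- The initial-to-final-state map `𝒰_T : f ↦ u(T, ·)`, where `u` is the physical solution with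
initial state `f`; for `0 < T` and `V ∈ L^∞(ℝⁿ)` that solution exists and is unique on
`[0, T]`. -/
noncomputable def initialToFinalStateMap {n : ℕ} (T : ℝ) (V : EuclideanSpace ℝ (Fin n) → ℂ) :
    L2Space n → L2Space n :=
  fun f => Classical.epsilon fun g => ∃ u, IsPhysicalSolution T V f u ∧ u T = g

/-! Write `Q = V₁ - V₂`. Green's formula in time says that the source of an inhomogeneous solution,
integrated against a solution of the adjoint equation, equals the difference of the pairings at
times `T` and `0`, up to a factor `i`. It is used with boundary terms that vanish.

Let `w` be a physical `V₁`-solution and `w'` a physical `V₂`-solution with the same initial state.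
Equality of the two maps makes `w - w'` vanish at both `0` and `T`, and it solves the `V₂`-equation
with source `Q w`; pairing with `v₂` shows that `conj Q * v₂` is orthogonal to every physical
`V₁`-solution. Now solve the adjoint `V₁`-equation with source `conj Q * v₂` backwards from the
value `0` at time `T`. By Green's formula in `L²` (`WeakSol.inner_sub_inner`) and this
orthogonality, its value at time `0` is orthogonal to all initial states, hence zero. It too has
zero data at both ends, and pairing it with `u₁` gives the conjugate of the claim.

The analytic core is Green's formula between an `L²` solution and a `B*` solution `v`
(`WeakSol.integral_inner_eq_zero`), where neither factor has derivatives to spare and `v` is not in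
`L²`. Averaging `v` over `[t, t + h]` makes it differentiable in time, and the equation then puts
its weak Laplacian locally in `L²`. A cutoff at radius `R` costs the commutator `2 ∇χ · ∇ + Δχ`,
which is of order `1/R` by a Caccioppoli estimate (`exists_test_approx`, `norm_pairing_cutoff_le`).
Since `v` has `L²` norm `O(R^{1/2})` on balls of radius comparable to `R`, the error is
`O(R^{-1/2})`. Let `R → ∞`, then `h → 0`.

The finite weighted norm of `Q` enters through `Q = |Q|^{1/2} (Q/|Q|) |Q|^{1/2}`: multiplication by
`|Q|^{1/2}` maps `B*` into `L²` (`eLpNorm_sqrtWeight_mul_le`), so the sources lie in `L²` and the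
final integral converges. The `L²` solutions come from Duhamel's formula (`exists_mild_solution`);
their uniqueness is never needed. -/

open scoped InnerProductSpace BoundedContinuousFunction NNReal

/-! ### Pairings in `L²`, multiplication operators and test functions -/

section L2Basics

variable {n : ℕ}

open Classical in
/-- The class in `L²` of a square integrable function (and `0` for other functions). -/
noncomputable def toL2 (f : EuclideanSpace ℝ (Fin n) → ℂ) : L2Space n :=
  if h : MemLp f 2 volume then h.toLp f else 0

lemma coeFn_toL2 {f : EuclideanSpace ℝ (Fin n) → ℂ} (hf : MemLp f 2 volume) :
    toL2 f =ᵐ[volume] f := by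
  rw [toL2, dif_pos hf]
  exact hf.coeFn_toLp

lemma norm_toL2 {f : EuclideanSpace ℝ (Fin n) → ℂ} (hf : MemLp f 2 volume) :
    ‖toL2 f‖ = (eLpNorm f 2 volume).toReal := by
  rw [toL2, dif_pos hf, Lp.norm_toLp]

lemma toL2_congr {f g : EuclideanSpace ℝ (Fin n) → ℂ} (h : f =ᵐ[volume] g) :
    toL2 f = toL2 g := by
  by_cases hf : MemLp f 2 volume
  · rw [toL2, toL2, dif_pos hf, dif_pos ((memLp_congr_ae h).1 hf)]
    exact (MemLp.toLp_eq_toLp_iff _ _).2 h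
  · rw [toL2, toL2, dif_neg hf, dif_neg (fun h' => hf ((memLp_congr_ae h).2 h'))]

lemma toL2_coe (f : L2Space n) : toL2 (f : EuclideanSpace ℝ (Fin n) → ℂ) = f := by
  rw [toL2, dif_pos (Lp.memLp f), Lp.toLp_coeFn]

lemma eq_toL2_of_ae {f : L2Space n} {g : EuclideanSpace ℝ (Fin n) → ℂ}
    (h : f =ᵐ[volume] g) : f = toL2 g := by
  rw [← toL2_congr h, toL2_coe]

lemma toL2_sub {f g : EuclideanSpace ℝ (Fin n) → ℂ} (hf : MemLp f 2 volume)
    (hg : MemLp g 2 volume) : toL2 (fun x => f x - g x) = toL2 f - toL2 g := by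
  symm
  apply eq_toL2_of_ae
  filter_upwards [Lp.coeFn_sub (toL2 f) (toL2 g), coeFn_toL2 hf, coeFn_toL2 hg] with x h1 h2 h3
  rw [h1, Pi.sub_apply, h2, h3]

lemma toL2_add {f g : EuclideanSpace ℝ (Fin n) → ℂ} (hf : MemLp f 2 volume)
    (hg : MemLp g 2 volume) : toL2 (fun x => f x + g x) = toL2 f + toL2 g := by
  symm
  apply eq_toL2_of_ae
  filter_upwards [Lp.coeFn_add (toL2 f) (toL2 g), coeFn_toL2 hf, coeFn_toL2 hg] with x h1 h2 h3
  rw [h1, Pi.add_apply, h2, h3]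

lemma toL2_const_mul {f : EuclideanSpace ℝ (Fin n) → ℂ} (c : ℂ) (hf : MemLp f 2 volume) :
    toL2 (fun x => c * f x) = c • toL2 f := by
  symm
  apply eq_toL2_of_ae
  filter_upwards [Lp.coeFn_smul c (toL2 f), coeFn_toL2 hf] with x h1 h2
  rw [h1, Pi.smul_apply, h2, smul_eq_mul]

lemma L2_inner_eq (f g : L2Space n) : ⟪f, g⟫_ℂ = ∫ x, g x * conj (f x) := by
  rw [L2.inner_def]
  rfl

lemma integrable_L2_mul_conj (f g : L2Space n) :
    Integrable (fun x => g x * conj (f x)) volume :=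
  L2.integrable_inner (𝕜 := ℂ) f g

lemma inner_toL2_left {f : EuclideanSpace ℝ (Fin n) → ℂ} (hf : MemLp f 2 volume) (g : L2Space n) :
    ⟪toL2 f, g⟫_ℂ = ∫ x, g x * conj (f x) := by
  rw [L2_inner_eq]
  apply integral_congr_ae
  filter_upwards [coeFn_toL2 hf] with x hx
  rw [hx]

/-- The norm square in `L²` as an integral. -/
lemma norm_sq_L2 (f : L2Space n) : ‖f‖ ^ 2 = ∫ x, ‖f x‖ ^ 2 := by
  have h := inner_self_eq_norm_sq_to_K (𝕜 := ℂ) f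
  rw [L2_inner_eq] at h
  have h2 : ∫ x, f x * conj (f x) = ((∫ x, ‖f x‖ ^ 2 : ℝ) : ℂ) := by
    rw [← integral_complex_ofReal]
    congr 1
    ext x
    rw [Complex.mul_conj, Complex.normSq_eq_norm_sq]
  rw [h2] at h
  exact Complex.ofReal_injective (by rw [h]; simp)

lemma norm_L2_le_of_ae_le {f g : L2Space n} {c : ℝ} (h : ∀ᵐ x, ‖f x‖ ≤ c * ‖g x‖) :
    ‖f‖ ≤ c * ‖g‖ := Lp.norm_le_mul_norm_of_ae_le_mul h

open Classical in
/-- Multiplication by an essentially bounded function, as a bounded operator on `L²`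
(and `0` if the function is not essentially bounded). -/
noncomputable def mulOp (V : EuclideanSpace ℝ (Fin n) → ℂ) : L2Space n →L[ℂ] L2Space n :=
  if h : MemLp V ⊤ volume then
    (ContinuousLinearMap.mul ℂ ℂ).holderL volume ⊤ 2 2 (h.toLp V) else 0

lemma coeFn_mulOp {V : EuclideanSpace ℝ (Fin n) → ℂ} (hV : MemLp V ⊤ volume) (f : L2Space n) :
    mulOp V f =ᵐ[volume] fun x => V x * f x := by
  rw [mulOp, dif_pos hV]
  have h := ContinuousLinearMap.coeFn_holder (r := 2) (ContinuousLinearMap.mul ℂ ℂ) (hV.toLp V) f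
  filter_upwards [h, hV.coeFn_toLp] with x h1 h2
  rw [← h2]
  exact h1

lemma mulOp_eq_toL2 {V : EuclideanSpace ℝ (Fin n) → ℂ} (hV : MemLp V ⊤ volume) (f : L2Space n) :
    mulOp V f = toL2 (fun x => V x * f x) := eq_toL2_of_ae (coeFn_mulOp hV f)

lemma mulOp_toL2 {V f : EuclideanSpace ℝ (Fin n) → ℂ} (hV : MemLp V ⊤ volume)
    (hf : MemLp f 2 volume) : mulOp V (toL2 f) = toL2 (fun x => V x * f x) := by
  apply eq_toL2_of_ae
  filter_upwards [coeFn_mulOp hV (toL2 f), coeFn_toL2 hf] with x h1 h2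
  rw [h1, h2]

lemma norm_mulOp_apply_le {V : EuclideanSpace ℝ (Fin n) → ℂ} (hV : MemLp V ⊤ volume) {c : ℝ}
    (hc : ∀ᵐ x, ‖V x‖ ≤ c) (f : L2Space n) : ‖mulOp V f‖ ≤ c * ‖f‖ := by
  apply norm_L2_le_of_ae_le
  filter_upwards [hc, coeFn_mulOp hV f] with x h1 h2
  rw [h2, norm_mul]
  gcongr

lemma MeasureTheory.MemLp.conj_top {V : EuclideanSpace ℝ (Fin n) → ℂ} {p : ℝ≥0∞}
    (hV : MemLp V p volume) : MemLp (fun x => conj (V x)) p volume := hV.star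

lemma inner_mulOp_left {V : EuclideanSpace ℝ (Fin n) → ℂ} (hV : MemLp V ⊤ volume)
    (f g : L2Space n) : ⟪mulOp V f, g⟫_ℂ = ⟪f, mulOp (fun x => conj (V x)) g⟫_ℂ := by
  rw [L2_inner_eq, L2_inner_eq]
  apply integral_congr_ae
  filter_upwards [coeFn_mulOp hV f, coeFn_mulOp hV.conj_top g] with x h1 h2
  rw [h1, h2, map_mul]
  ring

lemma mulOp_mulOp {V W : EuclideanSpace ℝ (Fin n) → ℂ} (hV : MemLp V ⊤ volume)
    (hW : MemLp W ⊤ volume) (f : L2Space n) :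
    mulOp V (mulOp W f) = mulOp (fun x => V x * W x) f := by
  have hVW : MemLp (fun x => V x * W x) ⊤ volume := by
    have := hW.mul (p := ⊤) (q := ⊤) (r := ⊤) hV
    exact this
  apply Lp.ext
  filter_upwards [coeFn_mulOp hV (mulOp W f), coeFn_mulOp hW f, coeFn_mulOp hVW f] with x h1 h2 h3
  rw [h1, h2, h3, mul_assoc]

/-- Smooth compactly supported functions. -/
structure IsTest (ψ : EuclideanSpace ℝ (Fin n) → ℂ) : Prop where
  contDiff : ContDiff ℝ ∞ ψ
  hasCompactSupport : HasCompactSupport ψ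

lemma IsTest.memLp {ψ : EuclideanSpace ℝ (Fin n) → ℂ} (h : IsTest ψ) (p : ℝ≥0∞) :
    MemLp ψ p volume :=
  h.contDiff.continuous.memLp_of_hasCompactSupport h.hasCompactSupport

lemma laplacian_eq_sum (f : EuclideanSpace ℝ (Fin n) → ℂ) (hf : ContDiff ℝ 2 f)
    (x : EuclideanSpace ℝ (Fin n)) :
    Laplacian.laplacian f x =
      ∑ i, fderiv ℝ (fun y => fderiv ℝ f y (EuclideanSpace.single i 1)) x
        (EuclideanSpace.single i 1) := by
  rw [congrFun (InnerProductSpace.laplacian_eq_iteratedFDeriv_orthonormalBasis f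
    (EuclideanSpace.basisFun (Fin n) ℝ)) x]
  apply Finset.sum_congr rfl
  intro i _
  rw [iteratedFDeriv_two_apply]
  have hd : DifferentiableAt ℝ (fderiv ℝ f) x :=
    (hf.fderiv_right (m := 1) (by norm_num)).differentiable (by norm_num) x
  rw [fderiv_clm_apply hd (by fun_prop)]
  simp

lemma laplacian_fun_eq_sum {f : EuclideanSpace ℝ (Fin n) → ℂ} (hf : ContDiff ℝ 2 f) :
    Laplacian.laplacian f = fun x =>
      ∑ i, fderiv ℝ (fun y => fderiv ℝ f y (EuclideanSpace.single i 1)) x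
        (EuclideanSpace.single i 1) := funext (laplacian_eq_sum f hf)

lemma contDiff_fderiv_single {f : EuclideanSpace ℝ (Fin n) → ℂ} (hf : ContDiff ℝ ∞ f)
    (v : EuclideanSpace ℝ (Fin n)) : ContDiff ℝ ∞ (fun x => fderiv ℝ f x v) :=
  (hf.fderiv_right (m := ∞) (by norm_num)).clm_apply contDiff_const

lemma contDiff_laplacian {f : EuclideanSpace ℝ (Fin n) → ℂ} (hf : ContDiff ℝ ∞ f) :
    ContDiff ℝ ∞ (Laplacian.laplacian f) := by
  rw [laplacian_fun_eq_sum (contDiff_infty.1 hf 2)]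
  exact ContDiff.sum fun i _ => contDiff_fderiv_single (contDiff_fderiv_single hf _) _

lemma tsupport_laplacian_subset (f : EuclideanSpace ℝ (Fin n) → ℂ) :
    tsupport (Laplacian.laplacian f) ⊆ tsupport f := by
  apply closure_minimal _ (isClosed_tsupport f)
  intro x hx
  by_contra hxf
  apply hx
  have h0 : f =ᶠ[𝓝 x] fun _ => 0 := notMem_tsupport_iff_eventuallyEq.1 hxf
  rw [(InnerProductSpace.laplacian_congr_nhds h0).self_of_nhds, InnerProductSpace.laplacian_const]
  rfl

lemma IsTest.laplacian {ψ : EuclideanSpace ℝ (Fin n) → ℂ} (h : IsTest ψ) :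
    IsTest (Laplacian.laplacian ψ) :=
  ⟨contDiff_laplacian h.contDiff,
    h.hasCompactSupport.mono' (subset_closure.trans (tsupport_laplacian_subset ψ))⟩

lemma IsTest.conj {ψ : EuclideanSpace ℝ (Fin n) → ℂ} (h : IsTest ψ) :
    IsTest (fun x => conj (ψ x)) :=
  ⟨Complex.conjCLE.contDiff.comp h.contDiff, h.hasCompactSupport.comp_left (map_zero _)⟩

lemma laplacian_conj {f : EuclideanSpace ℝ (Fin n) → ℂ} (x : EuclideanSpace ℝ (Fin n)) :
    Laplacian.laplacian (fun y => conj (f y)) x = conj (Laplacian.laplacian f x) :=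
  congrFun (InnerProductSpace.laplacian_CLE_comp_left (l := Complex.conjCLE) (f := f)) x

end L2Basics

/-! ### Continuity of translations and mollification in `L²` -/

section Mollification

variable {n : ℕ}

/-- Translations are continuous in `L²`. -/
lemma exists_eLpNorm_translate_sub_le {f : EuclideanSpace ℝ (Fin n) → ℂ} (hf : MemLp f 2 volume)
    {ε : ℝ} (hε : 0 < ε) :
    ∃ δ > 0, ∀ t : EuclideanSpace ℝ (Fin n), ‖t‖ < δ →
      eLpNorm (fun x => f (x - t) - f x) 2 volume ≤ ENNReal.ofReal ε := by
  let τ : C(EuclideanSpace ℝ (Fin n), C(EuclideanSpace ℝ (Fin n), EuclideanSpace ℝ (Fin n))) :=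
    (ContinuousMap.mk (fun p : EuclideanSpace ℝ (Fin n) × EuclideanSpace ℝ (Fin n) => p.2 - p.1)
      (by fun_prop)).curry
  have hτ : ∀ t, MeasurePreserving (τ t) (volume : Measure (EuclideanSpace ℝ (Fin n))) volume :=
    fun t => measurePreserving_sub_right volume t
  obtain ⟨F, hF⟩ : ∃ F : L2Space n, F = hf.toLp f := ⟨_, rfl⟩
  have hFf : F =ᵐ[volume] f := hF ▸ hf.coeFn_toLp
  have hc : Continuous fun t => Lp.compMeasurePreserving (τ t) (hτ t) F :=
    (continuous_const (y := F)).compMeasurePreservingLp τ.continuous hτ (by norm_num)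
  have h2 : ∀ t, (Lp.compMeasurePreserving (τ t) (hτ t) F : EuclideanSpace ℝ (Fin n) → ℂ)
      =ᵐ[volume] fun x => f (x - t) := fun t =>
    (Lp.coeFn_compMeasurePreserving F (hτ t)).trans
      ((hτ t).quasiMeasurePreserving.ae_eq_comp hFf)
  have h0 : Lp.compMeasurePreserving (τ 0) (hτ 0) F = F := by
    apply Lp.ext
    filter_upwards [h2 0, hFf] with x h3 h4
    rw [h3, h4, sub_zero]
  obtain ⟨δ, hδ, h⟩ := Metric.continuousAt_iff.1 (hc.continuousAt (x := 0)) ε hε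
  refine ⟨δ, hδ, fun t ht => ?_⟩
  have h1 : dist (Lp.compMeasurePreserving (τ t) (hτ t) F) F < ε := by
    have h5 := h (x := t) (by rw [dist_zero_right]; exact ht)
    rw [h0] at h5
    exact h5
  rw [Lp.dist_def] at h1
  have h3 : (⇑(Lp.compMeasurePreserving (τ t) (hτ t) F) - ⇑F)
      =ᵐ[volume] fun x => f (x - t) - f x := by
    filter_upwards [h2 t, hFf] with x h3 h4
    rw [Pi.sub_apply, h3, h4]
  have hfin : eLpNorm (fun x => f (x - t) - f x) 2 volume ≠ ⊤ := by
    rw [← eLpNorm_congr_ae h3]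
    exact ((Lp.memLp _).sub (Lp.memLp _)).2.ne
  rw [eLpNorm_congr_ae h3] at h1
  rw [← ENNReal.ofReal_toReal hfin]
  exact ENNReal.ofReal_le_ofReal h1.le

/-- Mollification converges in `L²`. -/
lemma exists_eLpNorm_mollify_sub_le {f : EuclideanSpace ℝ (Fin n) → ℂ} (hf : MemLp f 2 volume)
    (hfm : StronglyMeasurable f) {ε : ℝ} (hε : 0 < ε) :
    ∃ δ > 0, ∀ ρ : EuclideanSpace ℝ (Fin n) → ℝ, Continuous ρ → HasCompactSupport ρ →
      (∀ x, 0 ≤ ρ x) → Function.support ρ ⊆ Metric.ball 0 δ → ∫ x, ρ x = 1 →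
      eLpNorm (fun x => (∫ t, (ρ t : ℂ) * f (x - t)) - f x) 2 volume ≤ ENNReal.ofReal ε := by
  obtain ⟨δ, hδ, h⟩ := exists_eLpNorm_translate_sub_le hf hε
  refine ⟨δ, hδ, fun ρ hρc hρs hρ0 hρδ hρ1 => ?_⟩
  have hρi : Integrable ρ volume := hρc.integrable_of_hasCompactSupport hρs
  set w : EuclideanSpace ℝ (Fin n) → ℝ≥0∞ := fun x => ENNReal.ofReal (ρ x) with hw
  have hwm : Measurable w := hρc.measurable.ennreal_ofReal
  -- With `ρ` read as a probability measure, the mollification error at `x` is the `ν`-mean of `f (x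
  -- - t) - f x`. Comparing `L¹` with `L²` for `ν` and applying Tonelli reduces everything to the
  -- bound for translations.
  set ν : Measure (EuclideanSpace ℝ (Fin n)) := volume.withDensity w with hν
  have hν1 : IsProbabilityMeasure ν := by
    constructor
    rw [hν, withDensity_apply _ MeasurableSet.univ, Measure.restrict_univ, hw,
      ← ofReal_integral_eq_lintegral_ofReal hρi (Eventually.of_forall hρ0), hρ1, ENNReal.ofReal_one]
  have hloc : LocallyIntegrable f volume := hf.locallyIntegrable (by norm_num)
  have hmeas2 : Measurable (fun p : EuclideanSpace ℝ (Fin n) × EuclideanSpace ℝ (Fin n) =>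
      ‖f (p.1 - p.2) - f p.1‖ₑ ^ (2 : ℝ)) := by
    have h1 : Measurable f := hfm.measurable
    exact (((h1.comp (measurable_fst.sub measurable_snd)).sub (h1.comp measurable_fst)).enorm).pow_const _
  have key : ∀ x, ‖(∫ t, (ρ t : ℂ) * f (x - t)) - f x‖ₑ ^ (2 : ℝ) ≤
      ∫⁻ t, ‖f (x - t) - f x‖ₑ ^ (2 : ℝ) ∂ν := by
    intro x
    have hconv : Integrable (fun t => (ρ t : ℂ) * f (x - t)) volume := by
      have h1 := HasCompactSupport.convolutionExists_left (μ := volume)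
        (L := ContinuousLinearMap.lsmul ℝ ℝ) (f := ρ) (g := f) hρs hρc hloc x
      have h2 := h1.integrable
      simpa using h2
    have hconst : Integrable (fun t => (ρ t : ℂ) * f x) volume := hρi.ofReal.mul_const _
    have e1 : (∫ t, (ρ t : ℂ) * f (x - t)) - f x = ∫ t, (f (x - t) - f x) ∂ν := by
      have : f x = ∫ t, (ρ t : ℂ) * f x := by
        rw [integral_mul_const, integral_complex_ofReal, hρ1, Complex.ofReal_one, one_mul]
      conv_lhs => rw [this]
      rw [← integral_sub hconv hconst, hν,
        integral_withDensity_eq_integral_toReal_smul hwm (by simp [hw])]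
      congr 1
      ext t
      simp only [hw, ENNReal.toReal_ofReal (hρ0 t), Complex.real_smul]
      rw [mul_sub]
    rw [e1]
    have hm : AEStronglyMeasurable (fun t => f (x - t) - f x) ν :=
      ((hfm.comp_measurable (measurable_const.sub measurable_id)).sub
        stronglyMeasurable_const).aestronglyMeasurable
    have e2 : ‖∫ t, (f (x - t) - f x) ∂ν‖ₑ ≤ eLpNorm (fun t => f (x - t) - f x) 2 ν := by
      refine (enorm_integral_le_lintegral_enorm _).trans ?_
      rw [← eLpNorm_one_eq_lintegral_enorm]
      exact eLpNorm_le_eLpNorm_of_exponent_le (by norm_num) hm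
    calc _ ≤ (eLpNorm (fun t => f (x - t) - f x) 2 ν) ^ (2 : ℝ) := by gcongr
      _ = _ := by
        rw [eLpNorm_eq_lintegral_rpow_enorm_toReal (by norm_num) (by norm_num)]
        simp only [ENNReal.toReal_ofNat]
        rw [← ENNReal.rpow_mul]
        norm_num
  have hsq : ∀ g : EuclideanSpace ℝ (Fin n) → ℂ,
      eLpNorm g 2 volume = (∫⁻ x, ‖g x‖ₑ ^ (2 : ℝ)) ^ (1 / 2 : ℝ) := by
    intro g
    rw [eLpNorm_eq_lintegral_rpow_enorm_toReal (by norm_num) (by norm_num)]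
    simp only [ENNReal.toReal_ofNat]
  have hsq' : ∀ (g : EuclideanSpace ℝ (Fin n) → ℂ),
      eLpNorm g 2 volume ^ (2 : ℝ) = ∫⁻ x, ‖g x‖ₑ ^ (2 : ℝ) := by
    intro g
    rw [hsq, ← ENNReal.rpow_mul]
    norm_num
  have hfin : ∫⁻ x, ‖(∫ t, (ρ t : ℂ) * f (x - t)) - f x‖ₑ ^ (2 : ℝ) ≤
      ENNReal.ofReal ε ^ (2 : ℝ) := by
    calc _ ≤ ∫⁻ x, (∫⁻ t, ‖f (x - t) - f x‖ₑ ^ (2 : ℝ) ∂ν) := lintegral_mono key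
      _ = ∫⁻ t, (∫⁻ x, ‖f (x - t) - f x‖ₑ ^ (2 : ℝ)) ∂ν :=
        lintegral_lintegral_swap hmeas2.aemeasurable
      _ ≤ ∫⁻ t, ENNReal.ofReal ε ^ (2 : ℝ) ∂ν := by
        apply lintegral_mono_ae
        rw [hν, ae_withDensity_iff hwm]
        filter_upwards with t ht
        have ht' : ‖t‖ < δ := by
          have : t ∈ Function.support ρ := by
            intro h0
            apply ht
            simp [hw, h0]
          simpa using hρδ this
        rw [← hsq' (fun x => f (x - t) - f x)]
        have := h t ht'
        gcongr
      _ = _ := by simp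
  rw [hsq]
  calc _ ≤ (ENNReal.ofReal ε ^ (2 : ℝ)) ^ (1 / 2 : ℝ) := by gcongr
    _ = _ := by
      rw [← ENNReal.rpow_mul]
      norm_num

end Mollification

/-! ### Green's and Caccioppoli's identities, and convolutions -/

section SmoothCalculus

variable {n : ℕ}

/-- The partial derivative in the direction of the `i`-th coordinate. -/
noncomputable def partialDeriv (i : Fin n) (f : EuclideanSpace ℝ (Fin n) → ℂ)
    (x : EuclideanSpace ℝ (Fin n)) : ℂ := fderiv ℝ f x (EuclideanSpace.single i 1)

lemma laplacian_eq_sum_partialDeriv {f : EuclideanSpace ℝ (Fin n) → ℂ} (hf : ContDiff ℝ ∞ f) :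
    Laplacian.laplacian f = fun x => ∑ i, partialDeriv i (partialDeriv i f) x :=
  laplacian_fun_eq_sum (contDiff_infty.1 hf 2)

lemma contDiff_partialDeriv {f : EuclideanSpace ℝ (Fin n) → ℂ} (hf : ContDiff ℝ ∞ f) (i : Fin n) :
    ContDiff ℝ ∞ (partialDeriv i f) := contDiff_fderiv_single hf _

lemma IsTest.partialDeriv {ψ : EuclideanSpace ℝ (Fin n) → ℂ} (h : IsTest ψ) (i : Fin n) :
    IsTest (partialDeriv i ψ) :=
  ⟨contDiff_partialDeriv h.contDiff i, h.hasCompactSupport.fderiv_apply ℝ _⟩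

lemma ContDiff.differentiableAt_infty {f : EuclideanSpace ℝ (Fin n) → ℂ} (hf : ContDiff ℝ ∞ f)
    (x : EuclideanSpace ℝ (Fin n)) : DifferentiableAt ℝ f x :=
  hf.differentiable (by simp) x

lemma partialDeriv_mul {f g : EuclideanSpace ℝ (Fin n) → ℂ} (hf : ContDiff ℝ ∞ f)
    (hg : ContDiff ℝ ∞ g) (i : Fin n) :
    partialDeriv i (fun x => f x * g x) =
      fun x => f x * partialDeriv i g x + partialDeriv i f x * g x := by
  ext x
  simp only [partialDeriv]
  rw [fderiv_fun_mul (hf.differentiableAt_infty x) (hg.differentiableAt_infty x)]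
  simp only [add_apply, smul_apply, smul_eq_mul]
  ring

lemma partialDeriv_add {f g : EuclideanSpace ℝ (Fin n) → ℂ} (hf : ContDiff ℝ ∞ f)
    (hg : ContDiff ℝ ∞ g) (i : Fin n) :
    partialDeriv i (fun x => f x + g x) = fun x => partialDeriv i f x + partialDeriv i g x := by
  ext x
  simp only [partialDeriv]
  rw [fderiv_fun_add (hf.differentiableAt_infty x) (hg.differentiableAt_infty x)]
  rfl

lemma partialDeriv_conj {f : EuclideanSpace ℝ (Fin n) → ℂ} (hf : ContDiff ℝ ∞ f) (i : Fin n) :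
    partialDeriv i (fun x => conj (f x)) = fun x => conj (partialDeriv i f x) := by
  ext x
  simp only [partialDeriv]
  have h := (Complex.conjCLE.toContinuousLinearMap.hasFDerivAt (x := f x)).comp x
    (hf.differentiableAt_infty x).hasFDerivAt
  rw [HasFDerivAt.fderiv (f := fun x => conj (f x)) h]
  rfl

lemma laplacian_mul {f g : EuclideanSpace ℝ (Fin n) → ℂ} (hf : ContDiff ℝ ∞ f)
    (hg : ContDiff ℝ ∞ g) (x : EuclideanSpace ℝ (Fin n)) :
    Laplacian.laplacian (fun y => f y * g y) x = f x * Laplacian.laplacian g x +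
      2 * ∑ i, partialDeriv i f x * partialDeriv i g x + Laplacian.laplacian f x * g x := by
  rw [laplacian_eq_sum_partialDeriv (hf.mul hg), laplacian_eq_sum_partialDeriv hf,
    laplacian_eq_sum_partialDeriv hg]
  simp only [Finset.mul_sum, Finset.sum_mul, ← Finset.sum_add_distrib]
  refine Finset.sum_congr rfl fun i _ => ?_
  rw [partialDeriv_mul hf hg, partialDeriv_add (hf.mul (contDiff_partialDeriv hg i))
    ((contDiff_partialDeriv hf i).mul hg), partialDeriv_mul hf (contDiff_partialDeriv hg i),
    partialDeriv_mul (contDiff_partialDeriv hf i) hg]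
  ring

lemma IsTest.mul_left {θ g : EuclideanSpace ℝ (Fin n) → ℂ} (hθ : IsTest θ) (hg : ContDiff ℝ ∞ g) :
    IsTest (fun x => θ x * g x) :=
  ⟨hθ.contDiff.mul hg, hθ.hasCompactSupport.mul_right⟩

lemma IsTest.integrable {ψ : EuclideanSpace ℝ (Fin n) → ℂ} (h : IsTest ψ) :
    Integrable ψ volume := memLp_one_iff_integrable.1 (h.memLp 1)

lemma integral_mul_partialDeriv {θ g : EuclideanSpace ℝ (Fin n) → ℂ} (hθ : IsTest θ)
    (hg : ContDiff ℝ ∞ g) (i : Fin n) :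
    ∫ x, θ x * partialDeriv i g x = - ∫ x, partialDeriv i θ x * g x :=
  integral_mul_fderiv_eq_neg_fderiv_mul_of_integrable
    ((hθ.partialDeriv i).mul_left hg).integrable
    (hθ.mul_left (contDiff_partialDeriv hg i)).integrable (hθ.mul_left hg).integrable
    (fun x _ => hθ.contDiff.differentiableAt_infty x) (fun x _ => hg.differentiableAt_infty x)

/-- Green's identity with a compactly supported factor. -/
lemma integral_mul_laplacian {θ g : EuclideanSpace ℝ (Fin n) → ℂ} (hθ : IsTest θ)
    (hg : ContDiff ℝ ∞ g) :
    ∫ x, θ x * Laplacian.laplacian g x = ∫ x, Laplacian.laplacian θ x * g x := by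
  rw [laplacian_eq_sum_partialDeriv hg, laplacian_eq_sum_partialDeriv hθ.contDiff]
  simp only [Finset.mul_sum, Finset.sum_mul]
  rw [integral_finsetSum _ fun i _ => (hθ.mul_left
    (contDiff_partialDeriv (contDiff_partialDeriv hg i) i)).integrable,
    integral_finsetSum _ fun i _ => (((hθ.partialDeriv i).partialDeriv i).mul_left hg).integrable]
  refine Finset.sum_congr rfl fun i _ => ?_
  rw [integral_mul_partialDeriv hθ (contDiff_partialDeriv hg i),
    integral_mul_partialDeriv (hθ.partialDeriv i) hg, neg_neg]

/-- Caccioppoli's identity for smooth functions. -/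
lemma integral_mul_sum_norm_partialDeriv_sq {θ f : EuclideanSpace ℝ (Fin n) → ℂ} (hθ : IsTest θ)
    (hf : ContDiff ℝ ∞ f) :
    2 * ∫ x, θ x * ((∑ i, ‖partialDeriv i f x‖ ^ 2 : ℝ) : ℂ) =
      (∫ x, Laplacian.laplacian θ x * (f x * conj (f x))) -
      ∫ x, θ x * (f x * conj (Laplacian.laplacian f x) +
        Laplacian.laplacian f x * conj (f x)) := by
  have hfc : ContDiff ℝ ∞ fun x => conj (f x) := Complex.conjCLE.contDiff.comp hf
  have hΔ := contDiff_laplacian hf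
  have hΔc : ContDiff ℝ ∞ fun x => conj (Laplacian.laplacian f x) := Complex.conjCLE.contDiff.comp hΔ
  -- `Δ|f|² = 2 Re(f conj(Δf)) + 2 |∇f|²`; Green's identity against `θ` then isolates the gradient
  -- term.
  have hlap : ∀ x, Laplacian.laplacian (fun y => f y * conj (f y)) x =
      (f x * conj (Laplacian.laplacian f x) + Laplacian.laplacian f x * conj (f x)) +
      2 * ((∑ i, ‖partialDeriv i f x‖ ^ 2 : ℝ) : ℂ) := by
    intro x
    rw [laplacian_mul hf hfc, laplacian_conj]
    have : ∑ i, partialDeriv i f x * partialDeriv i (fun y => conj (f y)) x =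
        ((∑ i, ‖partialDeriv i f x‖ ^ 2 : ℝ) : ℂ) := by
      push_cast
      refine Finset.sum_congr rfl fun i _ => ?_
      rw [partialDeriv_conj hf, Complex.mul_conj, Complex.normSq_eq_norm_sq]
      push_cast
      rfl
    rw [this]
    ring
  have hA : ContDiff ℝ ∞ fun x =>
      f x * conj (Laplacian.laplacian f x) + Laplacian.laplacian f x * conj (f x) :=
    (hf.mul hΔc).add (hΔ.mul hfc)
  have hB : ContDiff ℝ ∞ fun x => ((∑ i, ‖partialDeriv i f x‖ ^ 2 : ℝ) : ℂ) := by
    have : (fun x => ((∑ i, ‖partialDeriv i f x‖ ^ 2 : ℝ) : ℂ)) =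
        fun x => ∑ i, partialDeriv i f x * conj (partialDeriv i f x) := by
      ext x
      push_cast
      refine Finset.sum_congr rfl fun i _ => ?_
      rw [Complex.mul_conj, Complex.normSq_eq_norm_sq]
      push_cast
      rfl
    rw [this]
    exact ContDiff.sum fun i _ => (contDiff_partialDeriv hf i).mul
      (Complex.conjCLE.contDiff.comp (contDiff_partialDeriv hf i))
  have hG := integral_mul_laplacian hθ (hf.mul hfc)
  rw [← hG]
  simp_rw [hlap, mul_add (θ _)]
  rw [integral_add, add_sub_cancel_left, ← integral_const_mul]
  · congr 1
    ext x
    ring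
  · simp_rw [← mul_add (θ _)]
    exact (hθ.mul_left hA).integrable
  · exact (hθ.mul_left (contDiff_const.mul hB)).integrable

/-- The convolution of a test function with a locally integrable function. -/
noncomputable def conv (η z : EuclideanSpace ℝ (Fin n) → ℂ) (x : EuclideanSpace ℝ (Fin n)) : ℂ :=
  ∫ t, η t * z (x - t)

lemma conv_eq_convolution (η z : EuclideanSpace ℝ (Fin n) → ℂ) :
    conv η z = convolution η z (ContinuousLinearMap.mul ℝ ℂ) volume := by
  ext x
  rfl

lemma conv_eq_swap (η z : EuclideanSpace ℝ (Fin n) → ℂ) (x : EuclideanSpace ℝ (Fin n)) :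
    conv η z x = ∫ t, η (x - t) * z t := by
  rw [conv_eq_convolution, convolution_eq_swap]
  rfl

lemma contDiff_conv {η z : EuclideanSpace ℝ (Fin n) → ℂ} (hη : IsTest η)
    (hz : LocallyIntegrable z volume) : ContDiff ℝ ∞ (conv η z) := by
  rw [conv_eq_convolution]
  exact hη.hasCompactSupport.contDiff_convolution_left _ hη.contDiff hz

lemma partialDeriv_conv {η z : EuclideanSpace ℝ (Fin n) → ℂ} (hη : IsTest η)
    (hz : LocallyIntegrable z volume) (i : Fin n) :
    partialDeriv i (conv η z) = conv (partialDeriv i η) z := by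
  ext x
  have h := hη.hasCompactSupport.hasFDerivAt_convolution_left (ContinuousLinearMap.mul ℝ ℂ)
    (contDiff_infty.1 hη.contDiff 1) hz x
  rw [partialDeriv, conv_eq_convolution, h.fderiv, conv_eq_convolution]
  have hc : HasCompactSupport (fderiv ℝ η) := hη.hasCompactSupport.fderiv ℝ
  have hcont : Continuous (fderiv ℝ η) := hη.contDiff.continuous_fderiv (by simp)
  have hex := hc.convolutionExists_left (μ := volume)
    ((ContinuousLinearMap.mul ℝ ℂ).precompL (EuclideanSpace ℝ (Fin n))) hcont hz x
  rw [convolution_def, ContinuousLinearMap.integral_apply hex.integrable]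
  rfl

lemma laplacian_conv {η z : EuclideanSpace ℝ (Fin n) → ℂ} (hη : IsTest η)
    (hz : LocallyIntegrable z volume) :
    Laplacian.laplacian (conv η z) = conv (Laplacian.laplacian η) z := by
  rw [laplacian_eq_sum_partialDeriv (contDiff_conv hη hz),
    laplacian_eq_sum_partialDeriv hη.contDiff]
  ext x
  simp only [partialDeriv_conv hη hz, partialDeriv_conv (hη.partialDeriv _) hz]
  simp only [conv, Finset.sum_mul]
  rw [integral_finsetSum]
  intro i _
  have h := ((hη.partialDeriv i).partialDeriv i).hasCompactSupport.convolutionExists_left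
    (μ := volume) (ContinuousLinearMap.mul ℝ ℂ)
    ((hη.partialDeriv i).partialDeriv i).contDiff.continuous hz x
  exact h.integrable

/-- A reflection changes the sign of each first derivative, hence of no second derivative. This lets
the value of a convolution at a point be read as a pairing with a test function. -/
lemma laplacian_comp_const_sub (f : EuclideanSpace ℝ (Fin n) → ℂ) (hf : ContDiff ℝ ∞ f)
    (a x : EuclideanSpace ℝ (Fin n)) :
    Laplacian.laplacian (fun y => f (a - y)) x = Laplacian.laplacian f (a - x) := by
  have hp : ∀ (g : EuclideanSpace ℝ (Fin n) → ℂ), ContDiff ℝ ∞ g → ∀ i,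
      partialDeriv i (fun y => g (a - y)) = fun y => - partialDeriv i g (a - y) := by
    intro g hg i
    ext y
    have h := (hg.differentiableAt_infty (a - y)).hasFDerivAt.comp y
      ((hasFDerivAt_id y).const_sub a)
    simp only [partialDeriv]
    rw [HasFDerivAt.fderiv (f := fun y => g (a - y)) h]
    simp
  have hf' : ContDiff ℝ ∞ fun y => f (a - y) := hf.comp (contDiff_const.sub contDiff_id)
  rw [laplacian_eq_sum_partialDeriv hf', laplacian_eq_sum_partialDeriv hf]
  refine Finset.sum_congr rfl fun i _ => ?_
  rw [hp f hf]
  have : ∀ g : EuclideanSpace ℝ (Fin n) → ℂ, partialDeriv i (fun y => - g y) x =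
      - partialDeriv i g x := by
    intro g
    simp only [partialDeriv]
    rw [fderiv_fun_neg]
    rfl
  rw [this, hp _ (contDiff_partialDeriv hf i), neg_neg]

end SmoothCalculus

/-! ### Cutoffs at scale `R` and the interior gradient estimate -/

section Cutoffs

variable {n : ℕ}

/-- `χ` is a smooth cutoff, equal to `1` on the ball of radius `R` and supported in the ball of
radius `2R`, whose derivatives are bounded according to the scale `R`. -/
structure IsCutoff (C R : ℝ) (χ : EuclideanSpace ℝ (Fin n) → ℂ) : Prop where
  isTest : IsTest χ
  ofReal_re : ∀ x, ((χ x).re : ℂ) = χ x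
  re_nonneg : ∀ x, 0 ≤ (χ x).re
  norm_le_one : ∀ x, ‖χ x‖ ≤ 1
  eq_one : ∀ x, ‖x‖ ≤ R → χ x = 1
  tsupport_subset : tsupport χ ⊆ Metric.closedBall 0 (2 * R)
  norm_partialDeriv_le : ∀ i x, ‖partialDeriv i χ x‖ ≤ C / R
  norm_laplacian_le : ∀ x, ‖Laplacian.laplacian χ x‖ ≤ C / R ^ 2

lemma IsTest.exists_norm_le {ψ : EuclideanSpace ℝ (Fin n) → ℂ} (h : IsTest ψ) :
    ∃ C, ∀ x, ‖ψ x‖ ≤ C := by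
  obtain ⟨C, hC⟩ := h.hasCompactSupport.exists_bound_of_continuous h.contDiff.continuous
  exact ⟨C, hC⟩

lemma partialDeriv_comp_smul {f : EuclideanSpace ℝ (Fin n) → ℂ} (hf : ContDiff ℝ ∞ f) (c : ℝ)
    (i : Fin n) :
    partialDeriv i (fun x => f (c • x)) = fun x => (c : ℂ) * partialDeriv i f (c • x) := by
  ext x
  have h := (hf.differentiableAt_infty (c • x)).hasFDerivAt.comp x
    ((hasFDerivAt_id x).const_smul c)
  simp only [partialDeriv]
  rw [HasFDerivAt.fderiv (f := fun x => f (c • x)) h]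
  simp

lemma exists_isCutoff (n : ℕ) : ∃ C : ℝ, 0 ≤ C ∧ ∀ R : ℝ, 0 < R →
    ∃ χ : EuclideanSpace ℝ (Fin n) → ℂ, IsCutoff C R χ := by
  let b : ContDiffBump (0 : EuclideanSpace ℝ (Fin n)) := ⟨1, 2, by norm_num, by norm_num⟩
  let φ : EuclideanSpace ℝ (Fin n) → ℂ := fun x => (b x : ℂ)
  have hφ : IsTest φ := ⟨Complex.ofRealCLM.contDiff.comp b.contDiff,
    b.hasCompactSupport.comp_left Complex.ofReal_zero⟩
  have hφs : ∀ x, 2 ≤ ‖x‖ → φ x = 0 := fun x hx => by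
    have : b x = 0 := b.zero_of_le_dist (by simpa using hx)
    simp [φ, this]
  obtain ⟨C1, hC1⟩ : ∃ C, ∀ i x, ‖partialDeriv i φ x‖ ≤ C := by
    choose c hc using fun i => (hφ.partialDeriv i).exists_norm_le
    refine ⟨∑ i, |c i|, fun i x => (hc i x).trans ((le_abs_self _).trans ?_)⟩
    exact Finset.single_le_sum (f := fun i => |c i|) (fun i _ => abs_nonneg _) (Finset.mem_univ i)
  obtain ⟨C2, hC2⟩ := hφ.laplacian.exists_norm_le
  -- The constant belongs to the unit bump alone. All cutoffs are rescalings of it, and the chain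
  -- rule supplies the factors `R⁻¹` and `R⁻²`.
  refine ⟨max 0 (max C1 C2), le_max_left _ _, fun R hR => ⟨fun x => φ (R⁻¹ • x), ?_⟩⟩
  have hsc : ContDiff ℝ ∞ fun x : EuclideanSpace ℝ (Fin n) => R⁻¹ • x := contDiff_const_smul _
  have hsupp : tsupport (fun x => φ (R⁻¹ • x)) ⊆ Metric.closedBall 0 (2 * R) := by
    apply closure_minimal _ Metric.isClosed_closedBall
    intro x hx
    by_contra h
    apply hx
    apply hφs
    rw [mem_closedBall_zero_iff, not_le] at h
    rw [norm_smul, norm_inv, Real.norm_of_nonneg hR.le, inv_mul_eq_div, le_div_iff₀ hR]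
    exact h.le
  have hCD : ContDiff ℝ ∞ fun x => φ (R⁻¹ • x) := hφ.contDiff.comp hsc
  refine ⟨⟨hCD, HasCompactSupport.of_support_subset_isCompact
    (isCompact_closedBall 0 (2 * R)) (subset_closure.trans hsupp)⟩, ?_, ?_, ?_, ?_, hsupp, ?_, ?_⟩
  · intro x
    simp [φ]
  · intro x
    simpa [φ] using b.nonneg
  · intro x
    simp only [φ, Complex.norm_real, Real.norm_of_nonneg b.nonneg]
    exact b.le_one
  · intro x hx
    have : b (R⁻¹ • x) = 1 := by
      apply b.one_of_mem_closedBall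
      rw [mem_closedBall_zero_iff, norm_smul, norm_inv, Real.norm_of_nonneg hR.le,
        inv_mul_eq_div, div_le_iff₀ hR]
      simpa [b] using hx
    simp [φ, this]
  · intro i x
    rw [partialDeriv_comp_smul hφ.contDiff, norm_mul, Complex.norm_real, norm_inv,
      Real.norm_of_nonneg hR.le, inv_mul_eq_div]
    gcongr
    exact (hC1 i _).trans ((le_max_left _ _).trans (le_max_right _ _))
  · intro x
    have e : Laplacian.laplacian (fun x => φ (R⁻¹ • x)) x =
        (R⁻¹ : ℝ) ^ 2 * Laplacian.laplacian φ (R⁻¹ • x) := by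
      rw [laplacian_eq_sum_partialDeriv hCD, laplacian_eq_sum_partialDeriv hφ.contDiff,
        Finset.mul_sum]
      refine Finset.sum_congr rfl fun i _ => ?_
      rw [partialDeriv_comp_smul hφ.contDiff,
        partialDeriv_mul (f := fun _ => ((R⁻¹ : ℝ) : ℂ)) (g := fun x => partialDeriv i φ (R⁻¹ • x))
          contDiff_const ((contDiff_partialDeriv hφ.contDiff i).comp hsc),
        partialDeriv_comp_smul (contDiff_partialDeriv hφ.contDiff i)]
      simp [partialDeriv]
      ring
    rw [e, norm_mul, norm_pow, Complex.norm_real, norm_inv, Real.norm_of_nonneg hR.le, inv_pow,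
      inv_mul_eq_div]
    gcongr
    exact (hC2 _).trans ((le_max_right _ _).trans (le_max_right _ _))

lemma IsTest.norm_mulOp_le {η : EuclideanSpace ℝ (Fin n) → ℂ} (hη : IsTest η) {c : ℝ}
    (hc : ∀ x, ‖η x‖ ≤ c) (f : L2Space n) : ‖mulOp η f‖ ≤ c * ‖f‖ :=
  norm_mulOp_apply_le (hη.memLp ⊤) (Eventually.of_forall hc) f

lemma MeasureTheory.MemLp.integrable_mul_conj {f g : EuclideanSpace ℝ (Fin n) → ℂ}
    (hf : MemLp f 2 volume) (hg : MemLp g 2 volume) :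
    Integrable (fun x => g x * conj (f x)) volume := by
  exact (hf.conj_top).integrable_mul hg |>.congr (Eventually.of_forall fun x => mul_comm _ _)

/-- The gradient of a smooth function is controlled by the function and its Laplacian. -/
lemma norm_integral_cutoff_gradient_le {C R : ℝ} (hC : 0 ≤ C) (hR : 1 ≤ R)
    {θ f g : EuclideanSpace ℝ (Fin n) → ℂ} (hθ : IsCutoff C R θ) (hf : ContDiff ℝ ∞ f)
    (hf2 : MemLp f 2 volume) (hg2 : MemLp g 2 volume)
    (hfg : ∀ x, ‖x‖ ≤ 2 * R → Laplacian.laplacian f x = g x) :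
    ∫ x, (θ x).re * ∑ i, ‖partialDeriv i f x‖ ^ 2 ≤
      (C + 2) * (‖toL2 f‖ + ‖toL2 g‖) ^ 2 := by
  have h := integral_mul_sum_norm_partialDeriv_sq hθ.isTest hf
  have hθ0 : ∀ x, 2 * R < ‖x‖ → θ x = 0 := fun x hx => by
    apply image_eq_zero_of_notMem_tsupport
    intro h'
    have := hθ.tsupport_subset h'
    rw [mem_closedBall_zero_iff] at this
    linarith
  have e0 : ∫ x, θ x * ((∑ i, ‖partialDeriv i f x‖ ^ 2 : ℝ) : ℂ) =
      ((∫ x, (θ x).re * ∑ i, ‖partialDeriv i f x‖ ^ 2 : ℝ) : ℂ) := by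
    rw [← integral_complex_ofReal]
    congr 1
    ext x
    rw [Complex.ofReal_mul, hθ.ofReal_re]
  have e1 : ∫ x, Laplacian.laplacian θ x * (f x * conj (f x)) =
      ⟪toL2 f, mulOp (Laplacian.laplacian θ) (toL2 f)⟫_ℂ := by
    rw [inner_toL2_left hf2]
    apply integral_congr_ae
    filter_upwards [coeFn_mulOp (hθ.isTest.laplacian.memLp ⊤) (toL2 f), coeFn_toL2 hf2] with x h1 h2
    rw [h1, h2]
    ring
  have m1 : Integrable (fun x => mulOp θ (toL2 f) x * conj (g x)) volume :=
    hg2.integrable_mul_conj (Lp.memLp _)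
  have m2 : Integrable (fun x => mulOp θ (toL2 g) x * conj (f x)) volume :=
    hf2.integrable_mul_conj (Lp.memLp _)
  have e2 : ∫ x, θ x * (f x * conj (Laplacian.laplacian f x) +
        Laplacian.laplacian f x * conj (f x)) =
      ⟪toL2 g, mulOp θ (toL2 f)⟫_ℂ + ⟪toL2 f, mulOp θ (toL2 g)⟫_ℂ := by
    rw [inner_toL2_left hf2, inner_toL2_left hg2, ← integral_add m1 m2]
    apply integral_congr_ae
    filter_upwards [coeFn_mulOp (hθ.isTest.memLp ⊤) (toL2 f), coeFn_toL2 hf2,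
      coeFn_mulOp (hθ.isTest.memLp ⊤) (toL2 g), coeFn_toL2 hg2] with x h1 h2 h3 h4
    rw [h1, h2, h3, h4]
    -- The identity `Δf = g` is known only on this ball; outside it `θ` vanishes.
    by_cases hx : ‖x‖ ≤ 2 * R
    · rw [hfg x hx]
      ring
    · rw [hθ0 x (not_le.1 hx)]
      ring
  have hI : 0 ≤ ∫ x, (θ x).re * ∑ i, ‖partialDeriv i f x‖ ^ 2 :=
    integral_nonneg fun x => mul_nonneg (hθ.re_nonneg x) (by positivity)
  have hn := congrArg norm h
  rw [e0, e1, e2, norm_mul, Complex.norm_real, Real.norm_of_nonneg hI, Complex.norm_ofNat] at hn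
  have hCR : C / R ^ 2 ≤ C := div_le_self hC (by nlinarith)
  have b1 : ‖⟪toL2 f, mulOp (Laplacian.laplacian θ) (toL2 f)⟫_ℂ‖ ≤ ‖toL2 f‖ * (C * ‖toL2 f‖) :=
    (norm_inner_le_norm _ _).trans (mul_le_mul_of_nonneg_left
      (hθ.isTest.laplacian.norm_mulOp_le (fun x => (hθ.norm_laplacian_le x).trans hCR) _)
      (norm_nonneg _))
  have b2 : ‖⟪toL2 g, mulOp θ (toL2 f)⟫_ℂ‖ ≤ ‖toL2 g‖ * (1 * ‖toL2 f‖) :=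
    (norm_inner_le_norm _ _).trans (mul_le_mul_of_nonneg_left
      (hθ.isTest.norm_mulOp_le hθ.norm_le_one _) (norm_nonneg _))
  have b3 : ‖⟪toL2 f, mulOp θ (toL2 g)⟫_ℂ‖ ≤ ‖toL2 f‖ * (1 * ‖toL2 g‖) :=
    (norm_inner_le_norm _ _).trans (mul_le_mul_of_nonneg_left
      (hθ.isTest.norm_mulOp_le hθ.norm_le_one _) (norm_nonneg _))
  have b4 := norm_sub_le ⟪toL2 f, mulOp (Laplacian.laplacian θ) (toL2 f)⟫_ℂ
    (⟪toL2 g, mulOp θ (toL2 f)⟫_ℂ + ⟪toL2 f, mulOp θ (toL2 g)⟫_ℂ)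
  have b5 := norm_add_le ⟪toL2 g, mulOp θ (toL2 f)⟫_ℂ ⟪toL2 f, mulOp θ (toL2 g)⟫_ℂ
  have n1 := norm_nonneg (toL2 f)
  have n2 := norm_nonneg (toL2 g)
  nlinarith [mul_nonneg hC (mul_nonneg n1 n2), mul_nonneg hC (mul_nonneg n2 n2),
    mul_nonneg n1 n2, mul_nonneg hC (mul_nonneg n1 n1), mul_nonneg n1 n1, mul_nonneg n2 n2]

end Cutoffs

/-! ### Approximation of localized `L²` functions by test functions -/

section TestApproximation

variable {n : ℕ}

/-- There are mollifiers with arbitrarily small support. -/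
lemma exists_mollifier (n : ℕ) {δ : ℝ} (hδ : 0 < δ) :
    ∃ ρ : EuclideanSpace ℝ (Fin n) → ℝ, Continuous ρ ∧ HasCompactSupport ρ ∧ (∀ x, 0 ≤ ρ x) ∧
      Function.support ρ ⊆ Metric.ball 0 δ ∧ ∫ x, ρ x = 1 ∧ IsTest (fun x => (ρ x : ℂ)) := by
  let b : ContDiffBump (0 : EuclideanSpace ℝ (Fin n)) := ⟨δ / 2, δ, by linarith, by linarith⟩
  refine ⟨b.normed volume, b.continuous_normed, b.hasCompactSupport_normed, b.nonneg_normed, ?_,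
    b.integral_normed, ⟨Complex.ofRealCLM.contDiff.comp b.contDiff_normed,
      b.hasCompactSupport_normed.comp_left Complex.ofReal_zero⟩⟩
  rw [b.support_normed_eq]

/-- The convolution at `x` is a pairing with `y ↦ conj (ρ (x - y))`, a test function supported
within `δ` of `x`. Thus a weak equation on the ball of radius `r` becomes a pointwise one for the
mollified functions, on the ball shrunk by `δ`. -/
lemma conv_test_eq_of_weak {r δ : ℝ} {z g : L2Space n} {ρ : EuclideanSpace ℝ (Fin n) → ℂ}
    (hρ : IsTest ρ) (hρs : Function.support ρ ⊆ Metric.ball 0 δ)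
    (hw : ∀ ψ : EuclideanSpace ℝ (Fin n) → ℂ, IsTest ψ → tsupport ψ ⊆ Metric.ball 0 r →
      ⟪toL2 (Laplacian.laplacian ψ), z⟫_ℂ = ⟪toL2 ψ, g⟫_ℂ)
    {x : EuclideanSpace ℝ (Fin n)} (hx : ‖x‖ + δ < r) :
    conv (Laplacian.laplacian ρ) z x = conv ρ g x := by
  have hρc : IsTest (fun y => conj (ρ y)) := hρ.conj
  have hψ : IsTest (fun y => conj (ρ (x - y))) := by
    refine ⟨hρc.contDiff.comp (contDiff_const.sub contDiff_id), ?_⟩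
    exact hρc.hasCompactSupport.comp_homeomorph (Homeomorph.subLeft x)
  have hs : tsupport (fun y => conj (ρ (x - y))) ⊆ Metric.ball 0 r := by
    refine (closure_minimal (t := Metric.closedBall x δ) ?_ Metric.isClosed_closedBall).trans ?_
    · intro y hy
      have h1 : x - y ∈ Function.support ρ := by
        intro h0
        apply hy
        simp [h0]
      have h2 := hρs h1
      rw [mem_ball_zero_iff] at h2
      rw [mem_closedBall_iff_norm, norm_sub_rev]
      exact h2.le
    · intro y hy
      rw [mem_closedBall_iff_norm] at hy
      rw [mem_ball_zero_iff]
      have := norm_le_norm_add_norm_sub' y x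
      linarith
  have h := hw _ hψ hs
  rw [inner_toL2_left (hψ.laplacian.memLp 2), inner_toL2_left (hψ.memLp 2)] at h
  rw [conv_eq_swap, conv_eq_swap]
  have e : ∀ y, Laplacian.laplacian (fun y => conj (ρ (x - y))) y =
      conj (Laplacian.laplacian ρ (x - y)) := fun y => by
    rw [laplacian_conj, laplacian_comp_const_sub ρ hρ.contDiff]
  simp only [e, Complex.conj_conj] at h
  rw [← integral_congr_ae (Eventually.of_forall fun y => mul_comm _ _), h]
  exact integral_congr_ae (Eventually.of_forall fun y => mul_comm _ _)

lemma norm_sum_mul_sq_le (a b : Fin n → ℂ) {c : ℝ} (ha : ∀ i, ‖a i‖ ≤ c) :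
    ‖∑ i, a i * b i‖ ^ 2 ≤ n * c ^ 2 * ∑ i, ‖b i‖ ^ 2 := by
  have h1 : ‖∑ i, a i * b i‖ ≤ ∑ i, ‖a i‖ * ‖b i‖ := by
    refine (norm_sum_le _ _).trans (le_of_eq ?_)
    simp
  have h2 := Finset.sum_mul_sq_le_sq_mul_sq Finset.univ (fun i => ‖a i‖) (fun i => ‖b i‖)
  have h3 : ∑ i, ‖a i‖ ^ 2 ≤ n * c ^ 2 := by
    refine (Finset.sum_le_sum fun i _ => pow_le_pow_left₀ (norm_nonneg _) (ha i) 2).trans ?_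
    simp
  calc _ ≤ (∑ i, ‖a i‖ * ‖b i‖) ^ 2 := by gcongr
    _ ≤ _ := h2
    _ ≤ _ := by gcongr

/-- A localized `L²` function with local weak Laplacian in `L²` is approximated by test functions,
with an error of order `1/R` in the Laplacian. -/
lemma exists_test_approx {C R : ℝ} (hC : 0 ≤ C) (hR : 1 ≤ R)
    {χ θ : EuclideanSpace ℝ (Fin n) → ℂ} (hχ : IsCutoff C R χ) (hθ : IsCutoff C (2 * R) θ)
    {z g : L2Space n}
    (hw : ∀ ψ : EuclideanSpace ℝ (Fin n) → ℂ, IsTest ψ → tsupport ψ ⊆ Metric.ball 0 (6 * R) →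
      ⟪toL2 (Laplacian.laplacian ψ), z⟫_ℂ = ⟪toL2 ψ, g⟫_ℂ) {ε : ℝ} (hε : 0 < ε) :
    ∃ ψ : EuclideanSpace ℝ (Fin n) → ℂ, IsTest ψ ∧ ‖toL2 ψ - mulOp χ z‖ ≤ ε ∧
      ‖toL2 (Laplacian.laplacian ψ) - mulOp χ g‖ ≤
        ε + (2 * (√(n * (C + 2)) * C) + C) * (‖z‖ + ‖g‖) / R := by
  have hR0 : 0 < R := by linarith
  set D : ℝ := 2 * (√(n * (C + 2)) * C) + C with hD
  have hD0 : 0 ≤ D := by positivity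
  obtain ⟨ε', hε', hεε, hε2⟩ : ∃ ε' : ℝ, 0 < ε' ∧ ε' ≤ ε ∧ ε' * (1 + 2 * D) ≤ ε := by
    refine ⟨ε / (1 + 2 * D), by positivity, div_le_self hε.le (by linarith), ?_⟩
    rw [div_mul_cancel₀]
    positivity
  obtain ⟨δ₁, hδ₁, H₁⟩ := exists_eLpNorm_mollify_sub_le (Lp.memLp z) (Lp.stronglyMeasurable z) hε'
  obtain ⟨δ₂, hδ₂, H₂⟩ := exists_eLpNorm_mollify_sub_le (Lp.memLp g) (Lp.stronglyMeasurable g) hε'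
  -- The cap `1` on the mollification radius keeps the equation on `‖x‖ ≤ 4R`, since `4R + 1 < 6R`
  -- for `R ≥ 1`.
  obtain ⟨ρ, hρc, hρs, hρ0, hρb, hρ1, hρt⟩ :=
    exists_mollifier n (show 0 < min (min δ₁ δ₂) 1 by positivity)
  specialize H₁ ρ hρc hρs hρ0 (hρb.trans (Metric.ball_subset_ball
    ((min_le_left _ _).trans (min_le_left _ _)))) hρ1
  specialize H₂ ρ hρc hρs hρ0 (hρb.trans (Metric.ball_subset_ball
    ((min_le_left _ _).trans (min_le_right _ _)))) hρ1
  set P : EuclideanSpace ℝ (Fin n) → ℂ := fun x => (ρ x : ℂ) with hP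
  have hPs : Function.support P ⊆ Metric.ball 0 1 := by
    intro x hx
    refine Metric.ball_subset_ball (min_le_right _ _) (hρb ?_)
    intro h0
    apply hx
    simp [hP, h0]
  have hloc : ∀ u : L2Space n, LocallyIntegrable u volume :=
    fun u => (Lp.memLp u).locallyIntegrable (by norm_num)
  have approx : ∀ u : L2Space n,
      eLpNorm (fun x => (∫ t, (ρ t : ℂ) * u (x - t)) - u x) 2 volume ≤ ENNReal.ofReal ε' →
      MemLp (conv P u) 2 volume ∧ ‖toL2 (conv P u) - u‖ ≤ ε' := by
    intro u hu
    have hm : MemLp (fun x => conv P u x - u x) 2 volume :=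
      ⟨(contDiff_conv hρt (hloc u)).continuous.aestronglyMeasurable.sub
        (Lp.aestronglyMeasurable u), hu.trans_lt ENNReal.ofReal_lt_top⟩
    have hm2 : MemLp (conv P u) 2 volume := by
      have := hm.add (Lp.memLp u)
      refine (memLp_congr_ae (Eventually.of_forall fun x => ?_)).1 this
      simp
    refine ⟨hm2, ?_⟩
    have e : toL2 (conv P u) - u = toL2 (fun x => conv P u x - u x) := by
      rw [toL2_sub hm2 (Lp.memLp u), toL2_coe]
    rw [e, norm_toL2 hm]
    exact ENNReal.toReal_le_of_le_ofReal hε'.le hu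
  obtain ⟨hz2, hz⟩ := approx z H₁
  obtain ⟨hg2, hg⟩ := approx g H₂
  set f := conv P z with hf
  set k := conv P g with hk
  have hfs : ContDiff ℝ ∞ f := contDiff_conv hρt (hloc z)
  have hΔ : ∀ x, ‖x‖ ≤ 2 * (2 * R) → Laplacian.laplacian f x = k x := by
    intro x hx
    rw [hf, laplacian_conv hρt (hloc z)]
    exact conv_test_eq_of_weak hρt hPs hw (by linarith)
  have hχ0 : ∀ x, 2 * R < ‖x‖ → x ∉ tsupport χ := fun x hx h' => by
    have := hχ.tsupport_subset h'
    rw [mem_closedBall_zero_iff] at this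
    linarith
  have hψ : IsTest (fun x => χ x * f x) := hχ.isTest.mul_left hfs
  have hcross : IsTest (fun x => ∑ i, partialDeriv i χ x * partialDeriv i f x) := by
    refine ⟨ContDiff.sum fun i _ => (contDiff_partialDeriv hχ.isTest.contDiff i).mul
      (contDiff_partialDeriv hfs i), ?_⟩
    apply HasCompactSupport.of_support_subset_isCompact hχ.isTest.hasCompactSupport
    intro x hx
    by_contra h
    apply hx
    refine Finset.sum_eq_zero fun i _ => ?_
    have : fderiv ℝ χ x = 0 := by
      have h2 := support_fderiv_subset ℝ (f := χ)
      by_contra h3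
      exact h (h2 h3)
    simp [partialDeriv, this]
  -- The approximant is the cutoff of the mollification of `z`.
  refine ⟨fun x => χ x * f x, hψ, ?_, ?_⟩
  · rw [← mulOp_toL2 (hχ.isTest.memLp ⊤) hz2, ← map_sub]
    calc _ ≤ 1 * ‖toL2 f - z‖ := hχ.isTest.norm_mulOp_le hχ.norm_le_one _
      _ ≤ ε := by linarith
  -- Leibniz's rule: `χ Δf` is close to `χ g`, and the two remaining terms form the commutator of
  -- `Δ` with `χ`, which is of order `1/R`.
  · have e1 : toL2 (Laplacian.laplacian fun x => χ x * f x) - mulOp χ g =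
        mulOp χ (toL2 k - g) + (2 : ℂ) • toL2 (fun x => ∑ i, partialDeriv i χ x * partialDeriv i f x)
          + mulOp (Laplacian.laplacian χ) (toL2 f) := by
      rw [map_sub, mulOp_toL2 (hχ.isTest.memLp ⊤) hg2, mulOp_toL2 (hχ.isTest.laplacian.memLp ⊤) hz2,
        ← toL2_const_mul _ (hcross.memLp 2)]
      have i1 : MemLp (fun x => χ x * k x) 2 volume := hg2.mul (hχ.isTest.memLp ⊤)
      have i3 : MemLp (fun x => Laplacian.laplacian χ x * f x) 2 volume :=
        (hχ.isTest.laplacian.mul_left hfs).memLp 2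
      have i2 : MemLp (fun x => 2 * ∑ i, partialDeriv i χ x * partialDeriv i f x) 2 volume :=
        (hcross.memLp 2).const_mul 2
      have i12 : MemLp (fun x => χ x * k x + 2 * ∑ i, partialDeriv i χ x * partialDeriv i f x) 2
          volume := i1.add i2
      rw [sub_add_eq_add_sub, sub_add_eq_add_sub, ← toL2_add i1 i2, ← toL2_add i12 i3]
      congr 2
      ext x
      rw [laplacian_mul hχ.isTest.contDiff hfs]
      by_cases hx : ‖x‖ ≤ 2 * R
      · rw [hΔ x (by linarith)]
      · rw [image_eq_zero_of_notMem_tsupport (hχ0 x (not_le.1 hx))]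
        ring
    have hgrad := norm_integral_cutoff_gradient_le hC (by linarith : 1 ≤ 2 * R) hθ hfs hz2 hg2 hΔ
    -- The gradient of `χ` lives in `‖x‖ ≤ 2R`, where the wider cutoff `θ` equals `1`, so the
    -- interior gradient estimate with weight `θ` applies. One factor `1/R` comes from `∇χ`.
    have hcn : ‖toL2 (fun x => ∑ i, partialDeriv i χ x * partialDeriv i f x)‖ ≤
        √(n * (C + 2)) * (C / R) * (‖toL2 f‖ + ‖toL2 k‖) := by
      apply le_of_sq_le_sq _ (by positivity)
      have hgi : IsTest (fun x => θ x * ((∑ i, ‖partialDeriv i f x‖ ^ 2 : ℝ) : ℂ)) := by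
        apply hθ.isTest.mul_left
        have : (fun x => ((∑ i, ‖partialDeriv i f x‖ ^ 2 : ℝ) : ℂ)) =
            fun x => ∑ i, partialDeriv i f x * conj (partialDeriv i f x) := by
          ext x
          push_cast
          refine Finset.sum_congr rfl fun i _ => ?_
          rw [Complex.mul_conj, Complex.normSq_eq_norm_sq]
          push_cast
          rfl
        rw [this]
        exact ContDiff.sum fun i _ => (contDiff_partialDeriv hfs i).mul
          (Complex.conjCLE.contDiff.comp (contDiff_partialDeriv hfs i))
      have hint : Integrable (fun x => (θ x).re * ∑ i, ‖partialDeriv i f x‖ ^ 2) volume := by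
        refine (hgi.integrable.re).congr (Eventually.of_forall fun x => ?_)
        simp only [RCLike.re_to_complex, Complex.re_mul_ofReal]
      have hsq : ‖toL2 (fun x => ∑ i, partialDeriv i χ x * partialDeriv i f x)‖ ^ 2 ≤
          ∫ x, (n * (C / R) ^ 2) * ((θ x).re * ∑ i, ‖partialDeriv i f x‖ ^ 2) := by
        rw [norm_sq_L2]
        apply integral_mono_ae ((memLp_two_iff_integrable_sq_norm
          (Lp.aestronglyMeasurable _)).1 (Lp.memLp _)) (hint.const_mul _)
        filter_upwards [coeFn_toL2 (hcross.memLp 2)] with x hx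
        rw [hx]
        by_cases hx2 : ‖x‖ ≤ 2 * R
        · rw [hθ.eq_one x hx2, Complex.one_re, one_mul]
          exact norm_sum_mul_sq_le _ _ fun i => hχ.norm_partialDeriv_le i x
        · have h0 : ∀ i, partialDeriv i χ x = 0 := fun i => by
            have h2 := support_fderiv_subset ℝ (f := χ)
            have : fderiv ℝ χ x = 0 := by
              by_contra h3
              exact hχ0 x (not_le.1 hx2) (h2 h3)
            simp [partialDeriv, this]
          simp only [h0, zero_mul, Finset.sum_const_zero, norm_zero]
          rw [zero_pow two_ne_zero]
          exact mul_nonneg (by positivity) (mul_nonneg (hθ.re_nonneg x) (by positivity))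
      rw [integral_const_mul] at hsq
      refine hsq.trans ?_
      rw [mul_pow, mul_pow, Real.sq_sqrt (by positivity)]
      calc _ ≤ n * (C / R) ^ 2 * ((C + 2) * (‖toL2 f‖ + ‖toL2 k‖) ^ 2) := by gcongr
        _ = _ := by ring
    have hCR : C / R ^ 2 ≤ C / R := by
      apply div_le_div_of_nonneg_left hC hR0
      nlinarith
    have hl : ‖mulOp (Laplacian.laplacian χ) (toL2 f)‖ ≤ C / R * ‖toL2 f‖ :=
      hχ.isTest.laplacian.norm_mulOp_le (fun x => (hχ.norm_laplacian_le x).trans hCR) _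
    have hk1 : ‖mulOp χ (toL2 k - g)‖ ≤ 1 * ‖toL2 k - g‖ :=
      hχ.isTest.norm_mulOp_le hχ.norm_le_one _
    have t1 : ‖toL2 f‖ ≤ ‖z‖ + ε' := by
      have h2 := norm_le_norm_add_norm_sub' (toL2 f) z
      linarith
    have t2 : ‖toL2 k‖ ≤ ‖g‖ + ε' := by
      have h2 := norm_le_norm_add_norm_sub' (toL2 k) g
      linarith
    rw [e1]
    calc _ ≤ ‖mulOp χ (toL2 k - g)‖ +
          ‖(2 : ℂ) • toL2 (fun x => ∑ i, partialDeriv i χ x * partialDeriv i f x)‖ +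
          ‖mulOp (Laplacian.laplacian χ) (toL2 f)‖ := norm_add₃_le
      _ ≤ ε' + 2 * (√(n * (C + 2)) * (C / R) * (‖toL2 f‖ + ‖toL2 k‖)) +
          C / R * (‖toL2 f‖ + ‖toL2 k‖) := by
        rw [norm_smul, Complex.norm_ofNat]
        have : C / R * ‖toL2 f‖ ≤ C / R * (‖toL2 f‖ + ‖toL2 k‖) := by
          gcongr
          linarith [norm_nonneg (toL2 k)]
        gcongr
        · linarith
        · linarith
      _ = ε' + D / R * (‖toL2 f‖ + ‖toL2 k‖) := by rw [hD]; ring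
      _ ≤ ε' + D / R * ((‖z‖ + ε') + (‖g‖ + ε')) := by gcongr
      _ = ε' + 2 * D * ε' / R + D * (‖z‖ + ‖g‖) / R := by ring
      _ ≤ ε' + 2 * D * ε' + D * (‖z‖ + ‖g‖) / R := by
        gcongr
        exact div_le_self (by positivity) hR
      _ ≤ ε + D * (‖z‖ + ‖g‖) / R := by
        gcongr
        linarith

end TestApproximation

/-! ### Weak solutions and their approximate pairing -/

section WeakSolutions

variable {n : ℕ}

/-- `w : ℝ → L²` satisfies `(i ∂_t + Δ - V) w = F` on `[a, b] × Ω`, tested with functions of the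
space variable. -/
def WeakSol (Ω : Set (EuclideanSpace ℝ (Fin n))) (a b : ℝ) (V : EuclideanSpace ℝ (Fin n) → ℂ)
    (w F : ℝ → L2Space n) : Prop :=
  ∀ ψ : EuclideanSpace ℝ (Fin n) → ℂ, IsTest ψ → tsupport ψ ⊆ Ω →
    ∀ s ∈ Icc a b, ∀ t ∈ Icc a b, ⟪toL2 ψ, w t⟫_ℂ - ⟪toL2 ψ, w s⟫_ℂ =
      ∫ τ in s..t, (Complex.I * ⟪toL2 (Laplacian.laplacian ψ), w τ⟫_ℂ -
        Complex.I * ⟪toL2 ψ, mulOp V (w τ) + F τ⟫_ℂ)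

lemma WeakSol.mono {Ω Ω' : Set (EuclideanSpace ℝ (Fin n))} {a b a' b' : ℝ}
    {V : EuclideanSpace ℝ (Fin n) → ℂ} {w F : ℝ → L2Space n} (h : WeakSol Ω a b V w F)
    (hΩ : Ω' ⊆ Ω) (ha : a ≤ a') (hb : b' ≤ b) : WeakSol Ω' a' b' V w F :=
  fun ψ hψ hs s hs' t ht => h ψ hψ (hs.trans hΩ) s (Icc_subset_Icc ha hb hs') t
    (Icc_subset_Icc ha hb ht)

/-- A weak mean value inequality. -/
lemma norm_sub_le_of_local_bound {f : ℝ → ℂ} {T κ : ℝ} (hT : 0 ≤ T)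
    (hf : ContinuousOn f (Icc 0 T))
    (h : ∀ x ∈ Ico 0 T, ∃ q : ℝ → ℂ, HasDerivAt q 0 x ∧ q x = 0 ∧
      ∀ τ ∈ Ioc x T, ‖f τ - f x‖ ≤ ‖q τ‖ + κ * (τ - x)) :
    ‖f T - f 0‖ ≤ κ * T := by
  apply le_of_forall_pos_le_add
  intro ε hε
  set η := ε / (T + 1) with hη
  have hη0 : 0 < η := by positivity
  -- The comparison principle wants a strict inequality between slopes: the barrier rises at rate `κ
  -- + η`, while right slopes of `f` are bounded by every `r > κ` because `q` is `o(τ - x)`. The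
  -- excess `η T` is at most `ε`.
  have hmain := image_norm_le_of_liminf_right_slope_norm_lt_deriv_boundary
    (f := fun t => f t - f 0) (f' := fun _ => κ) (a := 0) (b := T)
    (B := fun t => (κ + η) * t) (B' := fun _ => κ + η) (hf.sub continuousOn_const) ?_ (by simp)
    (by fun_prop) (fun x _ => by
      simpa using ((hasDerivAt_id x).const_mul (κ + η)).hasDerivWithinAt) (fun x _ _ => by linarith)
  · have := hmain (right_mem_Icc.2 hT)
    have h2 : η * T ≤ ε := by
      rw [hη, div_mul_eq_mul_div, div_le_iff₀ (by linarith)]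
      nlinarith
    calc _ ≤ (κ + η) * T := this
      _ ≤ κ * T + ε := by linarith
  · intro x hx r hr
    obtain ⟨q, hq, hq0, hb⟩ := h x hx
    apply Eventually.frequently
    have h1 : ∀ᶠ τ in 𝓝 x, ‖q τ‖ ≤ ((r - κ) / 2) * ‖τ - x‖ := by
      have := (hasDerivAt_iff_isLittleO.1 hq).def (show 0 < (r - κ) / 2 by linarith)
      filter_upwards [this] with τ hτ
      simpa [hq0] using hτ
    filter_upwards [nhdsWithin_le_nhds h1, Ioc_mem_nhdsGT hx.2] with τ h2 h3
    have h4 := hb τ h3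
    have h5 : 0 < τ - x := by linarith [h3.1]
    rw [Real.norm_of_nonneg h5.le] at h2
    have h6 : ‖f τ - f 0‖ - ‖f x - f 0‖ ≤ ‖f τ - f x‖ := by
      have := norm_sub_norm_le (f τ - f 0) (f x - f 0)
      simpa using this
    rw [slope_def_field, div_lt_iff₀ h5]
    simp only [Function.comp_apply]
    nlinarith

/-- Since `a` vanishes at `x`, the difference quotient of the pairing is the slope of `a` paired
with `b τ`, so continuity of `b` is enough. This replaces the product rule for curves not known to
be differentiable in `L²`. -/
lemma hasDerivAt_inner_of_continuousAt {a b : ℝ → L2Space n} {a' : L2Space n} {x : ℝ}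
    (ha : HasDerivAt a a' x) (ha0 : a x = 0) (hb : ContinuousAt b x) :
    HasDerivAt (fun τ => ⟪a τ, b τ⟫_ℂ) ⟪a', b x⟫_ℂ x := by
  rw [hasDerivAt_iff_tendsto_slope] at ha ⊢
  have h1 : Tendsto (fun τ => ⟪slope a x τ, b τ⟫_ℂ) (𝓝[≠] x) (𝓝 ⟪a', b x⟫_ℂ) :=
    ha.inner (hb.tendsto.mono_left nhdsWithin_le_nhds)
  refine h1.congr fun τ => ?_
  simp only [slope_def_module, ha0, sub_zero, inner_zero_left]
  rw [RCLike.real_smul_eq_coe_smul (K := ℂ), inner_smul_left]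
  simp

/-- The pairing of a weak solution with a localized function with weak Laplacian in `L²`. -/
lemma WeakSol.norm_inner_cutoff_sub_le {C R : ℝ} (hC : 0 ≤ C) (hR : 1 ≤ R)
    {χ θ : EuclideanSpace ℝ (Fin n) → ℂ} (hχ : IsCutoff C R χ) (hθ : IsCutoff C (2 * R) θ)
    {z g : L2Space n}
    (hw : ∀ ψ : EuclideanSpace ℝ (Fin n) → ℂ, IsTest ψ → tsupport ψ ⊆ Metric.ball 0 (6 * R) →
      ⟪toL2 (Laplacian.laplacian ψ), z⟫_ℂ = ⟪toL2 ψ, g⟫_ℂ)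
    {V : EuclideanSpace ℝ (Fin n) → ℂ} {w F : ℝ → L2Space n} (hwc : Continuous w)
    (hFc : Continuous F) {a b A : ℝ} (hws : WeakSol univ a b V w F)
    (hA : ∀ t ∈ Icc a b, ‖w t‖ ≤ A) {s t : ℝ} (hs : s ∈ Icc a b) (ht : t ∈ Icc a b) (hst : s ≤ t) :
    ‖⟪mulOp χ z, w t - w s⟫_ℂ - ∫ τ in s..t, (Complex.I * ⟪mulOp χ g, w τ⟫_ℂ -
        Complex.I * ⟪mulOp χ z, mulOp V (w τ) + F τ⟫_ℂ)‖ ≤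
      (A * ((2 * (√(n * (C + 2)) * C) + C) * (‖z‖ + ‖g‖) / R)) * (t - s) := by
  set κ := (2 * (√(n * (C + 2)) * C) + C) * (‖z‖ + ‖g‖) / R with hκ
  have hR0 : 0 < R := by linarith
  have hA0 : 0 ≤ A := (norm_nonneg _).trans (hA s hs)
  have hκ0 : 0 ≤ κ := by positivity
  have hN : Continuous fun τ => mulOp V (w τ) + F τ := by fun_prop
  obtain ⟨B, hB⟩ := (isCompact_Icc (a := a) (b := b)).exists_bound_of_continuousOn hN.continuousOn
  have hB0 : 0 ≤ B := (norm_nonneg _).trans (hB s hs)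
  apply le_of_forall_pos_le_add
  intro ε hε
  -- `Q` collects all that multiplies the approximation error: `2 * A` bounds `w t - w s`, and `A +
  -- B` bounds the two integrands.
  set Q := 2 * A + (t - s) * (A + B) with hQ
  have hQ0 : 0 ≤ Q := by
    have : 0 ≤ t - s := by linarith
    positivity
  obtain ⟨ψ, hψ, h1, h2⟩ := exists_test_approx hC hR hχ hθ hw (ε := ε / (Q + 1)) (by positivity)
  set ε' := ε / (Q + 1) with hε'
  have hεQ : ε' * Q ≤ ε := by
    rw [hε', div_mul_eq_mul_div, div_le_iff₀ (by linarith)]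
    nlinarith
  have hε0 : 0 < ε' := by positivity
  have e := hws ψ hψ (subset_univ _) s hs t ht
  rw [← inner_sub_right] at e
  have cint : ∀ u k : L2Space n, Continuous fun τ => (Complex.I * ⟪u, w τ⟫_ℂ -
      Complex.I * ⟪k, mulOp V (w τ) + F τ⟫_ℂ) := by
    intro u k
    fun_prop
  -- The weak identity holds exactly for the test function `ψ`; subtracting it leaves only terms
  -- with `ψ - χ z` and `Δψ - χ g`.
  have e2 : ⟪mulOp χ z, w t - w s⟫_ℂ - ∫ τ in s..t, (Complex.I * ⟪mulOp χ g, w τ⟫_ℂ -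
        Complex.I * ⟪mulOp χ z, mulOp V (w τ) + F τ⟫_ℂ) =
      (∫ τ in s..t, (Complex.I * ⟪toL2 (Laplacian.laplacian ψ) - mulOp χ g, w τ⟫_ℂ -
        Complex.I * ⟪toL2 ψ - mulOp χ z, mulOp V (w τ) + F τ⟫_ℂ)) -
        ⟪toL2 ψ - mulOp χ z, w t - w s⟫_ℂ := by
    have : ∀ τ, (Complex.I * ⟪toL2 (Laplacian.laplacian ψ) - mulOp χ g, w τ⟫_ℂ -
        Complex.I * ⟪toL2 ψ - mulOp χ z, mulOp V (w τ) + F τ⟫_ℂ) =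
        (Complex.I * ⟪toL2 (Laplacian.laplacian ψ), w τ⟫_ℂ -
        Complex.I * ⟪toL2 ψ, mulOp V (w τ) + F τ⟫_ℂ) - (Complex.I * ⟪mulOp χ g, w τ⟫_ℂ -
        Complex.I * ⟪mulOp χ z, mulOp V (w τ) + F τ⟫_ℂ) := by
      intro τ
      rw [inner_sub_left, inner_sub_left]
      ring
    simp_rw [this]
    rw [intervalIntegral.integral_sub ((cint _ _).intervalIntegrable _ _)
      ((cint _ _).intervalIntegrable _ _), ← e, inner_sub_left (toL2 ψ)]
    ring
  rw [e2]
  have b1 : ‖∫ τ in s..t, (Complex.I * ⟪toL2 (Laplacian.laplacian ψ) - mulOp χ g, w τ⟫_ℂ -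
        Complex.I * ⟪toL2 ψ - mulOp χ z, mulOp V (w τ) + F τ⟫_ℂ)‖ ≤
        ((ε' + κ) * A + ε' * B) * |t - s| := by
    apply intervalIntegral.norm_integral_le_of_norm_le_const
    intro τ hτ
    rw [uIoc_of_le hst] at hτ
    have hτ' : τ ∈ Icc a b := ⟨hs.1.trans hτ.1.le, hτ.2.trans ht.2⟩
    refine (norm_sub_le _ _).trans ?_
    rw [norm_mul, norm_mul, Complex.norm_I, one_mul, one_mul]
    refine add_le_add ((norm_inner_le_norm _ _).trans ?_) ((norm_inner_le_norm _ _).trans ?_)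
    · exact mul_le_mul h2 (hA τ hτ') (norm_nonneg _) (by positivity)
    · exact mul_le_mul h1 (hB τ hτ') (norm_nonneg _) (by positivity)
  have b2 : ‖⟪toL2 ψ - mulOp χ z, w t - w s⟫_ℂ‖ ≤ ε' * (2 * A) := by
    refine (norm_inner_le_norm _ _).trans (mul_le_mul h1 ?_ (norm_nonneg _) hε0.le)
    have := norm_sub_le (w t) (w s)
    linarith [hA t ht, hA s hs]
  rw [abs_of_nonneg (by linarith)] at b1
  calc _ ≤ _ := norm_sub_le _ _
    _ ≤ ((ε' + κ) * A + ε' * B) * (t - s) + ε' * (2 * A) := add_le_add b1 b2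
    _ = A * κ * (t - s) + ε' * Q := by rw [hQ]; ring
    _ ≤ _ := by gcongr

/-- The time average of a local weak solution has its weak Laplacian in `L²`. -/
lemma WeakSol.inner_laplacian_integral {Ω : Set (EuclideanSpace ℝ (Fin n))} {a b : ℝ}
    {V : EuclideanSpace ℝ (Fin n) → ℂ} {v G : ℝ → L2Space n} (h : WeakSol Ω a b V v G)
    (hv : Continuous v) (hG : Continuous G) {s t : ℝ} (hs : s ∈ Icc a b) (ht : t ∈ Icc a b)
    {ψ : EuclideanSpace ℝ (Fin n) → ℂ} (hψ : IsTest ψ) (hψs : tsupport ψ ⊆ Ω) :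
    ⟪toL2 (Laplacian.laplacian ψ), ∫ τ in s..t, v τ⟫_ℂ =
      ⟪toL2 ψ, (-Complex.I) • (v t - v s) + mulOp V (∫ τ in s..t, v τ) + ∫ τ in s..t, G τ⟫_ℂ := by
  -- Integration in time turns `∂ₜ v` into the increment `v t - v s`, which lies in `L²`; the
  -- equation can then be solved for the Laplacian.
  have e := h ψ hψ hψs s hs t ht
  have c1 : Continuous fun τ => Complex.I * ⟪toL2 (Laplacian.laplacian ψ), v τ⟫_ℂ := by fun_prop
  have c2 : Continuous fun τ => Complex.I * ⟪toL2 ψ, mulOp V (v τ) + G τ⟫_ℂ := by fun_prop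
  have c3 : Continuous fun τ => mulOp V (v τ) := by fun_prop
  have hi : ∀ (u : L2Space n) (f : ℝ → L2Space n), Continuous f →
      ∫ τ in s..t, ⟪u, f τ⟫_ℂ = ⟪u, ∫ τ in s..t, f τ⟫_ℂ := fun u f hf =>
    (innerSL ℂ u).intervalIntegral_comp_comm (hf.intervalIntegrable _ _)
  rw [intervalIntegral.integral_sub (c1.intervalIntegrable _ _)
    (c2.intervalIntegrable _ _), intervalIntegral.integral_const_mul,
    intervalIntegral.integral_const_mul, hi _ _ hv, hi _ _ (by fun_prop),
    intervalIntegral.integral_add (c3.intervalIntegrable _ _) (hG.intervalIntegrable _ _),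
    (mulOp V).intervalIntegral_comp_comm (hv.intervalIntegrable _ _), ← inner_sub_right] at e
  rw [add_assoc, inner_add_right, inner_smul_right, e]
  linear_combination (⟪toL2 (Laplacian.laplacian ψ), ∫ τ in s..t, v τ⟫_ℂ -
    ⟪toL2 ψ, mulOp V (∫ τ in s..t, v τ) + ∫ τ in s..t, G τ⟫_ℂ) * Complex.I_mul_I

/-- The approximate pairing identity between a global weak solution and the time average of a local
weak solution of the adjoint equation. -/
lemma norm_pairing_cutoff_le {C R : ℝ} (hC : 0 ≤ C) (hR : 1 ≤ R)
    {χ θ : EuclideanSpace ℝ (Fin n) → ℂ} (hχ : IsCutoff C R χ) (hθ : IsCutoff C (2 * R) θ)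
    {V : EuclideanSpace ℝ (Fin n) → ℂ} (hV : MemLp V ⊤ volume)
    {w F v G : ℝ → L2Space n} (hwc : Continuous w) (hFc : Continuous F) (hvc : Continuous v)
    (hGc : Continuous G) {T h A K L M : ℝ} (hT : 0 ≤ T) (hh : 0 ≤ h)
    (hw : WeakSol univ 0 T V w F)
    (hv : WeakSol (Metric.ball 0 (6 * R)) 0 (T + h) (fun x => conj (V x)) v G)
    (hA : ∀ t ∈ Icc 0 T, ‖w t‖ ≤ A) (hK : ∀ t ∈ Icc 0 (T + h), ‖v t‖ ≤ K)
    (hL : ∀ t ∈ Icc 0 (T + h), ‖G t‖ ≤ L)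
    (hM : ∀ f : L2Space n, ‖mulOp (fun x => conj (V x)) f‖ ≤ M * ‖f‖) (hM0 : 0 ≤ M) :
    ‖⟪mulOp χ (∫ τ in T..T + h, v τ), w T⟫_ℂ - ⟪mulOp χ (∫ τ in (0 : ℝ)..h, v τ), w 0⟫_ℂ -
      ∫ t in (0 : ℝ)..T, (Complex.I * ⟪mulOp χ (∫ τ in t..t + h, G τ), w t⟫_ℂ -
        Complex.I * ⟪mulOp χ (∫ τ in t..t + h, v τ), F t⟫_ℂ)‖ ≤
      (A * ((2 * (√(n * (C + 2)) * C) + C) * (h * K + (2 * K + M * (h * K) + h * L)) / R)) * T := by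
  have hR0 : 0 < R := by linarith
  have hA0 : 0 ≤ A := (norm_nonneg _).trans (hA 0 ⟨le_rfl, hT⟩)
  have hK0 : 0 ≤ K := (norm_nonneg _).trans (hK 0 ⟨le_rfl, by linarith⟩)
  have hL0 : 0 ≤ L := (norm_nonneg _).trans (hL 0 ⟨le_rfl, by linarith⟩)
  have hprim : ∀ f : ℝ → L2Space n, Continuous f → ∀ t,
      HasDerivAt (fun t => ∫ τ in t..t + h, f τ) (f (t + h) - f t) t := by
    intro f hf t
    have h1 : ∀ t, HasDerivAt (fun t => ∫ τ in (0 : ℝ)..t, f τ) (f t) t := fun t =>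
      intervalIntegral.integral_hasDerivAt_right (hf.intervalIntegrable _ _)
        hf.stronglyMeasurable.stronglyMeasurableAtFilter hf.continuousAt
    have h2 := ((h1 (t + h)).comp_add_const t h).sub (h1 t)
    refine h2.congr_of_eventuallyEq (Eventually.of_forall fun s => ?_)
    exact (intervalIntegral.integral_interval_sub_left (hf.intervalIntegrable _ _)
      (hf.intervalIntegrable _ _)).symm
  set z : ℝ → L2Space n := fun t => ∫ τ in t..t + h, v τ with hz
  set Γ : ℝ → L2Space n := fun t => ∫ τ in t..t + h, G τ with hΓ
  have hz' : ∀ t, HasDerivAt z (v (t + h) - v t) t := hprim v hvc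
  have hzc : Continuous z := continuous_iff_continuousAt.2 fun t => (hz' t).continuousAt
  have hΓc : Continuous Γ := continuous_iff_continuousAt.2 fun t => (hprim G hGc t).continuousAt
  set P : ℝ → ℂ := fun t => Complex.I * ⟪mulOp χ (Γ t), w t⟫_ℂ - Complex.I * ⟪mulOp χ (z t), F t⟫_ℂ
    with hP
  have hPc : Continuous P := by fun_prop
  set κ := A * ((2 * (√(n * (C + 2)) * C) + C) * (h * K + (2 * K + M * (h * K) + h * L)) / R)
    with hκ
  have hκ0 : 0 ≤ κ := by positivity
  have hPd : ∀ x t, HasDerivAt (fun t => ∫ τ in x..t, P τ) (P t) t := fun x t =>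
    intervalIntegral.integral_hasDerivAt_right (hPc.intervalIntegrable _ _)
      hPc.stronglyMeasurable.stronglyMeasurableAtFilter hPc.continuousAt
  -- Without the cutoff `f` would be constant by the two equations. With it, increments of `f` are
  -- bounded by `κ` times the time step up to `o` of that step, so the total drift is at most `κ *
  -- T`.
  set f : ℝ → ℂ := fun t => ⟪mulOp χ (z t), w t⟫_ℂ - ∫ τ in (0 : ℝ)..t, P τ with hf
  have hmain := norm_sub_le_of_local_bound (f := f) (κ := κ) hT ?_ ?_
  · refine le_of_eq_of_le ?_ hmain
    simp only [hf, hz, intervalIntegral.integral_same, zero_add, sub_zero]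
    congr 1
    ring
  · apply Continuous.continuousOn
    have : Continuous fun t => ∫ τ in (0 : ℝ)..t, P τ :=
      continuous_iff_continuousAt.2 fun t => (hPd 0 t).continuousAt
    fun_prop
  · intro x hx
    -- The weak Laplacian of `z x` on the ball of radius `6R`, as given by
    -- `WeakSol.inner_laplacian_integral`.
    set g : L2Space n := (-Complex.I) • (v (x + h) - v x) + mulOp (fun y => conj (V y)) (z x) + Γ x
      with hg
    set e : ℝ → ℂ := fun τ => Complex.I * ⟪mulOp χ g, w τ⟫_ℂ -
        Complex.I * ⟪mulOp χ (z x), mulOp V (w τ) + F τ⟫_ℂ with he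
    have hec : Continuous e := by fun_prop
    have hed : HasDerivAt (fun t => ∫ τ in x..t, e τ) (e x) x :=
      intervalIntegral.integral_hasDerivAt_right (hec.intervalIntegrable _ _)
        hec.stronglyMeasurable.stronglyMeasurableAtFilter hec.continuousAt
    have ha : HasDerivAt (fun τ => mulOp χ (z τ - z x)) (mulOp χ (v (x + h) - v x)) x :=
      ((mulOp χ).restrictScalars ℝ).hasFDerivAt.comp_hasDerivAt x ((hz' x).sub_const (z x))
    have hd := ((hasDerivAt_inner_of_continuousAt ha (by simp) hwc.continuousAt).add hed).sub
      (hPd x x)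
    -- The derivative at `x` vanishes: the increment of `v` in `z'` cancels the one in `g`, the
    -- potential terms cancel by adjointness, and what is left of `e x` is `P x`.
    refine ⟨fun t => ⟪mulOp χ (z t - z x), w t⟫_ℂ + (∫ τ in x..t, e τ) - ∫ τ in x..t, P τ, ?_, ?_, ?_⟩
    · convert! hd using 1
      have hcomm : ∀ k : L2Space n, ⟪mulOp χ (mulOp (fun y => conj (V y)) (z x)), k⟫_ℂ =
          ⟪mulOp χ (z x), mulOp V k⟫_ℂ := by
        intro k
        rw [mulOp_mulOp (hχ.isTest.memLp ⊤) hV.conj_top]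
        have : (fun y => χ y * conj (V y)) = fun y => conj (V y) * χ y := by
          ext y
          ring
        rw [this, ← mulOp_mulOp hV.conj_top (hχ.isTest.memLp ⊤), inner_mulOp_left hV.conj_top]
        simp
      simp only [he, hP, hg, map_add, map_smul, inner_add_left, inner_add_right, inner_smul_left,
        hcomm, map_neg, Complex.conj_I, neg_neg]
      linear_combination (-⟪mulOp χ (v (x + h) - v x), w x⟫_ℂ) * Complex.I_mul_I
    · simp
    · intro τ hτ
      have hx' : x ∈ Icc 0 T := ⟨hx.1, hx.2.le⟩
      have hτ' : τ ∈ Icc 0 T := ⟨hx.1.trans hτ.1.le, hτ.2⟩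
      have hxh : x ∈ Icc 0 (T + h) := ⟨hx.1, by linarith [hx.2]⟩
      have hxh' : x + h ∈ Icc 0 (T + h) := ⟨by linarith [hx.1], by linarith [hx.2]⟩
      have h1 := hw.norm_inner_cutoff_sub_le hC hR hχ hθ (z := z x) (g := g)
        (fun ψ hψ hs => hv.inner_laplacian_integral hvc hGc hxh hxh' hψ hs) hwc hFc hA hx' hτ' hτ.1.le
      have hsub : ∀ t, t ∈ uIoc x (x + h) → t ∈ Icc 0 (T + h) := by
        intro t ht
        rw [uIoc_of_le (by linarith)] at ht
        exact ⟨hx.1.trans ht.1.le, ht.2.trans hxh'.2⟩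
      have hzn : ‖z x‖ ≤ h * K := by
        have := intervalIntegral.norm_integral_le_of_norm_le_const (a := x) (b := x + h) (f := v)
          (C := K) (fun t ht => hK t (hsub t ht))
        rw [add_sub_cancel_left, abs_of_nonneg hh, mul_comm] at this
        exact this
      have hΓn : ‖Γ x‖ ≤ h * L := by
        have := intervalIntegral.norm_integral_le_of_norm_le_const (a := x) (b := x + h) (f := G)
          (C := L) (fun t ht => hL t (hsub t ht))
        rw [add_sub_cancel_left, abs_of_nonneg hh, mul_comm] at this
        exact this
      have hgn : ‖g‖ ≤ 2 * K + M * (h * K) + h * L := by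
        have a1 : ‖(-Complex.I) • (v (x + h) - v x)‖ ≤ 2 * K := by
          rw [norm_smul, norm_neg, Complex.norm_I, one_mul]
          have := norm_sub_le (v (x + h)) (v x)
          linarith [hK _ hxh, hK _ hxh']
        have a2 : ‖mulOp (fun y => conj (V y)) (z x)‖ ≤ M * (h * K) := (hM _).trans (by gcongr)
        refine norm_add₃_le.trans ?_
        linarith
      have hκ' : (A * ((2 * (√(n * (C + 2)) * C) + C) * (‖z x‖ + ‖g‖) / R)) * (τ - x) ≤
          κ * (τ - x) := by
        have : 0 ≤ τ - x := by linarith [hτ.1]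
        rw [hκ]
        gcongr
      -- Split so that `z` moves against `w τ`, where `z` is differentiable, and `w` moves against
      -- the frozen `z x`, where the cutoff estimate applies.
      have e3 : f τ - f x = (⟪mulOp χ (z τ - z x), w τ⟫_ℂ + (∫ τ in x..τ, e τ) - ∫ τ in x..τ, P τ) +
          (⟪mulOp χ (z x), w τ - w x⟫_ℂ - ∫ τ in x..τ, e τ) := by
        have : (∫ t in (0 : ℝ)..τ, P t) - ∫ t in (0 : ℝ)..x, P t = ∫ t in x..τ, P t :=
          intervalIntegral.integral_interval_sub_left (hPc.intervalIntegrable _ _)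
            (hPc.intervalIntegrable _ _)
        simp only [hf]
        rw [← this, map_sub, inner_sub_left, inner_sub_right]
        ring
      rw [e3]
      exact (norm_add_le _ _).trans (add_le_add le_rfl (h1.trans hκ'))

end WeakSolutions

/-! ### The free Schrödinger group as a Fourier multiplier -/

section FreePropagator

variable {n : ℕ}

/-- Dominated convergence in `L²`. -/
lemma tendsto_toL2_of_dominated {ι : Type*} {l : Filter ι} [l.IsCountablyGenerated]
    {h : ι → EuclideanSpace ℝ (Fin n) → ℂ} {h0 : EuclideanSpace ℝ (Fin n) → ℂ}
    {B : EuclideanSpace ℝ (Fin n) → ℝ} (hB : MemLp B 2 volume)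
    (hm : ∀ᶠ i in l, AEStronglyMeasurable (h i) volume) (hm0 : AEStronglyMeasurable h0 volume)
    (hle : ∀ᶠ i in l, ∀ᵐ x, ‖h i x‖ ≤ B x) (hle0 : ∀ᵐ x, ‖h0 x‖ ≤ B x)
    (hlim : ∀ᵐ x, Tendsto (fun i => h i x) l (𝓝 (h0 x))) :
    Tendsto (fun i => toL2 (h i)) l (𝓝 (toL2 h0)) := by
  have hmem : ∀ᶠ i in l, MemLp (h i) 2 volume := by
    filter_upwards [hm, hle] with i h1 h2
    exact hB.mono h1 (h2.mono fun x hx => hx.trans (le_abs_self _))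
  have hmem0 : MemLp h0 2 volume := hB.mono hm0 (hle0.mono fun x hx => hx.trans (le_abs_self _))
  rw [tendsto_iff_norm_sub_tendsto_zero]
  have hsq : ∀ᶠ i in l, ‖toL2 (h i) - toL2 h0‖ ^ 2 = ∫ x, ‖h i x - h0 x‖ ^ 2 := by
    filter_upwards [hmem] with i hi
    rw [norm_sq_L2]
    apply integral_congr_ae
    filter_upwards [Lp.coeFn_sub (toL2 (h i)) (toL2 h0), coeFn_toL2 hi, coeFn_toL2 hmem0]
      with x h1 h2 h3
    rw [h1, Pi.sub_apply, h2, h3]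
  have hint : Tendsto (fun i => ∫ x, ‖h i x - h0 x‖ ^ 2) l
      (𝓝 (∫ _ : EuclideanSpace ℝ (Fin n), (0 : ℝ))) := by
    apply tendsto_integral_filter_of_dominated_convergence (fun x => 4 * B x ^ 2)
    · filter_upwards [hm] with i h1
      exact ((h1.sub hm0).norm.aemeasurable.pow_const 2).aestronglyMeasurable
    · filter_upwards [hle] with i h1
      filter_upwards [h1, hle0] with x h2 h3
      rw [Real.norm_of_nonneg (by positivity)]
      have h4 : ‖h i x - h0 x‖ ≤ 2 * B x := by
        have := norm_sub_le (h i x) (h0 x)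
        linarith
      calc _ ≤ (2 * B x) ^ 2 := by gcongr
        _ = _ := by ring
    · exact hB.integrable_sq.const_mul 4
    · filter_upwards [hlim] with x hx
      have h5 := ((hx.sub_const (h0 x)).norm).pow 2
      simpa using h5
  rw [integral_zero] at hint
  have h6 : Tendsto (fun i => ‖toL2 (h i) - toL2 h0‖ ^ 2) l (𝓝 0) :=
    hint.congr' (hsq.mono fun i hi => hi.symm)
  have h7 := h6.sqrt
  simpa using h7

/-- The multiplier `exp(-i t |2π ξ|²)` of the free Schrödinger evolution. -/
noncomputable def freePhase (t : ℝ) (ξ : EuclideanSpace ℝ (Fin n)) : ℂ :=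
  Complex.exp (((-(t * ((2 * Real.pi) ^ 2 * ‖ξ‖ ^ 2)) : ℝ) : ℂ) * Complex.I)

lemma norm_freePhase (t : ℝ) (ξ : EuclideanSpace ℝ (Fin n)) : ‖freePhase t ξ‖ = 1 :=
  Complex.norm_exp_ofReal_mul_I _

lemma continuous_freePhase (t : ℝ) :
    Continuous (freePhase t : EuclideanSpace ℝ (Fin n) → ℂ) := by
  unfold freePhase
  fun_prop

lemma memLp_freePhase (t : ℝ) :
    MemLp (freePhase t : EuclideanSpace ℝ (Fin n) → ℂ) ⊤ volume :=
  memLp_top_of_bound (continuous_freePhase t).aestronglyMeasurable 1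
    (Eventually.of_forall fun ξ => (norm_freePhase t ξ).le)

lemma conj_freePhase (t : ℝ) (ξ : EuclideanSpace ℝ (Fin n)) :
    conj (freePhase t ξ) = freePhase (-t) ξ := by
  rw [freePhase, freePhase, ← Complex.exp_conj, map_mul, Complex.conj_ofReal, Complex.conj_I]
  congr 1
  push_cast
  ring

lemma freePhase_mul_neg (t : ℝ) (ξ : EuclideanSpace ℝ (Fin n)) :
    freePhase t ξ * freePhase (-t) ξ = 1 := by
  rw [← conj_freePhase, Complex.mul_conj, Complex.normSq_eq_norm_sq, norm_freePhase]
  simp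

/-- The free Schrödinger evolution `exp(itΔ)` on `L²`. -/
noncomputable def freeProp (t : ℝ) : L2Space n →L[ℂ] L2Space n :=
  ((Lp.fourierTransformₗᵢ (EuclideanSpace ℝ (Fin n)) ℂ).symm.toContinuousLinearEquiv :
      L2Space n →L[ℂ] L2Space n) ∘L mulOp (freePhase t) ∘L
    ((Lp.fourierTransformₗᵢ (EuclideanSpace ℝ (Fin n)) ℂ).toContinuousLinearEquiv :
      L2Space n →L[ℂ] L2Space n)

lemma freeProp_apply (t : ℝ) (f : L2Space n) :
    freeProp t f = (Lp.fourierTransformₗᵢ (EuclideanSpace ℝ (Fin n)) ℂ).symm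
      (mulOp (freePhase t) (Lp.fourierTransformₗᵢ (EuclideanSpace ℝ (Fin n)) ℂ f)) := rfl

lemma norm_freeProp_le (t : ℝ) (f : L2Space n) : ‖freeProp t f‖ ≤ ‖f‖ := by
  rw [freeProp_apply, LinearIsometryEquiv.norm_map]
  have h := norm_mulOp_apply_le (memLp_freePhase t)
    (Eventually.of_forall fun ξ => (norm_freePhase t ξ).le)
    (Lp.fourierTransformₗᵢ (EuclideanSpace ℝ (Fin n)) ℂ f)
  rwa [one_mul, LinearIsometryEquiv.norm_map] at h

lemma mulOp_one (f : L2Space n) : mulOp (fun _ => 1) f = f := by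
  apply Lp.ext
  filter_upwards [coeFn_mulOp (memLp_top_const (1 : ℂ)) f] with x h
  rw [h, one_mul]

lemma freeProp_freeProp_neg (t : ℝ) (f : L2Space n) : freeProp t (freeProp (-t) f) = f := by
  rw [freeProp_apply, freeProp_apply, LinearIsometryEquiv.apply_symm_apply,
    mulOp_mulOp (memLp_freePhase t) (memLp_freePhase (-t))]
  simp only [freePhase_mul_neg]
  rw [mulOp_one, LinearIsometryEquiv.symm_apply_apply]

lemma inner_freeProp_left (t : ℝ) (f g : L2Space n) :
    ⟪freeProp t f, g⟫_ℂ = ⟪f, freeProp (-t) g⟫_ℂ := by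
  rw [freeProp_apply, freeProp_apply, ← LinearIsometryEquiv.inner_map_map
    (Lp.fourierTransformₗᵢ (EuclideanSpace ℝ (Fin n)) ℂ), LinearIsometryEquiv.apply_symm_apply,
    inner_mulOp_left (memLp_freePhase t)]
  simp only [conj_freePhase]
  rw [← LinearIsometryEquiv.inner_map_map (Lp.fourierTransformₗᵢ (EuclideanSpace ℝ (Fin n)) ℂ) f,
    LinearIsometryEquiv.apply_symm_apply]

lemma continuous_freePhase_time (ξ : EuclideanSpace ℝ (Fin n)) :
    Continuous fun t => freePhase t ξ := by
  unfold freePhase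
  fun_prop

lemma continuous_freeProp_apply (f : L2Space n) : Continuous fun t => freeProp t f := by
  simp_rw [freeProp_apply]
  apply (LinearIsometryEquiv.continuous _).comp
  set k := Lp.fourierTransformₗᵢ (EuclideanSpace ℝ (Fin n)) ℂ f
  rw [continuous_iff_continuousAt]
  intro s
  simp_rw [ContinuousAt, mulOp_eq_toL2 (memLp_freePhase _)]
  apply tendsto_toL2_of_dominated (B := fun x => ‖k x‖) (Lp.memLp k).norm
  · exact Eventually.of_forall fun t =>
      (continuous_freePhase t).aestronglyMeasurable.mul (Lp.aestronglyMeasurable k)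
  · exact (continuous_freePhase s).aestronglyMeasurable.mul (Lp.aestronglyMeasurable k)
  · exact Eventually.of_forall fun t => Eventually.of_forall fun x => by
      rw [norm_mul, norm_freePhase, one_mul]
  · exact Eventually.of_forall fun x => by rw [norm_mul, norm_freePhase, one_mul]
  · exact Eventually.of_forall fun x =>
      ((continuous_freePhase_time x).tendsto s).mul_const _

/-- Strong continuity together with the uniform operator bound `1` gives joint continuity; the group
is not assumed continuous in operator norm. -/
lemma continuous_freeProp {y : ℝ → L2Space n} (hy : Continuous y) {c : ℝ → ℝ} (hc : Continuous c) :
    Continuous fun t => freeProp (c t) (y t) := by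
  rw [continuous_iff_continuousAt]
  intro s
  rw [ContinuousAt, tendsto_iff_norm_sub_tendsto_zero]
  have h1 : Tendsto (fun t => ‖y t - y s‖ + ‖freeProp (c t) (y s) - freeProp (c s) (y s)‖) (𝓝 s)
      (𝓝 0) := by
    have h2 := (tendsto_iff_norm_sub_tendsto_zero.1 (hy.tendsto s)).add
      (tendsto_iff_norm_sub_tendsto_zero.1
        (((continuous_freeProp_apply (y s)).comp hc).tendsto s))
    simpa using h2
  refine squeeze_zero (fun _ => norm_nonneg _) (fun t => ?_) h1
  have e : freeProp (c t) (y t) - freeProp (c s) (y s) = freeProp (c t) (y t - y s) +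
      (freeProp (c t) (y s) - freeProp (c s) (y s)) := by
    rw [map_sub]
    abel
  rw [e]
  exact (norm_add_le _ _).trans (add_le_add (norm_freeProp_le _ _) le_rfl)

open FourierTransform SchwartzMap in
-- A test function is a Schwartz function. There `Δ` is a Fourier multiplier, and the `L²` transform
-- agrees with the Schwartz one.
lemma fourier_laplacian_test {ψ : EuclideanSpace ℝ (Fin n) → ℂ} (hψ : IsTest ψ) :
    Lp.fourierTransformₗᵢ (EuclideanSpace ℝ (Fin n)) ℂ (toL2 (Laplacian.laplacian ψ)) =ᵐ[volume]
      fun ξ => -((2 * Real.pi) ^ 2 * ‖ξ‖ ^ 2 : ℝ) *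
        Lp.fourierTransformₗᵢ (EuclideanSpace ℝ (Fin n)) ℂ (toL2 ψ) ξ := by
  set f : 𝓢(EuclideanSpace ℝ (Fin n), ℂ) := hψ.hasCompactSupport.toSchwartzMap hψ.contDiff with hf
  have e1 : toL2 ψ = f.toLp 2 := by
    symm
    apply eq_toL2_of_ae
    filter_upwards [f.coeFn_toLp 2] with x hx
    rw [hx]
    rfl
  have e2 : toL2 (Laplacian.laplacian ψ) = (Laplacian.laplacian f).toLp 2 := by
    symm
    apply eq_toL2_of_ae
    filter_upwards [(Laplacian.laplacian f).coeFn_toLp 2] with x hx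
    rw [hx, SchwartzMap.laplacian_apply]
    rfl
  have e3 : Lp.fourierTransformₗᵢ (EuclideanSpace ℝ (Fin n)) ℂ (f.toLp 2) = (𝓕 f).toLp 2 :=
    SchwartzMap.toLp_fourier_eq f
  have e4 : Lp.fourierTransformₗᵢ (EuclideanSpace ℝ (Fin n)) ℂ ((Laplacian.laplacian f).toLp 2) =
    (𝓕 (Laplacian.laplacian f)).toLp 2 := SchwartzMap.toLp_fourier_eq _
  have hg : (fun x : EuclideanSpace ℝ (Fin n) => ‖x‖ ^ 2).HasTemperateGrowth := by fun_prop
  have e5 : ∀ ξ, 𝓕 (Laplacian.laplacian f) ξ = -((2 * Real.pi) ^ 2 * ‖ξ‖ ^ 2 : ℝ) * 𝓕 f ξ := by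
    intro ξ
    have h1 := SchwartzMap.laplacian_eq_fourierMultiplierCLM f
    rw [SchwartzMap.fourierMultiplierCLM_apply] at h1
    have h2 : 𝓕 (Laplacian.laplacian f) =
        -(2 * Real.pi) ^ 2 • SchwartzMap.smulLeftCLM ℂ (fun x => ‖x‖ ^ 2) (𝓕 f) := by
      rw [h1, FourierTransform.fourier_smul, FourierTransform.fourier_fourierInv_eq]
    rw [h2, _root_.smul_apply, SchwartzMap.smulLeftCLM_apply_apply hg]
    simp only [Complex.real_smul]
    push_cast
    ring
  rw [e1, e2, e3, e4]
  filter_upwards [(𝓕 (Laplacian.laplacian f)).coeFn_toLp 2, (𝓕 f).coeFn_toLp 2] with ξ h1 h2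
  rw [h1, h2, e5]

lemma hasDerivAt_freePhase (t : ℝ) (ξ : EuclideanSpace ℝ (Fin n)) :
    HasDerivAt (fun s => freePhase s ξ)
      (Complex.I * (-((2 * Real.pi) ^ 2 * ‖ξ‖ ^ 2 : ℝ) * freePhase t ξ)) t := by
  unfold freePhase
  have h1 : HasDerivAt (fun s : ℝ => -(s * ((2 * Real.pi) ^ 2 * ‖ξ‖ ^ 2)))
      (-((2 * Real.pi) ^ 2 * ‖ξ‖ ^ 2)) t := (hasDerivAt_mul_const _).fun_neg
  have h2 := ((h1.ofReal_comp).mul_const Complex.I).cexp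
  convert! h2 using 1
  push_cast
  ring

/-- The mean value inequality, uniformly in both times. For a test function `ψ`, it dominates the
difference quotients by the transform of `Δψ`, which is square integrable. -/
lemma norm_slope_freePhase_le (t s : ℝ) (ξ : EuclideanSpace ℝ (Fin n)) :
    ‖slope (fun s => freePhase s ξ) t s‖ ≤ (2 * Real.pi) ^ 2 * ‖ξ‖ ^ 2 := by
  have hb : ∀ x ∈ (univ : Set ℝ), ‖(Complex.I * (-((2 * Real.pi) ^ 2 * ‖ξ‖ ^ 2 : ℝ) *
      freePhase x ξ))‖ ≤ (2 * Real.pi) ^ 2 * ‖ξ‖ ^ 2 := by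
    intro x _
    rw [norm_mul, norm_mul, Complex.norm_I, norm_freePhase, norm_neg, Complex.norm_real,
      Real.norm_of_nonneg (by positivity), one_mul, mul_one]
  have h := convex_univ.norm_image_sub_le_of_norm_hasDerivWithin_le
    (fun x _ => (hasDerivAt_freePhase x ξ).hasDerivWithinAt) hb (mem_univ t) (mem_univ s)
  rw [slope_def_module, norm_smul, norm_inv]
  rcases eq_or_ne s t with rfl | hst
  · simp
    positivity
  · rw [inv_mul_le_iff₀ (norm_pos_iff.2 (sub_ne_zero.2 hst)), mul_comm]
    exact h

/-- The free evolution of a test function is differentiable in time. -/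
lemma hasDerivAt_freeProp_test {ψ : EuclideanSpace ℝ (Fin n) → ℂ} (hψ : IsTest ψ) (t : ℝ) :
    HasDerivAt (fun s => freeProp s (toL2 ψ))
      (freeProp t (Complex.I • toL2 (Laplacian.laplacian ψ))) t := by
  simp_rw [freeProp_apply]
  set U := Lp.fourierTransformₗᵢ (EuclideanSpace ℝ (Fin n)) ℂ with hU
  set k := U (toL2 ψ) with hk
  set k' := U (toL2 (Laplacian.laplacian ψ)) with hk'
  have hkk : k' =ᵐ[volume] fun ξ => -((2 * Real.pi) ^ 2 * ‖ξ‖ ^ 2 : ℝ) * k ξ :=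
    fourier_laplacian_test hψ
  suffices h : HasDerivAt (fun s => mulOp (freePhase s) k)
      (mulOp (freePhase t) (Complex.I • k')) t by
    have := (U.symm.toContinuousLinearEquiv : L2Space n →L[ℂ] L2Space n).restrictScalars ℝ
      |>.hasFDerivAt.comp_hasDerivAt t h
    rw [map_smul U]
    exact this
  rw [hasDerivAt_iff_tendsto_slope]
  have es : ∀ s, slope (fun s => mulOp (freePhase s) k) t s =
      toL2 (fun ξ => slope (fun s => freePhase s ξ) t s * k ξ) := by
    intro s
    apply eq_toL2_of_ae
    rw [slope_def_module]
    filter_upwards [Lp.coeFn_smul (s - t)⁻¹ (mulOp (freePhase s) k - mulOp (freePhase t) k),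
      Lp.coeFn_sub (mulOp (freePhase s) k) (mulOp (freePhase t) k),
      coeFn_mulOp (memLp_freePhase s) k, coeFn_mulOp (memLp_freePhase t) k] with ξ h1 h2 h3 h4
    rw [h1, Pi.smul_apply, h2, Pi.sub_apply, h3, h4, slope_def_module, smul_mul_assoc, sub_mul]
  have e0 : mulOp (freePhase t) (Complex.I • k') = toL2 (fun ξ =>
      (Complex.I * (-((2 * Real.pi) ^ 2 * ‖ξ‖ ^ 2 : ℝ) * freePhase t ξ)) * k ξ) := by
    apply eq_toL2_of_ae
    filter_upwards [coeFn_mulOp (memLp_freePhase t) (Complex.I • k'), Lp.coeFn_smul Complex.I k',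
      hkk] with ξ h1 h2 h3
    rw [h1, h2, Pi.smul_apply, h3, smul_eq_mul]
    ring
  rw [e0, funext es]
  apply tendsto_toL2_of_dominated (B := fun x => ‖k' x‖) (Lp.memLp k').norm
  · refine Eventually.of_forall fun s => ?_
    have : Continuous fun ξ : EuclideanSpace ℝ (Fin n) => slope (fun s => freePhase s ξ) t s := by
      have e : (fun ξ : EuclideanSpace ℝ (Fin n) => slope (fun s => freePhase s ξ) t s) =
          fun ξ => (s - t)⁻¹ • (freePhase s ξ - freePhase t ξ) :=
        funext fun ξ => slope_def_module _ _ _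
      rw [e]
      exact ((continuous_freePhase s).sub (continuous_freePhase t)).const_smul (s - t)⁻¹
    exact this.aestronglyMeasurable.mul (Lp.aestronglyMeasurable k)
  · refine AEStronglyMeasurable.mul (Continuous.aestronglyMeasurable ?_)
      (Lp.aestronglyMeasurable k)
    have := continuous_freePhase (n := n) t
    fun_prop
  · refine Eventually.of_forall fun s => ?_
    filter_upwards [hkk] with ξ h
    rw [h, norm_mul, norm_mul, norm_neg, Complex.norm_real, Real.norm_of_nonneg (by positivity)]
    gcongr
    exact norm_slope_freePhase_le t s ξ
  · filter_upwards [hkk] with ξ h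
    rw [h, norm_mul, norm_mul, norm_mul, norm_mul, Complex.norm_I, norm_freePhase, one_mul, mul_one]
  · exact Eventually.of_forall fun ξ =>
      (hasDerivAt_iff_tendsto_slope.1 (hasDerivAt_freePhase t ξ)).mul_const _

end FreePropagator

/-! ### Linear integral equations in a Banach space -/

section LinearEvolution

/-- Integrating the weight `exp (l |t - t₀|)` gains a factor `1 / l` on either side of `t₀`. This
makes the Picard map a contraction on the whole time axis at once. -/
lemma norm_integral_le_exp_weight {E : Type*} [NormedAddCommGroup E] [NormedSpace ℝ E]
    {u : ℝ → E} {c l t₀ : ℝ} (hc : 0 ≤ c) (hl : 0 < l)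
    (h : ∀ s, ‖u s‖ ≤ c * Real.exp (l * |s - t₀|)) (t : ℝ) :
    ‖∫ s in t₀..t, u s‖ ≤ c / l * Real.exp (l * |t - t₀|) := by
  have hcl : 0 ≤ c / l := by positivity
  rcases le_total t₀ t with ht | ht
  · have hd : ∀ s ∈ uIcc t₀ t, HasDerivAt (fun s => c / l * Real.exp (l * (s - t₀)))
        (c * Real.exp (l * (s - t₀))) s := by
      intro s _
      have h1 : HasDerivAt (fun s => l * (s - t₀)) l s := by
        simpa using ((hasDerivAt_id s).sub_const t₀).const_mul l
      convert! (h1.exp).const_mul (c / l) using 1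
      field_simp
    have hi := intervalIntegral.integral_eq_sub_of_hasDerivAt hd
      (Continuous.intervalIntegrable (by fun_prop) _ _)
    have h2 : ‖∫ s in t₀..t, u s‖ ≤ ∫ s in t₀..t, c * Real.exp (l * (s - t₀)) := by
      apply intervalIntegral.norm_integral_le_of_norm_le ht _
        (Continuous.intervalIntegrable (by fun_prop) _ _)
      refine Eventually.of_forall fun s hs => ?_
      have := h s
      rwa [abs_of_nonneg (by linarith [hs.1])] at this
    rw [hi] at h2
    rw [abs_of_nonneg (by linarith)]
    refine h2.trans ?_
    simp only [sub_self, mul_zero, Real.exp_zero, mul_one]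
    linarith
  · have hd : ∀ s ∈ uIcc t t₀, HasDerivAt (fun s => -(c / l) * Real.exp (l * (t₀ - s)))
        (c * Real.exp (l * (t₀ - s))) s := by
      intro s _
      have h1 : HasDerivAt (fun s => l * (t₀ - s)) (-l) s := by
        simpa using ((hasDerivAt_id s).const_sub t₀).const_mul l
      convert! (h1.exp).const_mul (-(c / l)) using 1
      field_simp
    have hi := intervalIntegral.integral_eq_sub_of_hasDerivAt hd
      (Continuous.intervalIntegrable (by fun_prop) _ _)
    have h2 : ‖∫ s in t..t₀, u s‖ ≤ ∫ s in t..t₀, c * Real.exp (l * (t₀ - s)) := by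
      apply intervalIntegral.norm_integral_le_of_norm_le ht _
        (Continuous.intervalIntegrable (by fun_prop) _ _)
      refine Eventually.of_forall fun s hs => ?_
      have := h s
      rwa [abs_of_nonpos (by linarith [hs.2]), neg_sub] at this
    rw [hi] at h2
    rw [intervalIntegral.integral_symm, norm_neg, abs_of_nonpos (by linarith), neg_sub]
    refine h2.trans ?_
    simp only [sub_self, mul_zero, Real.exp_zero, mul_one]
    linarith

/-- Global solutions of linear equations in Banach spaces, in integral form. -/
lemma exists_linear_integral_eq {E : Type*} [NormedAddCommGroup E] [NormedSpace ℂ E]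
    [CompleteSpace E] {A : ℝ → E →L[ℂ] E} {M : ℝ} (hM : ∀ s, ‖A s‖ ≤ M)
    (hA : ∀ x : ℝ → E, Continuous x → Continuous fun s => A s (x s)) {g : ℝ → E}
    (hg : Continuous g) {B : ℝ} (hB : ∀ s, ‖g s‖ ≤ B) (f : E) (t₀ : ℝ) :
    ∃ y : ℝ → E, Continuous y ∧ ∀ t, y t = f + ∫ s in t₀..t, (A s (y s) + g s) := by
  have hM0 : 0 ≤ M := (norm_nonneg _).trans (hM 0)
  have hB0 : 0 ≤ B := (norm_nonneg _).trans (hB 0)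
  -- Chosen so that `M / l ≤ 1/2`; the summand `1` keeps `l` positive when `M = 0`.
  set l : ℝ := 2 * (M + 1) with hl
  have hl0 : 0 < l := by positivity
  let W : ℝ → ℝ := fun t => Real.exp (l * |t - t₀|)
  have hWc : Continuous W := by fun_prop
  have hW1 : ∀ t, 1 ≤ W t := fun t => Real.one_le_exp (by positivity)
  have hW0 : ∀ t, 0 < W t := fun t => Real.exp_pos _
  have hWn : ∀ t, ‖((W t)⁻¹ : ℝ)‖ = (W t)⁻¹ := fun t =>
    Real.norm_of_nonneg (inv_nonneg.2 (hW0 t).le)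
  have hWn' : ∀ t, ‖W t‖ = W t := fun t => Real.norm_of_nonneg (hW0 t).le
  have hcont : ∀ x : ℝ →ᵇ E, Continuous fun s => A s (W s • x s) + g s := fun x =>
    (hA _ (hWc.smul x.continuous)).add hg
  have hprim : ∀ u : ℝ → E, Continuous u → Continuous fun t => ∫ s in t₀..t, u s := fun u hu =>
    intervalIntegral.continuous_primitive (fun _ _ => hu.intervalIntegrable _ _) _
  have hAx : ∀ (x : ℝ → E) (c : ℝ) s, ‖x s‖ ≤ c → ‖A s (W s • x s)‖ ≤ M * c * W s := by
    intro x c s hx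
    calc _ ≤ ‖A s‖ * ‖W s • x s‖ := (A s).le_opNorm _
      _ ≤ M * (W s * c) := by
        rw [norm_smul, hWn']
        have := hW0 s
        have := hM s
        gcongr
      _ = _ := by ring
  -- The Picard map for the rescaled unknown `x = y / W`, so that the weighted sup norm of `y`
  -- becomes the usual norm of bounded continuous functions.
  let Φ : (ℝ →ᵇ E) → (ℝ →ᵇ E) := fun x => BoundedContinuousFunction.ofNormedAddCommGroup
    (fun t => (W t)⁻¹ • (f + ∫ s in t₀..t, (A s (W s • x s) + g s)))
    ((hWc.inv₀ fun t => (hW0 t).ne').smul (continuous_const.add (hprim _ (hcont x))))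
    (‖f‖ + (M * ‖x‖ + B) / l) (by
      intro t
      have h1 : ‖∫ s in t₀..t, (A s (W s • x s) + g s)‖ ≤ (M * ‖x‖ + B) / l * W t := by
        refine norm_integral_le_exp_weight (by positivity) hl0 (fun s => ?_) t
        have a1 := hAx x ‖x‖ s (x.norm_coe_le_norm s)
        have a2 := hB s
        have a3 : B ≤ B * W s := le_mul_of_one_le_right hB0 (hW1 s)
        calc _ ≤ ‖A s (W s • x s)‖ + ‖g s‖ := norm_add_le _ _
          _ ≤ M * ‖x‖ * W s + B * W s := by linarith
          _ = _ := by ring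
      rw [norm_smul, hWn, inv_mul_le_iff₀ (hW0 t)]
      have h2 := norm_add_le f (∫ s in t₀..t, (A s (W s • x s) + g s))
      have h3 : ‖f‖ ≤ W t * ‖f‖ := le_mul_of_one_le_left (norm_nonneg _) (hW1 t)
      linarith)
  have hΦ : ContractingWith (1 / 2 : ℝ≥0) Φ := by
    refine ⟨by norm_num, LipschitzWith.of_dist_le_mul fun x x' => ?_⟩
    rw [BoundedContinuousFunction.dist_le (by positivity)]
    intro t
    have e : Φ x t - Φ x' t = (W t)⁻¹ • ∫ s in t₀..t, A s (W s • (x - x') s) := by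
      have h1 : ∀ s, A s (W s • (x - x') s) = (A s (W s • x s) + g s) - (A s (W s • x' s) + g s) := by
        intro s
        rw [BoundedContinuousFunction.sub_apply, smul_sub, map_sub]
        abel
      simp_rw [h1]
      rw [intervalIntegral.integral_sub ((hcont x).intervalIntegrable _ _)
        ((hcont x').intervalIntegrable _ _)]
      change (W t)⁻¹ • (f + ∫ s in t₀..t, (A s (W s • x s) + g s)) -
        (W t)⁻¹ • (f + ∫ s in t₀..t, (A s (W s • x' s) + g s)) = _
      rw [← smul_sub, add_sub_add_left_eq_sub]
    rw [dist_eq_norm, e, norm_smul, hWn, inv_mul_le_iff₀ (hW0 t), dist_eq_norm]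
    have h2 := norm_integral_le_exp_weight (t₀ := t₀) (by positivity) hl0
      (fun s => hAx (x - x') ‖x - x'‖ s ((x - x').norm_coe_le_norm s)) t
    have h3 : M * ‖x - x'‖ / l ≤ 1 / 2 * ‖x - x'‖ := by
      rw [div_le_iff₀ hl0, hl]
      nlinarith [norm_nonneg (x - x')]
    have h4 := mul_le_mul_of_nonneg_right h3 (hW0 t).le
    refine h2.trans (h4.trans (le_of_eq ?_))
    simp only [NNReal.coe_div, NNReal.coe_one, NNReal.coe_ofNat]
    ring
  obtain ⟨x, hx⟩ : ∃ x, Φ x = x := ⟨_, hΦ.fixedPoint_isFixedPt⟩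
  refine ⟨fun t => W t • x t, hWc.smul x.continuous, fun t => ?_⟩
  have h1 : Φ x t = x t := by rw [hx]
  change (W t)⁻¹ • (f + ∫ s in t₀..t, (A s (W s • x s) + g s)) = x t at h1
  change W t • x t = f + ∫ s in t₀..t, (A s (W s • x s) + g s)
  rw [← h1, smul_inv_smul₀ (hW0 t).ne']

end LinearEvolution

/-! ### Duhamel's formula -/

section Existence

variable {n : ℕ}

/-- Existence of mild solutions. The second part states that the equation holds weakly, in
differentiated form. -/
lemma exists_mild_solution {V : EuclideanSpace ℝ (Fin n) → ℂ} {F : ℝ → L2Space n}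
    (hF : Continuous F) {B : ℝ} (hB : ∀ s, ‖F s‖ ≤ B) (f : L2Space n) (t₀ : ℝ) :
    ∃ w : ℝ → L2Space n, Continuous w ∧ w t₀ = f ∧
      ∀ ψ : EuclideanSpace ℝ (Fin n) → ℂ, IsTest ψ → ∀ t,
        HasDerivAt (fun t => ⟪toL2 ψ, w t⟫_ℂ)
          (Complex.I * ⟪toL2 (Laplacian.laplacian ψ), w t⟫_ℂ -
            Complex.I * ⟪toL2 ψ, mulOp V (w t) + F t⟫_ℂ) t := by
  let N : L2Space n →L[ℂ] L2Space n := (-Complex.I) • mulOp V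
  -- Interaction picture: the unknown `y t = freeProp (-t) (w t)` solves a linear equation with
  -- bounded operators only, since the Laplacian has been conjugated away.
  let A : ℝ → L2Space n →L[ℂ] L2Space n := fun s => freeProp (-s) ∘L N ∘L freeProp s
  have hA : ∀ x : ℝ → L2Space n, Continuous x → Continuous fun s => A s (x s) := by
    intro x hx
    exact continuous_freeProp (N.continuous.comp (continuous_freeProp hx continuous_id))
      continuous_neg
  have hAn : ∀ s, ‖A s‖ ≤ ‖N‖ := fun s => ContinuousLinearMap.opNorm_le_bound _ (norm_nonneg _)
    fun x => (norm_freeProp_le _ _).trans ((N.le_opNorm _).trans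
      (mul_le_mul_of_nonneg_left (norm_freeProp_le _ _) (norm_nonneg _)))
  let g : ℝ → L2Space n := fun s => freeProp (-s) ((-Complex.I) • F s)
  have hg : Continuous g := continuous_freeProp (y := fun s => (-Complex.I) • F s) (by fun_prop) continuous_neg
  have hgB : ∀ s, ‖g s‖ ≤ B := fun s => by
    refine (norm_freeProp_le _ _).trans ?_
    rw [norm_smul, norm_neg, Complex.norm_I, one_mul]
    exact hB s
  obtain ⟨y, hyc, hy⟩ := exists_linear_integral_eq hAn hA hg hgB (freeProp (-t₀) f) t₀
  have hy' : ∀ t, HasDerivAt y (A t (y t) + g t) t := by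
    intro t
    have hc : Continuous fun s => A s (y s) + g s := (hA y hyc).add hg
    have h1 := (intervalIntegral.integral_hasDerivAt_right (a := t₀) (hc.intervalIntegrable _ t)
      hc.stronglyMeasurable.stronglyMeasurableAtFilter hc.continuousAt).const_add (freeProp (-t₀) f)
    exact h1.congr_of_eventuallyEq (Eventually.of_forall hy)
  refine ⟨fun t => freeProp t (y t), continuous_freeProp hyc continuous_id, ?_, fun ψ hψ t => ?_⟩
  · change freeProp t₀ (y t₀) = f
    rw [hy t₀, intervalIntegral.integral_same, add_zero, freeProp_freeProp_neg]
  -- The group is moved onto the test function, whose free evolution is differentiable in `L²`; both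
  -- factors can then be differentiated.
  · have e : ∀ t, ⟪toL2 ψ, freeProp t (y t)⟫_ℂ = ⟪freeProp (-t) (toL2 ψ), y t⟫_ℂ := fun t => by
      rw [inner_freeProp_left, neg_neg]
    simp_rw [e]
    have h1 : HasDerivAt (fun s => freeProp (-s) (toL2 ψ))
        (-freeProp (-t) (Complex.I • toL2 (Laplacian.laplacian ψ))) t := by
      have h0 := (hasDerivAt_freeProp_test hψ (-t)).scomp t (hasDerivAt_neg t)
      rw [neg_smul, one_smul] at h0
      exact h0
    have h2 := h1.inner ℂ (hy' t)
    convert! h2 using 1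
    have e2 : A t (y t) + g t =
        freeProp (-t) ((-Complex.I) • (mulOp V (freeProp t (y t)) + F t)) := by
      rw [smul_add, map_add]
      rfl
    rw [e2, inner_neg_left, inner_freeProp_left (-t), inner_freeProp_left (-t), neg_neg,
      freeProp_freeProp_neg, inner_smul_left, inner_smul_right, Complex.conj_I]
    ring

end Existence

/-! ### Weak ordinary differential equations in time -/

section DuBoisReymond

/-- The lemma of du Bois-Reymond: a continuous function orthogonal to all derivatives of test
functions is constant. -/
lemma eq_of_integral_deriv_mul_eq_zero {g : ℝ → ℂ} {α β : ℝ} (hαβ : α < β) (hg : Continuous g)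
    (h : ∀ θ : ℝ → ℝ, ContDiff ℝ ∞ θ → HasCompactSupport θ → tsupport θ ⊆ Ioo α β →
      ∫ t, ((deriv θ t : ℝ) : ℂ) * g t = 0) {s t : ℝ} (hs : s ∈ Icc α β) (ht : t ∈ Icc α β) :
    g s = g t := by
  let b : ContDiffBump ((α + β) / 2) := ⟨(β - α) / 8, (β - α) / 4, by linarith, by linarith⟩
  set η₀ : ℝ → ℝ := b.normed volume with hη₀
  have hη₀d : ContDiff ℝ ∞ η₀ := b.contDiff_normed
  have hη₀c : HasCompactSupport η₀ := b.hasCompactSupport_normed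
  have hη₀1 : ∫ x, η₀ x = 1 := b.integral_normed
  have hη₀s : tsupport η₀ ⊆ Ioo α β := by
    rw [hη₀, b.tsupport_normed_eq]
    intro x hx
    rw [Real.closedBall_eq_Icc] at hx
    change x ∈ Icc ((α + β) / 2 - (β - α) / 4) ((α + β) / 2 + (β - α) / 4) at hx
    constructor <;> linarith [hx.1, hx.2]
  set c : ℂ := ∫ x, (η₀ x : ℂ) * g x with hc
  have hint : ∀ η : ℝ → ℝ, Continuous η → HasCompactSupport η → ∀ k : ℝ → ℂ, Continuous k →
      Integrable (fun x => (η x : ℂ) * k x) volume := fun η h1 h2 k h3 =>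
    ((Complex.continuous_ofReal.comp h1).mul h3).integrable_of_hasCompactSupport
      ((h2.comp_left Complex.ofReal_zero).mul_right)
  have key : ∀ η : ℝ → ℝ, ContDiff ℝ ∞ η → HasCompactSupport η → tsupport η ⊆ Ioo α β →
      ∫ x, η x • (g x - c) = 0 := by
    intro η hη hηc hηs
    set m : ℝ := ∫ x, η x with hm
    -- Removing the mean of `η` leaves a function of integral zero, whose primitive has compact
    -- support in the interval and is therefore an admissible `θ`. The constant is then `c`, the
    -- `η₀`-average of `g`.
    set κ : ℝ → ℝ := fun x => η x - m * η₀ x with hκ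
    have hκd : ContDiff ℝ ∞ κ := hη.sub (contDiff_const.mul hη₀d)
    set K := tsupport η ∪ tsupport η₀ with hK
    have hKc : IsCompact K := hηc.isCompact.union hη₀c.isCompact
    have hKs : K ⊆ Ioo α β := union_subset hηs hη₀s
    have hKne : K.Nonempty := by
      by_contra h0
      rw [not_nonempty_iff_eq_empty] at h0
      have : tsupport η₀ = ∅ := subset_empty_iff.1 (h0 ▸ subset_union_right)
      rw [tsupport_eq_empty_iff] at this
      rw [this] at hη₀1
      simp at hη₀1
    have hκ0 : ∀ x, x ∉ K → κ x = 0 := by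
      intro x hx
      rw [hK, mem_union, not_or] at hx
      simp [hκ, image_eq_zero_of_notMem_tsupport hx.1, image_eq_zero_of_notMem_tsupport hx.2]
    have hκi : ∫ x, κ x = 0 := by
      rw [hκ, integral_sub (hη.continuous.integrable_of_hasCompactSupport hηc)
        ((hη₀d.continuous.integrable_of_hasCompactSupport hη₀c).const_mul m), integral_const_mul,
        hη₀1, ← hm]
      ring
    have hlo : ∀ x ∈ K, sInf K ≤ x := fun x hx => csInf_le hKc.bddBelow hx
    have hhi : ∀ x ∈ K, x ≤ sSup K := fun x hx => le_csSup hKc.bddAbove hx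
    have hInf := hKs (hKc.sInf_mem hKne)
    have hSup := hKs (hKc.sSup_mem hKne)
    set θ : ℝ → ℝ := fun t => ∫ x in α..t, κ x with hθ
    have hθ' : ∀ t, HasDerivAt θ (κ t) t := fun t =>
      intervalIntegral.integral_hasDerivAt_right (hκd.continuous.intervalIntegrable _ _)
        hκd.continuous.stronglyMeasurable.stronglyMeasurableAtFilter hκd.continuous.continuousAt
    have hdθ : deriv θ = κ := funext fun t => (hθ' t).deriv
    have hθd : ContDiff ℝ ∞ θ :=
      contDiff_infty_iff_deriv.2 ⟨fun t => (hθ' t).differentiableAt, hdθ ▸ hκd⟩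
    have hθs : Function.support θ ⊆ Icc (sInf K) (sSup K) := by
      intro t ht
      by_contra h0
      apply ht
      rw [mem_Icc, not_and_or, not_le, not_le] at h0
      rcases h0 with h0 | h0
      · apply intervalIntegral.integral_zero_ae
        refine Eventually.of_forall fun x hx => hκ0 x fun hxK => ?_
        have h1 := hlo x hxK
        have h2 : x ≤ max α t := hx.2
        have h3 : max α t < sInf K := max_lt hInf.1 h0
        linarith
      · change ∫ x in α..t, κ x = 0
        rw [intervalIntegral.integral_eq_integral_of_support_subset, hκi]
        intro x hx
        have hxK : x ∈ K := by
          by_contra h5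
          exact hx (hκ0 x h5)
        exact ⟨(hKs hxK).1, (hhi x hxK).trans h0.le⟩
    have hθt : tsupport θ ⊆ Icc (sInf K) (sSup K) := closure_minimal hθs isClosed_Icc
    have h1 := h θ hθd (HasCompactSupport.of_support_subset_isCompact isCompact_Icc hθs)
      (hθt.trans (Icc_subset_Ioo hInf.1 hSup.2))
    rw [hdθ] at h1
    have i1 := hint η hη.continuous hηc g hg
    have i2 := hint η₀ hη₀d.continuous hη₀c g hg
    have i3 := hint η hη.continuous hηc (fun _ => c) continuous_const
    have e1 : ∫ t, (κ t : ℂ) * g t = (∫ x, (η x : ℂ) * g x) - m * c := by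
      rw [hc, ← integral_const_mul, ← integral_sub i1 (i2.const_mul _)]
      congr 1
      ext x
      simp only [hκ]
      push_cast
      ring
    have e2 : ∫ x, η x • (g x - c) = (∫ x, (η x : ℂ) * g x) - m * c := by
      have : ∫ x, (η x : ℂ) * c = m * c := by
        rw [integral_mul_const, integral_complex_ofReal]
      rw [← this, ← integral_sub i1 i3]
      congr 1
      ext x
      rw [Complex.real_smul]
      ring
    rw [e2, ← e1, h1]
  have hae := isOpen_Ioo.ae_eq_zero_of_integral_contDiff_smul_eq_zero
    ((hg.sub continuous_const).locallyIntegrable.locallyIntegrableOn (Ioo α β)) key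
  have hEq : EqOn (fun x => g x - c) (fun _ => 0) (Ioo α β) := by
    apply Measure.eqOn_open_of_ae_eq (μ := volume) _ isOpen_Ioo (by fun_prop) (by fun_prop)
    rw [Filter.EventuallyEq, ae_restrict_iff' measurableSet_Ioo]
    exact hae
  have hEq2 : EqOn (fun x => g x - c) (fun _ => 0) (Icc α β) := by
    rw [← closure_Ioo hαβ.ne]
    exact hEq.closure (by fun_prop) (by fun_prop)
  rw [sub_eq_zero.1 (hEq2 hs), sub_eq_zero.1 (hEq2 ht)]

/-- A weak ordinary differential equation with continuous data holds in integrated form. -/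
lemma sub_eq_integral_of_weak {a b : ℝ → ℂ} {α β : ℝ} (hαβ : α < β) (ha : Continuous a)
    (hb : Continuous b)
    (h : ∀ θ : ℝ → ℝ, ContDiff ℝ ∞ θ → HasCompactSupport θ → tsupport θ ⊆ Ioo α β →
      ∫ t, (-Complex.I * deriv θ t * a t + θ t * b t) = 0) {s t : ℝ} (hs : s ∈ Icc α β)
    (ht : t ∈ Icc α β) : a t - a s = ∫ τ in s..t, Complex.I * b τ := by
  set P : ℝ → ℂ := fun t => ∫ τ in α..t, b τ with hP
  have hP' : ∀ t, HasDerivAt P (b t) t := fun t =>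
    intervalIntegral.integral_hasDerivAt_right (hb.intervalIntegrable _ _)
      hb.stronglyMeasurable.stronglyMeasurableAtFilter hb.continuousAt
  have hPc : Continuous P := continuous_iff_continuousAt.2 fun t => (hP' t).continuousAt
  -- After integrating `θ * b` by parts, the hypothesis says that `a - i P` has vanishing weak
  -- derivative.
  have hg : a s - Complex.I * P s = a t - Complex.I * P t := by
    apply eq_of_integral_deriv_mul_eq_zero hαβ (g := fun t => a t - Complex.I * P t)
      (ha.sub (continuous_const.mul hPc)) _ hs ht
    intro θ hθ hθc hθs
    have h1 := h θ hθ hθc hθs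
    have hθ1 : Continuous (deriv θ) := hθ.continuous_deriv (by simp)
    have hint : ∀ η : ℝ → ℝ, Continuous η → HasCompactSupport η → ∀ k : ℝ → ℂ, Continuous k →
        Integrable (fun x => (η x : ℂ) * k x) volume := fun η h1 h2 k h3 =>
      ((Complex.continuous_ofReal.comp h1).mul h3).integrable_of_hasCompactSupport
        ((h2.comp_left Complex.ofReal_zero).mul_right)
    have j1 := hint _ hθ1 hθc.deriv a ha
    have j2 := hint _ hθ.continuous hθc b hb
    have j3 := hint _ hθ1 hθc.deriv P hPc
    have j4 := hint _ hθ.continuous hθc P hPc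
    have hparts : ∫ t, (θ t : ℂ) * b t = - ∫ t, ((deriv θ t : ℝ) : ℂ) * P t := by
      apply integral_mul_deriv_eq_deriv_mul_of_integrable
        (u := fun t => (θ t : ℂ)) (u' := fun t => ((deriv θ t : ℝ) : ℂ)) (v := P) (v' := b)
      · exact fun t _ => ((hθ.differentiable (by simp) t).hasDerivAt).ofReal_comp
      · exact fun t _ => hP' t
      · exact j2
      · exact j3
      · exact j4
    simp_rw [mul_assoc] at h1
    rw [integral_add (j1.const_mul _) j2, integral_const_mul, hparts] at h1
    have e : ∫ t, ((deriv θ t : ℝ) : ℂ) * (a t - Complex.I * P t) =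
        (∫ t, ((deriv θ t : ℝ) : ℂ) * a t) - Complex.I * ∫ t, ((deriv θ t : ℝ) : ℂ) * P t := by
      rw [← integral_const_mul, ← integral_sub j1 (j3.const_mul _)]
      congr 1
      ext t
      ring
    rw [e]
    linear_combination Complex.I * h1 + (∫ t, ((deriv θ t : ℝ) : ℂ) * a t) * Complex.I_mul_I
  rw [intervalIntegral.integral_const_mul, ← intervalIntegral.integral_interval_sub_left
    (hb.intervalIntegrable α t) (hb.intervalIntegrable α s)]
  linear_combination -hg

end DuBoisReymond

/-! ### From distributional to weak solutions -/

section Distributional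

variable {n : ℕ}

lemma schrodingerTranspose_mul (V : EuclideanSpace ℝ (Fin n) → ℂ) {θ : ℝ → ℝ}
    (hθ : ContDiff ℝ ∞ θ) {ψ : EuclideanSpace ℝ (Fin n) → ℂ} (hψ : IsTest ψ) (t : ℝ)
    (x : EuclideanSpace ℝ (Fin n)) :
    schrodingerTranspose V (fun p => (θ p.1 : ℂ) * ψ p.2) t x =
      -Complex.I * deriv θ t * ψ x + θ t * (Laplacian.laplacian ψ x - V x * ψ x) := by
  have h1 : deriv (fun s => (θ s : ℂ) * ψ x) t = deriv θ t * ψ x :=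
    (((hθ.differentiable (by simp) t).hasDerivAt).ofReal_comp.mul_const (ψ x)).deriv
  have h2 : Laplacian.laplacian (fun y => (θ t : ℂ) * ψ y) x = θ t * Laplacian.laplacian ψ x :=
    InnerProductSpace.laplacian_smul (θ t : ℂ)
      ((contDiff_infty.1 hψ.contDiff 2).contDiffAt (x := x))
  simp only [schrodingerTranspose]
  rw [h1, h2]
  ring

/-- Distributional solutions are weak solutions in the sense of `WeakSol`. -/
lemma SolvesSchrodinger.weakSol {J : Set ℝ} {V : EuclideanSpace ℝ (Fin n) → ℂ}
    (hV : MemLp V ⊤ volume) {u : ℝ → EuclideanSpace ℝ (Fin n) → ℂ} (hu : SolvesSchrodinger J V u)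
    {Ω : Set (EuclideanSpace ℝ (Fin n))} {α β : ℝ} (hαβ : α < β) (hJ : Ioo α β ⊆ J)
    {U : ℝ → L2Space n} (hU : Continuous U)
    (hUu : ∀ t ∈ Ioo α β, ∀ᵐ x, x ∈ Ω → U t x = u t x) : WeakSol Ω α β V U (fun _ => 0) := by
  intro ψ hψ hψs s hs t ht
  have hψc := hψ.conj
  set a : ℝ → ℂ := fun t => ⟪toL2 ψ, U t⟫_ℂ with ha
  set b : ℝ → ℂ := fun t => ⟪toL2 (Laplacian.laplacian ψ), U t⟫_ℂ - ⟪toL2 ψ, mulOp V (U t)⟫_ℂ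
    with hb
  have hac : Continuous a := by fun_prop
  have hbc : Continuous b := by fun_prop
  have hmain := sub_eq_integral_of_weak hαβ hac hbc ?_ hs ht
  · simp only [ha, hb] at hmain
    rw [hmain]
    congr 1
    ext τ
    rw [add_zero]
    ring
  · intro θ hθ hθc hθs
    have hsub : tsupport (fun p : ℝ × EuclideanSpace ℝ (Fin n) => (θ p.1 : ℂ) * conj (ψ p.2)) ⊆
        tsupport θ ×ˢ tsupport ψ := by
      apply closure_minimal _ ((isClosed_tsupport θ).prod (isClosed_tsupport ψ))
      intro p hp
      rw [Function.mem_support] at hp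
      refine ⟨subset_tsupport _ fun h0 => hp ?_, subset_tsupport _ fun h0 => hp ?_⟩
      · rw [h0]
        simp
      · rw [h0]
        simp
    -- The distributional pairing is bilinear whereas the inner product is conjugate linear in `ψ`;
    -- hence the conjugate in the tensor product.
    have h1 := hu (fun p => (θ p.1 : ℂ) * conj (ψ p.2)) ?_ ?_ ?_
    · rw [← h1]
      congr 1
      ext t
      -- `U t` is tied to `u t` only for times in the open interval. Off the support of `θ` both
      -- integrands are zero.
      by_cases htθ : t ∈ tsupport θ
      · have hΩ := hUu t (hθs htθ)
        have i1 := integrable_L2_mul_conj (toL2 ψ) (U t)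
        have i2 := integrable_L2_mul_conj (toL2 (Laplacian.laplacian ψ)) (U t)
        have i3 := integrable_L2_mul_conj (toL2 ψ) (mulOp V (U t))
        have i23 : Integrable (fun x => θ t * (U t x * conj (toL2 (Laplacian.laplacian ψ) x) -
          mulOp V (U t) x * conj (toL2 ψ x))) volume := (i2.sub i3).const_mul _
        simp only [ha, hb, L2_inner_eq]
        rw [← integral_sub i2 i3, ← integral_const_mul, ← integral_const_mul,
          ← integral_add (i1.const_mul _) i23]
        apply integral_congr_ae
        filter_upwards [hΩ, coeFn_toL2 (hψ.memLp 2), coeFn_toL2 (hψ.laplacian.memLp 2),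
          coeFn_mulOp hV (U t)] with x h2 h3 h4 h5
        rw [schrodingerTranspose_mul V hθ hψc, laplacian_conj, h3, h4, h5]
        by_cases hx : x ∈ Ω
        · rw [h2 hx]
          ring
        · have e1 : ψ x = 0 := image_eq_zero_of_notMem_tsupport fun h => hx (hψs h)
          have e2 : Laplacian.laplacian ψ x = 0 := image_eq_zero_of_notMem_tsupport fun h =>
            hx (hψs (tsupport_laplacian_subset ψ h))
          rw [e1, e2]
          simp
      · have e1 : θ t = 0 := image_eq_zero_of_notMem_tsupport htθ
        have e2 : deriv θ t = 0 := by
          by_contra h3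
          exact htθ (support_deriv_subset h3)
        simp_rw [schrodingerTranspose_mul V hθ hψc, e1, e2]
        simp
    · exact (Complex.ofRealCLM.contDiff.comp (hθ.comp contDiff_fst)).mul
        (hψc.contDiff.comp contDiff_snd)
    · exact (hθc.isCompact.prod hψ.hasCompactSupport.isCompact).of_isClosed_subset
        (isClosed_tsupport _) hsub
    · intro p hp
      exact ⟨hJ (hθs (hsub hp).1), mem_univ _⟩

end Distributional

/-! ### Existence and properties of physical solutions -/

section PhysicalSolutions

variable {n : ℕ}

/-- A smooth family of test functions is differentiable as an `L²`-valued curve. -/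
lemma hasDerivAt_toL2_slice {φ : ℝ × EuclideanSpace ℝ (Fin n) → ℂ} (hφ : ContDiff ℝ ∞ φ)
    (hφc : HasCompactSupport φ) (t : ℝ) :
    HasDerivAt (fun s => toL2 (fun x => φ (s, x)))
      (toL2 (fun x => deriv (fun s => φ (s, x)) t)) t := by
  set K : Set (EuclideanSpace ℝ (Fin n)) := Prod.snd '' tsupport φ with hK
  have hKc : IsCompact K := hφc.isCompact.image continuous_snd
  have h0 : ∀ s x, x ∉ K → φ (s, x) = 0 := fun s x hx =>
    image_eq_zero_of_notMem_tsupport fun h => hx ⟨_, h, rfl⟩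
  have hd : ∀ s x, HasDerivAt (fun s => φ (s, x)) (fderiv ℝ φ (s, x) (1, 0)) s := fun s x =>
    (hφ.differentiable (by simp) (s, x)).hasFDerivAt.comp_hasDerivAt s
      ((hasDerivAt_id s).prodMk (hasDerivAt_const s x))
  have hc : Continuous fun p => fderiv ℝ φ p (1, 0) :=
    (hφ.continuous_fderiv (by simp)).clm_apply continuous_const
  obtain ⟨C, hC⟩ := (hφc.fderiv_apply ℝ (1, 0)).exists_bound_of_continuous hc
  have hslice : ∀ s, MemLp (fun x => φ (s, x)) 2 volume := fun s =>
    (hφ.continuous.comp (by fun_prop : Continuous fun x => (s, x))).memLp_of_hasCompactSupport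
      (HasCompactSupport.of_support_subset_isCompact hKc fun x hx => by
        by_contra h
        exact hx (h0 s x h))
  have hderiv : ∀ x, deriv (fun s => φ (s, x)) t = fderiv ℝ φ (t, x) (1, 0) := fun x => (hd t x).deriv
  simp_rw [hderiv]
  rw [hasDerivAt_iff_tendsto_slope]
  have es : ∀ s, slope (fun s => toL2 (fun x => φ (s, x))) t s =
      toL2 (fun x => slope (fun s => φ (s, x)) t s) := by
    intro s
    apply eq_toL2_of_ae
    rw [slope_def_module]
    filter_upwards [Lp.coeFn_smul (s - t)⁻¹
      (toL2 (fun x => φ (s, x)) - toL2 (fun x => φ (t, x))),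
      Lp.coeFn_sub (toL2 (fun x => φ (s, x))) (toL2 (fun x => φ (t, x))),
      coeFn_toL2 (hslice s), coeFn_toL2 (hslice t)] with x h1 h2 h3 h4
    rw [h1, Pi.smul_apply, h2, Pi.sub_apply, h3, h4, slope_def_module]
  have hsl : ∀ s x, slope (fun s => φ (s, x)) t s = (s - t)⁻¹ • (φ (s, x) - φ (t, x)) :=
    fun s x => slope_def_module _ _ _
  have hB : MemLp (K.indicator fun _ => C) 2 (volume : Measure (EuclideanSpace ℝ (Fin n))) :=
    memLp_indicator_const 2 hKc.measurableSet C (Or.inr hKc.measure_lt_top.ne)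
  have hbound : ∀ s x, ‖slope (fun s => φ (s, x)) t s‖ ≤ K.indicator (fun _ => C) x := by
    intro s x
    by_cases hx : x ∈ K
    · rw [indicator_of_mem hx]
      have h := convex_univ.norm_image_sub_le_of_norm_hasDerivWithin_le
        (fun s _ => (hd s x).hasDerivWithinAt) (fun s _ => hC (s, x)) (mem_univ t) (mem_univ s)
      rw [hsl, norm_smul, norm_inv]
      rcases eq_or_ne s t with rfl | hst
      · simp only [sub_self, norm_zero, mul_zero]
        exact (norm_nonneg _).trans (hC (s, x))
      · rw [inv_mul_le_iff₀ (norm_pos_iff.2 (sub_ne_zero.2 hst)), mul_comm]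
        exact h
    · rw [indicator_of_notMem hx, hsl, h0 s x hx, h0 t x hx]
      simp
  have hlim : ∀ x, Tendsto (fun s => slope (fun s => φ (s, x)) t s) (𝓝[≠] t)
      (𝓝 (fderiv ℝ φ (t, x) (1, 0))) := fun x => hasDerivAt_iff_tendsto_slope.1 (hd t x)
  rw [funext es]
  apply tendsto_toL2_of_dominated hB
  · refine Eventually.of_forall fun s => ?_
    have e : (fun x => slope (fun s => φ (s, x)) t s) =
        fun x => (s - t)⁻¹ • (φ (s, x) - φ (t, x)) := funext fun x => hsl s x
    rw [e]
    exact ((hslice s).1.sub (hslice t).1).const_smul (s - t)⁻¹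
  · exact (hc.comp (by fun_prop : Continuous fun x => (t, x))).aestronglyMeasurable
  · exact Eventually.of_forall fun s => Eventually.of_forall fun x => hbound s x
  · exact Eventually.of_forall fun x =>
      le_of_tendsto (hlim x).norm (Eventually.of_forall fun s => hbound s x)
  · exact Eventually.of_forall hlim

/-- The pairing of `u t` with the slice at time `t` of `conj φ` is differentiable: the slices are
differentiable in `L²`, and `u` is differentiable against each fixed slice. Its derivative is the
spatial integral in the distributional equation up to the factor `-i`, and the pairing has compact
support in time. -/
lemma solvesSchrodinger_of_hasDerivAt {V : EuclideanSpace ℝ (Fin n) → ℂ} (hV : MemLp V ⊤ volume)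
    {u : ℝ → L2Space n} (hu : Continuous u)
    (h : ∀ ψ : EuclideanSpace ℝ (Fin n) → ℂ, IsTest ψ → ∀ t,
        HasDerivAt (fun t => ⟪toL2 ψ, u t⟫_ℂ)
          (Complex.I * ⟪toL2 (Laplacian.laplacian ψ), u t⟫_ℂ -
            Complex.I * ⟪toL2 ψ, mulOp V (u t)⟫_ℂ) t) (J : Set ℝ) :
    SolvesSchrodinger J V (fun t x => u t x) := by
  intro φ hφ hφc _
  set Φ : ℝ × EuclideanSpace ℝ (Fin n) → ℂ := fun p => conj (φ p) with hΦ
  have hΦd : ContDiff ℝ ∞ Φ := Complex.conjCLE.contDiff.comp hφ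
  have hΦc : HasCompactSupport Φ := hφc.comp_left (map_zero _)
  set K : Set (EuclideanSpace ℝ (Fin n)) := Prod.snd '' tsupport φ with hK
  have hKc : IsCompact K := hφc.isCompact.image continuous_snd
  have h0 : ∀ s x, x ∉ K → Φ (s, x) = 0 := fun s x hx => by
    have : φ (s, x) = 0 := image_eq_zero_of_notMem_tsupport fun h => hx ⟨_, h, rfl⟩
    rw [hΦ]
    simp [this]
  have htest : ∀ s, IsTest (fun x => Φ (s, x)) := fun s =>
    ⟨hΦd.comp (contDiff_const.prodMk contDiff_id),
      HasCompactSupport.of_support_subset_isCompact hKc fun x hx => by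
        by_contra h
        exact hx (h0 s x h)⟩
  set c : ℝ → ℂ := fun t => ⟪toL2 (fun x => Φ (t, x)), u t⟫_ℂ with hc
  set c' : ℝ → ℂ := fun t => ⟪toL2 (fun x => deriv (fun s => Φ (s, x)) t), u t⟫_ℂ +
    (Complex.I * ⟪toL2 (Laplacian.laplacian fun x => Φ (t, x)), u t⟫_ℂ -
      Complex.I * ⟪toL2 (fun x => Φ (t, x)), mulOp V (u t)⟫_ℂ) with hc'
  have hder : ∀ t, HasDerivAt c (c' t) t := by
    intro t
    have h1 := hasDerivAt_inner_of_continuousAt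
      ((hasDerivAt_toL2_slice hΦd hΦc t).sub_const (toL2 fun x => Φ (t, x))) (sub_self _)
      hu.continuousAt
    refine (h1.add (h _ (htest t) t)).congr_of_eventuallyEq (Eventually.of_forall fun s => ?_)
    simp only [hc, Pi.add_apply]
    rw [inner_sub_left]
    ring
  have hd : ∀ t x, HasDerivAt (fun s => φ (s, x)) (fderiv ℝ φ (t, x) (1, 0)) t := fun s x =>
    (hφ.differentiable (by simp) (s, x)).hasFDerivAt.comp_hasDerivAt s
      ((hasDerivAt_id s).prodMk (hasDerivAt_const s x))
  have hdΦ : ∀ t x, deriv (fun s => Φ (s, x)) t = conj (deriv (fun s => φ (s, x)) t) := by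
    intro t x
    have h1 := Complex.conjCLE.toContinuousLinearMap.hasFDerivAt.comp_hasDerivAt t (hd t x)
    have h2 : HasDerivAt (fun s => Φ (s, x)) (conj (fderiv ℝ φ (t, x) (1, 0))) t := h1
    rw [h2.deriv, (hd t x).deriv]
  have hpt : ∀ t, ∫ x, u t x * schrodingerTranspose V φ t x = -Complex.I * c' t := by
    intro t
    have hm1 : MemLp (fun x => deriv (fun s => Φ (s, x)) t) 2 volume := by
      have hcont : Continuous fun x => deriv (fun s => Φ (s, x)) t := by
        simp_rw [hdΦ, fun x => (hd t x).deriv]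
        exact Complex.continuous_conj.comp (((hφ.continuous_fderiv (by simp)).clm_apply
          continuous_const).comp (by fun_prop : Continuous fun x => (t, x)))
      refine hcont.memLp_of_hasCompactSupport
        (HasCompactSupport.of_support_subset_isCompact hKc fun x hx => ?_)
      by_contra hxK
      apply hx
      have : (fun s => Φ (s, x)) = fun _ => 0 := funext fun s => h0 s x hxK
      simp [this]
    have i1 := integrable_L2_mul_conj (toL2 (fun x => deriv (fun s => Φ (s, x)) t)) (u t)
    have i2 := integrable_L2_mul_conj (toL2 (Laplacian.laplacian fun x => Φ (t, x))) (u t)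
    have i3 := integrable_L2_mul_conj (toL2 (fun x => Φ (t, x))) (mulOp V (u t))
    have i23 : Integrable (fun x => Complex.I * (u t x *
        conj (toL2 (Laplacian.laplacian fun x => Φ (t, x)) x)) - Complex.I *
        (mulOp V (u t) x * conj (toL2 (fun x => Φ (t, x)) x))) volume :=
      (i2.const_mul _).sub (i3.const_mul _)
    simp only [hc', L2_inner_eq]
    rw [← integral_const_mul, ← integral_const_mul, ← integral_sub (i2.const_mul _) (i3.const_mul _),
      ← integral_add i1 i23, ← integral_const_mul]
    apply integral_congr_ae
    filter_upwards [coeFn_toL2 hm1, coeFn_toL2 ((htest t).memLp 2),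
      coeFn_toL2 ((htest t).laplacian.memLp 2), coeFn_mulOp hV (u t)] with x h1 h2 h3 h4
    rw [h1, h2, h3, h4, hdΦ, schrodingerTranspose]
    simp only [hΦ]
    rw [laplacian_conj, Complex.conj_conj, Complex.conj_conj, Complex.conj_conj]
    linear_combination (u t x * Laplacian.laplacian (fun y => φ (t, y)) x -
      V x * u t x * φ (t, x)) * Complex.I_mul_I
  simp_rw [hpt]
  rw [integral_const_mul]
  -- Integrability of `c'` need not be proved: otherwise its Bochner integral is zero by convention,
  -- which is the value wanted.
  by_cases hi : Integrable c' volume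
  · have hci : Integrable c volume := by
      have hcc : Continuous c := continuous_iff_continuousAt.2 fun t => (hder t).continuousAt
      apply hcc.integrable_of_hasCompactSupport
      apply HasCompactSupport.of_support_subset_isCompact (hφc.isCompact.image continuous_fst)
      intro t ht
      by_contra h
      apply ht
      have hz : (fun x => Φ (t, x)) = fun _ => 0 := by
        ext x
        have : φ (t, x) = 0 := image_eq_zero_of_notMem_tsupport fun h' => h ⟨_, h', rfl⟩
        rw [hΦ]
        simp [this]
      have hz2 : toL2 (fun _ : EuclideanSpace ℝ (Fin n) => (0 : ℂ)) = 0 := by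
        symm
        apply eq_toL2_of_ae
        exact Lp.coeFn_zero _ _ _
      simp only [hc, hz, hz2, inner_zero_left]
    rw [integral_eq_zero_of_hasDerivAt_of_integrable hder hi hci, mul_zero]
  · rw [integral_undef hi, mul_zero]

lemma exists_isPhysicalSolution {V : EuclideanSpace ℝ (Fin n) → ℂ} (hV : MemLp V ⊤ volume) (T : ℝ)
    (f : L2Space n) : ∃ u, IsPhysicalSolution T V f u := by
  obtain ⟨w, hw, hw0, h⟩ := exists_mild_solution (V := V) (F := fun _ => (0 : L2Space n))
    continuous_const (B := 0) (fun _ => norm_zero.le) f 0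
  refine ⟨w, hw.continuousOn, solvesSchrodinger_of_hasDerivAt hV hw (fun ψ hψ t => ?_) _, hw0⟩
  simpa using h ψ hψ t

/-- The initial-to-final-state map is realized by a physical solution. -/
lemma exists_isPhysicalSolution_final {V : EuclideanSpace ℝ (Fin n) → ℂ} (hV : MemLp V ⊤ volume)
    (T : ℝ) (f : L2Space n) :
    ∃ u, IsPhysicalSolution T V f u ∧ u T = initialToFinalStateMap T V f := by
  obtain ⟨u, hu⟩ := exists_isPhysicalSolution hV T f
  -- Existence alone suffices: the chosen value is then the final state of some physical solution,
  -- whether or not it is the only one.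
  exact Classical.epsilon_spec (p := fun g => ∃ u, IsPhysicalSolution T V f u ∧ u T = g)
    ⟨u T, u, hu, rfl⟩

/-- Weak solutions with a source exist, with data prescribed at any time. -/
lemma exists_weakSol (V : EuclideanSpace ℝ (Fin n) → ℂ) {F : ℝ → L2Space n}
    (hF : Continuous F) {B : ℝ} (hB : ∀ s, ‖F s‖ ≤ B) (f : L2Space n) (t₀ : ℝ) :
    ∃ w : ℝ → L2Space n, Continuous w ∧ w t₀ = f ∧ ∀ a b, WeakSol univ a b V w F := by
  obtain ⟨w, hw, hw0, h⟩ := exists_mild_solution (V := V) hF hB f t₀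
  refine ⟨w, hw, hw0, fun a b ψ hψ _ s _ t _ => ?_⟩
  exact (intervalIntegral.integral_eq_sub_of_hasDerivAt (fun τ _ => h ψ hψ τ)
    (Continuous.intervalIntegrable (by fun_prop) _ _)).symm

/-- A physical solution extends to a continuous curve that is a weak solution. -/
lemma IsPhysicalSolution.exists_weakSol {T : ℝ} (hT : 0 < T) {V : EuclideanSpace ℝ (Fin n) → ℂ}
    (hV : MemLp V ⊤ volume) {f : L2Space n} {u : ℝ → L2Space n} (h : IsPhysicalSolution T V f u) :
    ∃ w : ℝ → L2Space n, Continuous w ∧ w 0 = f ∧ w T = u T ∧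
      WeakSol univ 0 T V w (fun _ => 0) := by
  have hw : ∀ t ∈ Icc 0 T, u (projIcc 0 T hT.le t) = u t := fun t ht => by
    rw [projIcc_of_mem hT.le ht]
  -- Outside `[0, T]` the curve is frozen at its end values.
  have hc : Continuous fun t => u (projIcc 0 T hT.le t) :=
    h.continuousOn.comp_continuous (continuous_subtype_val.comp continuous_projIcc)
      fun t => (projIcc 0 T hT.le t).2
  refine ⟨fun t => u (projIcc 0 T hT.le t), hc, ?_, ?_, ?_⟩
  · exact (hw 0 ⟨le_rfl, hT.le⟩).trans h.initial
  · exact hw T ⟨hT.le, le_rfl⟩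
  · refine h.equation.weakSol hV hT subset_rfl hc fun t ht => ?_
    rw [hw t (Ioo_subset_Icc_self ht)]
    exact Eventually.of_forall fun x _ => rfl

end PhysicalSolutions

/-! ### The space `B*`, its growth on balls and its pairing with the weight -/

section BStar

variable {n : ℕ}

/-- Every point of the ball of radius `2^J` lies in one of the first shells. -/
lemma exists_mem_dyadicShell {J : ℕ} {x : EuclideanSpace ℝ (Fin n)} (hx : ‖x‖ ≤ 2 ^ J) :
    ∃ j ≤ J, x ∈ dyadicShell n j := by
  induction J with
  | zero => exact ⟨0, le_rfl, by simpa [dyadicShell] using hx⟩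
  | succ J ih =>
    rcases le_or_gt ‖x‖ (2 ^ J) with h | h
    · obtain ⟨j, hj, hxj⟩ := ih h
      exact ⟨j, hj.trans (Nat.le_succ J), hxj⟩
    · exact ⟨J + 1, le_rfl, h, hx⟩

lemma iUnion_dyadicShell : ⋃ j, dyadicShell n j = univ := by
  rw [eq_univ_iff_forall]
  intro x
  obtain ⟨J, hJ⟩ := pow_unbounded_of_one_lt ‖x‖ (one_lt_two (α := ℝ))
  obtain ⟨j, _, hj⟩ := exists_mem_dyadicShell hJ.le
  exact mem_iUnion.2 ⟨j, hj⟩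

lemma eLpNorm_two_sq (f : EuclideanSpace ℝ (Fin n) → ℂ)
    (μ : Measure (EuclideanSpace ℝ (Fin n))) :
    eLpNorm f 2 μ ^ 2 = ∫⁻ x, ‖f x‖ₑ ^ 2 ∂μ := by
  rw [eLpNorm_eq_lintegral_rpow_enorm_toReal (by norm_num) (by norm_num), ← ENNReal.rpow_natCast,
    ← ENNReal.rpow_mul]
  simp

lemma lintegral_dyadicShell_le (f : EuclideanSpace ℝ (Fin n) → ℂ) (j : ℕ) :
    ∫⁻ x in dyadicShell n j, ‖f x‖ₑ ^ 2 ≤ 2 ^ j * bStarNorm f ^ 2 := by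
  rw [← eLpNorm_two_sq]
  have h1 : (2 : ℝ≥0∞) ^ (-(j : ℝ) / 2) * eLpNorm f 2 (volume.restrict (dyadicShell n j)) ≤
      bStarNorm f :=
    le_iSup (fun j : ℕ => (2 : ℝ≥0∞) ^ (-(j : ℝ) / 2) *
      eLpNorm f 2 (volume.restrict (dyadicShell n j))) j
  have h2 : (2 : ℝ≥0∞) ^ j * ((2 : ℝ≥0∞) ^ (-(j : ℝ) / 2)) ^ 2 = 1 := by
    rw [← ENNReal.rpow_natCast, ← ENNReal.rpow_natCast, ← ENNReal.rpow_mul,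
      ← ENNReal.rpow_add _ _ (by norm_num) (by norm_num)]
    have : (j : ℝ) + -(j : ℝ) / 2 * ((2 : ℕ) : ℝ) = 0 := by
      push_cast
      ring
    rw [this, ENNReal.rpow_zero]
  calc _ = 2 ^ j * ((2 : ℝ≥0∞) ^ (-(j : ℝ) / 2) *
        eLpNorm f 2 (volume.restrict (dyadicShell n j))) ^ 2 := by
        rw [mul_pow, ← mul_assoc, h2, one_mul]
    _ ≤ _ := by gcongr

/-- The growth of the `L²` norm over balls of functions in `B*`. -/
lemma eLpNorm_indicator_ball_le (f : EuclideanSpace ℝ (Fin n) → ℂ) (J : ℕ) :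
    eLpNorm ((Metric.closedBall 0 (2 ^ J)).indicator f) 2 volume ^ 2 ≤
      2 ^ (J + 1) * bStarNorm f ^ 2 := by
  rw [eLpNorm_indicator_eq_eLpNorm_restrict measurableSet_closedBall, eLpNorm_two_sq]
  have hsub : Metric.closedBall (0 : EuclideanSpace ℝ (Fin n)) (2 ^ J) ⊆
      ⋃ j : Fin (J + 1), dyadicShell n j := by
    intro x hx
    obtain ⟨j, hj, hxj⟩ := exists_mem_dyadicShell (mem_closedBall_zero_iff.1 hx)
    exact mem_iUnion.2 ⟨⟨j, by omega⟩, hxj⟩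
  have hgeom : ∀ J : ℕ, ∑ j ∈ Finset.range J, (2 : ℝ≥0∞) ^ j ≤ 2 ^ J := by
    intro J
    induction J with
    | zero => simp
    | succ J ih =>
      rw [Finset.sum_range_succ, pow_succ, mul_two]
      gcongr
  calc _ ≤ ∫⁻ x in ⋃ j : Fin (J + 1), dyadicShell n j, ‖f x‖ₑ ^ 2 :=
        lintegral_mono_set hsub
    _ ≤ ∑' j : Fin (J + 1), ∫⁻ x in dyadicShell n j, ‖f x‖ₑ ^ 2 := lintegral_iUnion_le _ _
    _ = ∑ j ∈ Finset.range (J + 1), ∫⁻ x in dyadicShell n j, ‖f x‖ₑ ^ 2 := by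
        rw [tsum_fintype,
          Fin.sum_univ_eq_sum_range (fun j => ∫⁻ x in dyadicShell n j, ‖f x‖ₑ ^ 2)]
    _ ≤ ∑ j ∈ Finset.range (J + 1), 2 ^ j * bStarNorm f ^ 2 :=
        Finset.sum_le_sum fun j _ => lintegral_dyadicShell_le f j
    _ ≤ _ := by
        rw [← Finset.sum_mul]
        gcongr
        exact hgeom _

/-- The weight `|Q|^{1/2}`. -/
noncomputable def sqrtWeight (Q : EuclideanSpace ℝ (Fin n) → ℂ) (x : EuclideanSpace ℝ (Fin n)) : ℂ :=
  (√‖Q x‖ : ℝ)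

lemma norm_sqrtWeight (Q : EuclideanSpace ℝ (Fin n) → ℂ) (x : EuclideanSpace ℝ (Fin n)) :
    ‖sqrtWeight Q x‖ = √‖Q x‖ := by
  rw [sqrtWeight, Complex.norm_real, Real.norm_of_nonneg (Real.sqrt_nonneg _)]

lemma enorm_sqrtWeight_sq (Q : EuclideanSpace ℝ (Fin n) → ℂ) (x : EuclideanSpace ℝ (Fin n)) :
    ‖sqrtWeight Q x‖ₑ ^ 2 = ‖Q x‖ₑ := by
  rw [← ofReal_norm, ← ENNReal.ofReal_pow (norm_nonneg _), norm_sqrtWeight,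
    Real.sq_sqrt (norm_nonneg _), ofReal_norm]

lemma aestronglyMeasurable_sqrtWeight {Q : EuclideanSpace ℝ (Fin n) → ℂ}
    (hQ : AEStronglyMeasurable Q volume) : AEStronglyMeasurable (sqrtWeight Q) volume :=
  (Complex.continuous_ofReal.comp Real.continuous_sqrt).comp_aestronglyMeasurable hQ.norm

lemma memLp_sqrtWeight {Q : EuclideanSpace ℝ (Fin n) → ℂ} (hQ : MemLp Q ⊤ volume) :
    MemLp (sqrtWeight Q) ⊤ volume := by
  obtain ⟨C, hC⟩ : ∃ C, ∀ᵐ x, ‖Q x‖ ≤ C := by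
    refine ⟨(eLpNorm Q ⊤ volume).toReal, ?_⟩
    filter_upwards [enorm_ae_le_eLpNormEssSup Q volume] with x hx
    rw [← eLpNorm_exponent_top] at hx
    rw [← toReal_enorm]
    exact ENNReal.toReal_mono hQ.2.ne hx
  refine memLp_top_of_bound (aestronglyMeasurable_sqrtWeight hQ.1) √C ?_
  filter_upwards [hC] with x hx
  rw [norm_sqrtWeight]
  exact Real.sqrt_le_sqrt hx

/-- Multiplication by `|Q|^{1/2}` maps `B*` to `L²`. -/
lemma eLpNorm_sqrtWeight_mul_le {Q : EuclideanSpace ℝ (Fin n) → ℂ} (hQ : MemLp Q ⊤ volume)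
    (f : EuclideanSpace ℝ (Fin n) → ℂ) :
    eLpNorm (fun x => sqrtWeight Q x * f x) 2 volume ^ 2 ≤ tripleNorm Q * bStarNorm f ^ 2 := by
  rw [eLpNorm_two_sq]
  calc _ = ∫⁻ x in ⋃ j, dyadicShell n j, ‖sqrtWeight Q x * f x‖ₑ ^ 2 := by
        rw [iUnion_dyadicShell, Measure.restrict_univ]
    _ ≤ ∑' j, ∫⁻ x in dyadicShell n j, ‖sqrtWeight Q x * f x‖ₑ ^ 2 := lintegral_iUnion_le _ _
    -- On the `j`-th shell, `|Q| |f|²` integrates to at most the supremum of `|Q|` times `2 ^ j`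
    -- times the squared `B*` norm. The weights of the two norms match exactly.
    _ ≤ ∑' j : ℕ, (2 ^ j * eLpNorm Q ⊤ (volume.restrict (dyadicShell n j))) * bStarNorm f ^ 2 := by
        refine ENNReal.tsum_le_tsum fun j => ?_
        calc _ ≤ ∫⁻ x in dyadicShell n j,
              eLpNorm Q ⊤ (volume.restrict (dyadicShell n j)) * ‖f x‖ₑ ^ 2 := by
              apply lintegral_mono_ae
              filter_upwards [enorm_ae_le_eLpNormEssSup Q (volume.restrict (dyadicShell n j))]
                with x hx
              rw [enorm_mul, mul_pow, enorm_sqrtWeight_sq]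
              rw [← eLpNorm_exponent_top] at hx
              gcongr
          _ ≤ eLpNorm Q ⊤ (volume.restrict (dyadicShell n j)) *
                ∫⁻ x in dyadicShell n j, ‖f x‖ₑ ^ 2 := by
              rw [lintegral_const_mul' _ _ (hQ.restrict _).2.ne]
          _ ≤ eLpNorm Q ⊤ (volume.restrict (dyadicShell n j)) * (2 ^ j * bStarNorm f ^ 2) := by
              gcongr
              exact lintegral_dyadicShell_le f j
          _ = _ := by ring
    _ = _ := by rw [ENNReal.tsum_mul_right, tripleNorm]

lemma tripleNorm_sub_lt_top {V₁ V₂ : EuclideanSpace ℝ (Fin n) → ℂ}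
    (h₁ : AEStronglyMeasurable V₁ volume) (h₂ : AEStronglyMeasurable V₂ volume)
    (hV₁ : tripleNorm V₁ < ⊤) (hV₂ : tripleNorm V₂ < ⊤) :
    tripleNorm (fun x => V₁ x - V₂ x) < ⊤ := by
  refine lt_of_le_of_lt ?_ (ENNReal.add_lt_top.2 ⟨hV₁, hV₂⟩)
  rw [tripleNorm, tripleNorm, tripleNorm, ← ENNReal.tsum_add]
  refine ENNReal.tsum_le_tsum fun j => ?_
  rw [← mul_add]
  gcongr
  exact eLpNorm_sub_le h₁.restrict h₂.restrict le_top

lemma bStarNorm_add_le {f g : EuclideanSpace ℝ (Fin n) → ℂ} (hf : AEStronglyMeasurable f volume)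
    (hg : AEStronglyMeasurable g volume) :
    bStarNorm (fun x => f x + g x) ≤ bStarNorm f + bStarNorm g := by
  refine iSup_le fun j => ?_
  calc _ ≤ (2 : ℝ≥0∞) ^ (-(j : ℝ) / 2) * (eLpNorm f 2 (volume.restrict (dyadicShell n j)) +
        eLpNorm g 2 (volume.restrict (dyadicShell n j))) := by
        gcongr
        exact eLpNorm_add_le hf.restrict hg.restrict (by norm_num)
    _ = _ := mul_add _ _ _
    _ ≤ _ := add_le_add
        (le_iSup (fun j : ℕ => (2 : ℝ≥0∞) ^ (-(j : ℝ) / 2) *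
          eLpNorm f 2 (volume.restrict (dyadicShell n j))) j)
        (le_iSup (fun j : ℕ => (2 : ℝ≥0∞) ^ (-(j : ℝ) / 2) *
          eLpNorm g 2 (volume.restrict (dyadicShell n j))) j)

/-- Curves in `B*` are bounded on compact time intervals. -/
lemma IsContinuousBStarCurve.exists_bound {u : ℝ × EuclideanSpace ℝ (Fin n) → ℂ}
    (hu : IsContinuousBStarCurve u) (a b : ℝ) :
    ∃ N : ℝ≥0∞, N < ⊤ ∧ ∀ t ∈ Icc a b, bStarNorm (fun x => u (t, x)) ≤ N := by
  refine isCompact_Icc.induction_on (p := fun s => ∃ N : ℝ≥0∞, N < ⊤ ∧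
    ∀ t ∈ s, bStarNorm (fun x => u (t, x)) ≤ N) ⟨0, by simp, by simp⟩ ?_ ?_ ?_
  · rintro s t hst ⟨N, hN, h⟩
    exact ⟨N, hN, fun x hx => h x (hst hx)⟩
  · rintro s t ⟨N, hN, h⟩ ⟨N', hN', h'⟩
    refine ⟨max N N', max_lt hN hN', fun x hx => ?_⟩
    rcases hx with hx | hx
    · exact (h x hx).trans (le_max_left _ _)
    · exact (h' x hx).trans (le_max_right _ _)
  · intro t _
    have h1 : ∀ᶠ s in 𝓝 t, bStarNorm (fun x => u (s, x) - u (t, x)) < 1 :=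
      (hu.continuous t).eventually_lt_const (by norm_num)
    refine ⟨_, mem_nhdsWithin_of_mem_nhds h1, 1 + bStarNorm (fun x => u (t, x)),
      ENNReal.add_lt_top.2 ⟨by simp, (hu.memBStar t).2⟩, fun s hs => ?_⟩
    have h2 := bStarNorm_add_le ((hu.memBStar s).1.sub (hu.memBStar t).1) (hu.memBStar t).1
    simp only [Pi.sub_apply, sub_add_cancel] at h2
    exact h2.trans (add_le_add (le_of_lt hs) le_rfl)

/-- A weight mapping `B*` to `L²` maps continuous curves to continuous curves. -/
lemma IsContinuousBStarCurve.continuous_toL2_mul {u : ℝ × EuclideanSpace ℝ (Fin n) → ℂ}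
    (hu : IsContinuousBStarCurve u) {m : EuclideanSpace ℝ (Fin n) → ℂ}
    (hm : AEStronglyMeasurable m volume) {c : ℝ≥0∞} (hc : c < ⊤)
    (hmc : ∀ f : EuclideanSpace ℝ (Fin n) → ℂ,
      eLpNorm (fun x => m x * f x) 2 volume ^ 2 ≤ c * bStarNorm f ^ 2) :
    (∀ t, MemLp (fun x => m x * u (t, x)) 2 volume) ∧
      Continuous fun t => toL2 (fun x => m x * u (t, x)) := by
  have hmem : ∀ t, MemLp (fun x => m x * u (t, x)) 2 volume := by
    intro t
    refine ⟨hm.mul (hu.memBStar t).1, ?_⟩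
    have h1 := hmc (fun x => u (t, x))
    have h2 : c * bStarNorm (fun x => u (t, x)) ^ 2 < ⊤ :=
      ENNReal.mul_lt_top hc (ENNReal.pow_lt_top (hu.memBStar t).2)
    by_contra h3
    rw [not_lt, top_le_iff] at h3
    rw [h3] at h1
    simp at h1
    exact h2.ne h1
  refine ⟨hmem, continuous_iff_continuousAt.2 fun t => ?_⟩
  rw [ContinuousAt, tendsto_iff_norm_sub_tendsto_zero]
  have e : ∀ s, ‖toL2 (fun x => m x * u (s, x)) - toL2 (fun x => m x * u (t, x))‖ ^ 2 =
      (eLpNorm (fun x => m x * (u (s, x) - u (t, x))) 2 volume ^ 2).toReal := by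
    intro s
    have hsub : MemLp (fun x => m x * u (s, x) - m x * u (t, x)) 2 volume := (hmem s).sub (hmem t)
    rw [← toL2_sub (hmem s) (hmem t), norm_toL2 hsub, ENNReal.toReal_pow]
    simp_rw [mul_sub]
  have h1 : Tendsto (fun s => c * bStarNorm (fun x => u (s, x) - u (t, x)) ^ 2) (𝓝 t) (𝓝 0) := by
    have h2 := ENNReal.Tendsto.const_mul (a := c) ((ENNReal.continuous_pow 2).tendsto 0 |>.comp
      (hu.continuous t)) (Or.inr hc.ne)
    simpa using h2
  have h3 : Tendsto (fun s => eLpNorm (fun x => m x * (u (s, x) - u (t, x))) 2 volume ^ 2) (𝓝 t)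
      (𝓝 0) :=
    tendsto_of_tendsto_of_tendsto_of_le_of_le tendsto_const_nhds h1 (fun _ => bot_le)
      (fun s => hmc (fun x => u (s, x) - u (t, x)))
  have h4 := ((ENNReal.continuousAt_toReal ENNReal.zero_ne_top).tendsto.comp h3).sqrt
  refine (h4.congr fun s => ?_).trans (by simp)
  simp only [Function.comp_apply]
  rw [← e, Real.sqrt_sq (norm_nonneg _)]

end BStar

/-! ### Green's formulas: removing the cutoff, then the time average -/

section Pairing

variable {n : ℕ}

lemma IsCutoff.norm_mulOp_le {C R : ℝ} {χ : EuclideanSpace ℝ (Fin n) → ℂ} (hχ : IsCutoff C R χ)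
    (f : L2Space n) : ‖mulOp χ f‖ ≤ ‖f‖ := by
  simpa using hχ.isTest.norm_mulOp_le hχ.norm_le_one f

/-- Radii `2 ^ k` fit the shells, and doubling the radius is passing to the next index: `χ (k + 1)`
serves as the wider cutoff `θ` for `χ k`. -/
lemma exists_dyadic_cutoffs (n : ℕ) : ∃ C : ℝ, 0 ≤ C ∧
    ∃ χ : ℕ → EuclideanSpace ℝ (Fin n) → ℂ, (∀ k, IsCutoff C (2 ^ k) (χ k)) ∧
      ∀ k, IsCutoff C (2 * 2 ^ k) (χ (k + 1)) := by
  obtain ⟨C, hC, h⟩ := exists_isCutoff n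
  choose χ hχ using fun k : ℕ => h (2 ^ k) (by positivity)
  exact ⟨C, hC, χ, hχ, fun k => by simpa [pow_succ'] using hχ (k + 1)⟩

lemma tendsto_mulOp_cutoff {C : ℝ} {χ : ℕ → EuclideanSpace ℝ (Fin n) → ℂ}
    (hχ : ∀ k, IsCutoff C (2 ^ k) (χ k)) (f : L2Space n) :
    Tendsto (fun k => mulOp (χ k) f) atTop (𝓝 f) := by
  have h : Tendsto (fun k => toL2 (fun x => χ k x * f x)) atTop (𝓝 (toL2 (fun x => f x))) := by
    apply tendsto_toL2_of_dominated (B := fun x => ‖f x‖) (Lp.memLp f).norm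
    · exact Eventually.of_forall fun k =>
        (hχ k).isTest.contDiff.continuous.aestronglyMeasurable.mul (Lp.aestronglyMeasurable f)
    · exact Lp.aestronglyMeasurable f
    · refine Eventually.of_forall fun k => Eventually.of_forall fun x => ?_
      rw [norm_mul]
      exact mul_le_of_le_one_left (norm_nonneg _) ((hχ k).norm_le_one x)
    · exact Eventually.of_forall fun x => le_rfl
    · refine Eventually.of_forall fun x => tendsto_const_nhds.congr' ?_
      obtain ⟨J, hJ⟩ := pow_unbounded_of_one_lt ‖x‖ (one_lt_two (α := ℝ))
      filter_upwards [eventually_ge_atTop J] with k hk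
      rw [(hχ k).eq_one x (hJ.le.trans (pow_le_pow_right₀ one_le_two hk)), one_mul]
  rw [toL2_coe] at h
  exact h.congr fun k => (mulOp_eq_toL2 ((hχ k).isTest.memLp ⊤) f).symm

lemma tendsto_integral_inner_mulOp_cutoff {C : ℝ} {χ : ℕ → EuclideanSpace ℝ (Fin n) → ℂ}
    (hχ : ∀ k, IsCutoff C (2 ^ k) (χ k)) {y p : ℝ → L2Space n} (hy : Continuous y)
    (hp : Continuous p) (a b : ℝ) :
    Tendsto (fun k => ∫ t in a..b, ⟪mulOp (χ k) (y t), p t⟫_ℂ) atTop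
      (𝓝 (∫ t in a..b, ⟪y t, p t⟫_ℂ)) := by
  apply intervalIntegral.tendsto_integral_filter_of_dominated_convergence
    (fun t => ‖y t‖ * ‖p t‖)
  · exact Eventually.of_forall fun k => Continuous.aestronglyMeasurable (by fun_prop)
  · refine Eventually.of_forall fun k => Eventually.of_forall fun t _ => ?_
    exact (norm_inner_le_norm _ _).trans
      (mul_le_mul_of_nonneg_right ((hχ k).norm_mulOp_le _) (norm_nonneg _))
  · exact Continuous.intervalIntegrable (by fun_prop) _ _
  · exact Eventually.of_forall fun t _ => (tendsto_mulOp_cutoff hχ (y t)).inner tendsto_const_nhds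

lemma integral_add_eq_sub {q : ℝ → L2Space n} (hq : Continuous q) (t h : ℝ) :
    ∫ τ in t..t + h, q τ = (∫ τ in (0 : ℝ)..t + h, q τ) - ∫ τ in (0 : ℝ)..t, q τ :=
  (intervalIntegral.integral_interval_sub_left (hq.intervalIntegrable _ _)
    (hq.intervalIntegrable _ _)).symm

lemma continuous_timeAverage {q : ℝ → L2Space n} (hq : Continuous q) (h : ℝ) :
    Continuous fun t => ∫ τ in t..t + h, q τ := by
  simp_rw [integral_add_eq_sub hq]
  have := intervalIntegral.continuous_primitive (fun a b => hq.intervalIntegrable a b) 0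
    (μ := volume)
  exact (this.comp (continuous_id.add continuous_const)).sub this

lemma tendsto_timeAverage {q : ℝ → L2Space n} (hq : Continuous q) (t : ℝ) :
    Tendsto (fun h : ℝ => ((h⁻¹ : ℝ) : ℂ) • ∫ τ in t..t + h, q τ) (𝓝[>] 0) (𝓝 (q t)) := by
  have h1 : HasDerivAt (fun t => ∫ τ in (0 : ℝ)..t, q τ) (q t) t :=
    intervalIntegral.integral_hasDerivAt_right (hq.intervalIntegrable _ _)
      hq.stronglyMeasurable.stronglyMeasurableAtFilter hq.continuousAt
  refine h1.tendsto_slope_zero_right.congr fun h => ?_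
  rw [integral_add_eq_sub hq]
  exact RCLike.real_smul_eq_coe_smul (K := ℂ) _ _

lemma tendsto_inner_timeAverage {q : ℝ → L2Space n} (hq : Continuous q) (t : ℝ) (f : L2Space n) :
    Tendsto (fun h : ℝ => ((h⁻¹ : ℝ) : ℂ) * ⟪∫ τ in t..t + h, q τ, f⟫_ℂ) (𝓝[>] 0)
      (𝓝 ⟪q t, f⟫_ℂ) := by
  refine ((tendsto_timeAverage hq t).inner tendsto_const_nhds).congr fun h => ?_
  rw [inner_smul_left, Complex.conj_ofReal]

lemma tendsto_integral_inner_timeAverage {q p : ℝ → L2Space n} (hq : Continuous q)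
    (hp : Continuous p) {a b : ℝ} (hab : a ≤ b) :
    Tendsto (fun h : ℝ => ((h⁻¹ : ℝ) : ℂ) * ∫ t in a..b, ⟪∫ τ in t..t + h, q τ, p t⟫_ℂ) (𝓝[>] 0)
      (𝓝 (∫ t in a..b, ⟪q t, p t⟫_ℂ)) := by
  obtain ⟨K, hK⟩ := isCompact_Icc.exists_bound_of_continuousOn (hq.continuousOn (s := Icc a (b + 1)))
  simp_rw [← intervalIntegral.integral_const_mul]
  apply intervalIntegral.tendsto_integral_filter_of_dominated_convergence (fun t => K * ‖p t‖)
  · refine Eventually.of_forall fun h => Continuous.aestronglyMeasurable ?_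
    have := continuous_timeAverage hq h
    fun_prop
  · filter_upwards [Ioc_mem_nhdsGT (zero_lt_one (α := ℝ))] with h hh
    refine Eventually.of_forall fun t ht => ?_
    rw [uIoc_of_le hab] at ht
    have h1 : ‖∫ τ in t..t + h, q τ‖ ≤ K * |t + h - t| := by
      apply intervalIntegral.norm_integral_le_of_norm_le_const
      intro τ hτ
      rw [uIoc_of_le (by linarith [hh.1])] at hτ
      exact hK τ ⟨by linarith [hτ.1, ht.1], by linarith [hτ.2, ht.2, hh.2]⟩
    rw [add_sub_cancel_left, abs_of_pos hh.1] at h1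
    rw [norm_mul, Complex.norm_real, Real.norm_of_nonneg (inv_nonneg.2 hh.1.le)]
    calc _ ≤ h⁻¹ * (K * h * ‖p t‖) := by
          refine mul_le_mul_of_nonneg_left ?_ (inv_nonneg.2 hh.1.le)
          exact (norm_inner_le_norm _ _).trans (mul_le_mul_of_nonneg_right h1 (norm_nonneg _))
      _ = _ := by
          have := hh.1.ne'
          field_simp
  · exact Continuous.intervalIntegrable (by fun_prop) _ _
  · exact Eventually.of_forall fun t _ => tendsto_inner_timeAverage hq t (p t)

lemma exists_norm_mulOp_le {V : EuclideanSpace ℝ (Fin n) → ℂ} :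
    ∃ M, 0 ≤ M ∧ ∀ f : L2Space n, ‖mulOp V f‖ ≤ M * ‖f‖ :=
  ⟨‖mulOp V‖, norm_nonneg _, (mulOp V).le_opNorm⟩

/-- Green's formula for two weak solutions in `L²`. -/
lemma WeakSol.inner_sub_inner {V : EuclideanSpace ℝ (Fin n) → ℂ} (hV : MemLp V ⊤ volume)
    {w v G : ℝ → L2Space n} (hwc : Continuous w) (hvc : Continuous v) (hGc : Continuous G)
    {T : ℝ} (hT : 0 ≤ T) (hw : WeakSol univ 0 T V w (fun _ => 0))
    (hv : WeakSol univ 0 (T + 1) (fun x => conj (V x)) v G) :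
    ⟪v T, w T⟫_ℂ - ⟪v 0, w 0⟫_ℂ = ∫ t in (0 : ℝ)..T, Complex.I * ⟪G t, w t⟫_ℂ := by
  obtain ⟨C, hC, χ, hχ, hθ⟩ := exists_dyadic_cutoffs n
  obtain ⟨M, hM0, hM⟩ := exists_norm_mulOp_le (n := n) (V := fun x => conj (V x))
  obtain ⟨A, hA⟩ := isCompact_Icc.exists_bound_of_continuousOn (hwc.continuousOn (s := Icc 0 T))
  obtain ⟨K, hK⟩ :=
    isCompact_Icc.exists_bound_of_continuousOn (hvc.continuousOn (s := Icc 0 (T + 1)))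
  obtain ⟨L, hL⟩ :=
    isCompact_Icc.exists_bound_of_continuousOn (hGc.continuousOn (s := Icc 0 (T + 1)))
  -- For fixed `h` the cutoff error is a constant times `2⁻ᵏ`, as `v` and `G` are bounded in `L²`.
  -- The averages stay within `[0, T + 1]` because `h ≤ 1`.
  have key : ∀ h ∈ Ioc (0 : ℝ) 1, ⟪∫ τ in T..T + h, v τ, w T⟫_ℂ - ⟪∫ τ in (0 : ℝ)..0 + h, v τ, w 0⟫_ℂ -
      Complex.I * ∫ t in (0 : ℝ)..T, ⟪∫ τ in t..t + h, G τ, w t⟫_ℂ = 0 := by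
    intro h hh
    have hsub : Icc 0 (T + h) ⊆ Icc 0 (T + 1) := Icc_subset_Icc le_rfl (by linarith [hh.2])
    have h1 : ∀ k, ‖⟪mulOp (χ k) (∫ τ in T..T + h, v τ), w T⟫_ℂ -
        ⟪mulOp (χ k) (∫ τ in (0 : ℝ)..0 + h, v τ), w 0⟫_ℂ -
        Complex.I * ∫ t in (0 : ℝ)..T, ⟪mulOp (χ k) (∫ τ in t..t + h, G τ), w t⟫_ℂ‖ ≤
        (A * (2 * (√(n * (C + 2)) * C) + C) * (h * K + (2 * K + M * (h * K) + h * L)) * T) *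
          (2⁻¹ : ℝ) ^ k := by
      intro k
      have := norm_pairing_cutoff_le hC (one_le_pow₀ one_le_two) (hχ k) (hθ k) hV hwc
        (continuous_const (y := (0 : L2Space n))) hvc hGc hT hh.1.le hw
        (hv.mono (subset_univ _) le_rfl (by linarith [hh.2])) hA (fun t ht => hK t (hsub ht))
        (fun t ht => hL t (hsub ht)) hM hM0
      simp only [inner_zero_right, mul_zero, sub_zero,
        intervalIntegral.integral_const_mul] at this
      rw [zero_add]
      refine this.trans (le_of_eq ?_)
      rw [inv_pow]
      ring
    have h2 := ((((tendsto_mulOp_cutoff hχ (∫ τ in T..T + h, v τ)).inner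
      (tendsto_const_nhds (x := w T))).sub ((tendsto_mulOp_cutoff hχ (∫ τ in (0 : ℝ)..0 + h, v τ)).inner
      (tendsto_const_nhds (x := w 0)))).sub ((tendsto_integral_inner_mulOp_cutoff hχ
        (continuous_timeAverage hGc h) hwc 0 T).const_mul Complex.I)).norm
    have h3 := (tendsto_pow_atTop_nhds_zero_of_lt_one (r := (2⁻¹ : ℝ)) (by norm_num)
      (by norm_num)).const_mul
        (A * (2 * (√(n * (C + 2)) * C) + C) * (h * K + (2 * K + M * (h * K) + h * L)) * T)
    have h4 := le_of_tendsto_of_tendsto' h2 h3 h1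
    rw [mul_zero] at h4
    exact norm_le_zero_iff.1 h4
  have h1 := ((tendsto_inner_timeAverage hvc T (w T)).sub
    (tendsto_inner_timeAverage hvc 0 (w 0))).sub
    ((tendsto_integral_inner_timeAverage hGc hwc hT).const_mul Complex.I)
  have h2 : Tendsto (fun _ : ℝ => (0 : ℂ)) (𝓝[>] (0 : ℝ)) (𝓝 (⟪v T, w T⟫_ℂ - ⟪v 0, w 0⟫_ℂ -
      Complex.I * ∫ t in (0 : ℝ)..T, ⟪G t, w t⟫_ℂ)) := by
    refine h1.congr' ?_
    filter_upwards [Ioc_mem_nhdsGT (zero_lt_one (α := ℝ))] with h hh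
    rw [← mul_zero ((h⁻¹ : ℝ) : ℂ), ← key h hh]
    ring
  rw [intervalIntegral.integral_const_mul]
  exact sub_eq_zero.1 (tendsto_nhds_unique h2 tendsto_const_nhds)

lemma indicator_one_mul (s : Set (EuclideanSpace ℝ (Fin n))) (f : EuclideanSpace ℝ (Fin n) → ℂ) :
    (fun x => s.indicator (fun _ => (1 : ℂ)) x * f x) = s.indicator f := by
  ext x
  by_cases hx : x ∈ s <;> simp [hx]

/-- Truncations of curves in `B*` to balls. -/
lemma IsContinuousBStarCurve.exists_truncation {v : ℝ × EuclideanSpace ℝ (Fin n) → ℂ}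
    (hv : IsContinuousBStarCurve v) (a b : ℝ) :
    ∃ N : ℝ, ∀ J : ℕ, (∀ t, MemLp ((Metric.closedBall 0 (2 ^ J)).indicator fun x => v (t, x)) 2
        volume) ∧
      Continuous (fun t => toL2 ((Metric.closedBall 0 (2 ^ J)).indicator fun x => v (t, x))) ∧
      ∀ t ∈ Icc a b, ‖toL2 ((Metric.closedBall 0 (2 ^ J)).indicator fun x => v (t, x))‖ ≤
        √(2 ^ (J + 1)) * N := by
  obtain ⟨N, hN, hvN⟩ := hv.exists_bound a b
  refine ⟨N.toReal, fun J => ?_⟩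
  have h := hv.continuous_toL2_mul
    (m := (Metric.closedBall 0 (2 ^ J)).indicator (fun _ => (1 : ℂ)))
    (aestronglyMeasurable_const.indicator measurableSet_closedBall) (c := 2 ^ (J + 1))
    (ENNReal.pow_lt_top (by norm_num))
    (fun f => by
      rw [indicator_one_mul]
      exact eLpNorm_indicator_ball_le f J)
  simp_rw [indicator_one_mul] at h
  refine ⟨h.1, h.2, fun t ht => ?_⟩
  rw [norm_toL2 (h.1 t)]
  refine le_of_sq_le_sq ?_ (by positivity)
  rw [← ENNReal.toReal_pow, mul_pow, Real.sq_sqrt (by positivity)]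
  have h1 : eLpNorm ((Metric.closedBall 0 (2 ^ J)).indicator fun x => v (t, x)) 2 volume ^ 2 ≤
      2 ^ (J + 1) * N ^ 2 := (eLpNorm_indicator_ball_le _ J).trans (by gcongr; exact hvN t ht)
  have h2 := ENNReal.toReal_mono (ENNReal.mul_lt_top (ENNReal.pow_lt_top (by norm_num))
    (ENNReal.pow_lt_top hN)).ne h1
  simpa using h2

/-- Green's formula for a weak solution in `L²` with vanishing data at the initial and final times,
and a solution of the adjoint equation in `B*`. -/
lemma WeakSol.integral_inner_eq_zero {V P : EuclideanSpace ℝ (Fin n) → ℂ} (hV : MemLp V ⊤ volume)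
    (hP : MemLp P ⊤ volume) {w p : ℝ → L2Space n} (hwc : Continuous w) (hpc : Continuous p)
    {T : ℝ} (hT : 0 < T) (hw : WeakSol univ 0 T V w (fun t => mulOp P (p t)))
    (hw0 : w 0 = 0) (hwT : w T = 0) {v : ℝ × EuclideanSpace ℝ (Fin n) → ℂ}
    (hv : IsContinuousBStarCurve v)
    (hv_eq : SolvesSchrodinger univ (fun x => conj (V x)) (fun t x => v (t, x)))
    (hqm : ∀ t, MemLp (fun x => conj (P x) * v (t, x)) 2 volume)
    (hqc : Continuous fun t => toL2 (fun x => conj (P x) * v (t, x))) :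
    ∫ t in (0 : ℝ)..T, ⟪toL2 (fun x => conj (P x) * v (t, x)), p t⟫_ℂ = 0 := by
  obtain ⟨C, hC, χ, hχ, hθ⟩ := exists_dyadic_cutoffs n
  obtain ⟨M, hM0, hM⟩ := exists_norm_mulOp_le (n := n) (V := fun x => conj (V x))
  obtain ⟨A, hA⟩ := isCompact_Icc.exists_bound_of_continuousOn (hwc.continuousOn (s := Icc 0 T))
  obtain ⟨N, hN⟩ := hv.exists_truncation 0 (T + 1)
  set q : ℝ → L2Space n := fun t => toL2 (fun x => conj (P x) * v (t, x)) with hq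
  have key : ∀ h ∈ Ioc (0 : ℝ) 1, ∫ t in (0 : ℝ)..T, ⟪∫ τ in t..t + h, q τ, p t⟫_ℂ = 0 := by
    intro h hh
    have hsub : Icc 0 (T + h) ⊆ Icc 0 (T + 1) := Icc_subset_Icc le_rfl (by linarith [hh.2])
    -- The truncation of `v` has norm of order `2^{k/2}` against the gain `2⁻ᵏ` of the cutoff, so
    -- the bound still decays. The boundary terms vanish with `w 0` and `w T`.
    have h1 : ∀ k, ‖∫ t in (0 : ℝ)..T, ⟪mulOp (χ k) (∫ τ in t..t + h, q τ), p t⟫_ℂ‖ ≤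
        (A * (2 * (√(n * (C + 2)) * C) + C) * (h + 2 + M * h) * T * N) *
          (√(2 ^ (k + 3 + 1)) / 2 ^ k) := by
      intro k
      -- Radius `2 ^ (k + 3) = 8 * 2 ^ k` covers the ball of radius `6 * 2 ^ k` on which the local
      -- equation is required.
      obtain ⟨hm, hc, hb⟩ := hN (k + 3)
      set vk : ℝ → L2Space n :=
        fun t => toL2 ((Metric.closedBall 0 (2 ^ (k + 3))).indicator fun x => v (t, x)) with hvk
      have hball : ∀ x : EuclideanSpace ℝ (Fin n), ‖x‖ < 6 * 2 ^ k →
          x ∈ Metric.closedBall (0 : EuclideanSpace ℝ (Fin n)) (2 ^ (k + 3)) := by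
        intro x hx
        rw [mem_closedBall_zero_iff, pow_add]
        have : (0 : ℝ) < 2 ^ k := by positivity
        linarith
      have hsol : WeakSol (Metric.ball 0 (6 * 2 ^ k)) 0 (T + h) (fun x => conj (V x)) vk
          (fun _ => 0) := by
        refine hv_eq.weakSol hV.conj_top (by linarith [hh.1]) (subset_univ _) hc fun t _ => ?_
        filter_upwards [coeFn_toL2 (hm t)] with x hx hxb
        rw [hx, indicator_of_mem (hball x (mem_ball_zero_iff.1 hxb))]
      have := norm_pairing_cutoff_le hC (one_le_pow₀ one_le_two) (hχ k) (hθ k) hV hwc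
        ((mulOp P).continuous.comp hpc) hc (continuous_const (y := (0 : L2Space n))) hT.le hh.1.le
        hw hsol hA (fun t ht => hb t (hsub ht)) (L := 0) (fun t _ => norm_zero.le) hM hM0
      simp only [hw0, hwT, inner_zero_right, intervalIntegral.integral_zero, map_zero,
        inner_zero_left, mul_zero, sub_zero, zero_sub, norm_neg, intervalIntegral.integral_neg,
        intervalIntegral.integral_const_mul, norm_mul, Complex.norm_I, one_mul, add_zero] at this
      -- The support of `χ k` lies in the truncation ball, so the truncation can be dropped. Moving
      -- `P` to the left replaces `v`, which has no `L²` limit, by `conj P * v`, which is globally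
      -- in `L²`.
      have e : ∀ t, ⟪mulOp (χ k) (∫ τ in t..t + h, vk τ), mulOp P (p t)⟫_ℂ =
          ⟪mulOp (χ k) (∫ τ in t..t + h, q τ), p t⟫_ℂ := by
        intro t
        have e1 := inner_mulOp_left hP.conj_top (mulOp (χ k) (∫ τ in t..t + h, vk τ)) (p t)
        simp only [Complex.conj_conj] at e1
        rw [← e1]
        congr 1
        rw [← ContinuousLinearMap.intervalIntegral_comp_comm _ (hc.intervalIntegrable _ _),
          ← ContinuousLinearMap.intervalIntegral_comp_comm _
            ((show Continuous fun τ => mulOp (χ k) (vk τ) by fun_prop).intervalIntegrable _ _),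
          ← ContinuousLinearMap.intervalIntegral_comp_comm _ (hqc.intervalIntegrable _ _)]
        congr 1
        ext1 τ
        have hχm := (hχ k).isTest.memLp ⊤
        rw [hvk, hq, mulOp_toL2 hχm (hm τ), mulOp_toL2 hχm (hqm τ), mulOp_toL2 hP.conj_top]
        · congr 1
          ext x
          by_cases hx : x ∈ Metric.closedBall (0 : EuclideanSpace ℝ (Fin n)) (2 ^ (k + 3))
          · rw [indicator_of_mem hx]
            ring
          · have : χ k x = 0 := by
              by_contra h0
              have h2 := (hχ k).tsupport_subset (subset_tsupport _ h0)
              rw [mem_closedBall_zero_iff] at h2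
              have : (0 : ℝ) < 2 ^ k := by positivity
              exact hx (hball x (by linarith))
            simp [this]
        · have := coeFn_mulOp hχm (vk τ)
          refine (memLp_congr_ae ?_).1 (Lp.memLp (mulOp (χ k) (vk τ)))
          filter_upwards [this, coeFn_toL2 (hm τ)] with x h1 h2
          rw [h1, ← h2]
      simp only [Function.comp_apply, e] at this
      refine this.trans (le_of_eq ?_)
      ring
    have h2 := (tendsto_integral_inner_mulOp_cutoff hχ (continuous_timeAverage hqc h) hpc 0 T).norm
    have h3 : Tendsto (fun k : ℕ => √(2 ^ (k + 3 + 1)) / 2 ^ k) atTop (𝓝 (0 : ℝ)) := by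
      have h4 : ∀ k : ℕ, √(2 ^ (k + 3 + 1)) / 2 ^ k = 4 * √(2⁻¹ : ℝ) ^ k := by
        intro k
        have h5 : (√(2⁻¹ : ℝ) ^ k) ^ 2 = (2⁻¹ : ℝ) ^ k := by
          rw [← pow_mul, mul_comm, pow_mul, Real.sq_sqrt (by norm_num)]
        rw [div_eq_iff (by positivity),
          ← Real.sqrt_sq (show 0 ≤ 4 * √(2⁻¹ : ℝ) ^ k * 2 ^ k by positivity), mul_pow, mul_pow, h5,
          inv_pow]
        congr 1
        field_simp
        ring
      simp_rw [h4]
      have h5 := (tendsto_pow_atTop_nhds_zero_of_lt_one (r := √(2⁻¹ : ℝ)) (by positivity)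
        (by rw [Real.sqrt_lt' one_pos]; norm_num)).const_mul 4
      rwa [mul_zero] at h5
    have h4 := le_of_tendsto_of_tendsto' h2 (h3.const_mul _) h1
    rw [mul_zero] at h4
    exact norm_le_zero_iff.1 h4
  refine tendsto_nhds_unique (tendsto_integral_inner_timeAverage hqc hpc hT.le)
    (tendsto_const_nhds.congr' ?_)
  filter_upwards [Ioc_mem_nhdsGT (zero_lt_one (α := ℝ))] with h hh
  rw [key h hh, mul_zero]

end Pairing

/-! ### Factorization of `V₁ - V₂` and the final duality argument -/

section Main

variable {n : ℕ}

lemma conj_sqrtWeight (Q : EuclideanSpace ℝ (Fin n) → ℂ) (x : EuclideanSpace ℝ (Fin n)) :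
    conj (sqrtWeight Q x) = sqrtWeight Q x := Complex.conj_ofReal _

/-- The phase `Q / |Q|`. -/
noncomputable def phase (Q : EuclideanSpace ℝ (Fin n) → ℂ) (x : EuclideanSpace ℝ (Fin n)) : ℂ :=
  Q x / ‖Q x‖

/-- At zeros of `Q` the phase is `0 / 0 = 0`, which does no harm because both sides vanish there.
One weight goes to each `B*` factor and the bounded phase to either. -/
lemma sqrtWeight_mul_phase_mul (Q : EuclideanSpace ℝ (Fin n) → ℂ) (x : EuclideanSpace ℝ (Fin n)) :
    sqrtWeight Q x * (phase Q x * sqrtWeight Q x) = Q x := by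
  have h : sqrtWeight Q x * sqrtWeight Q x = (‖Q x‖ : ℂ) := by
    rw [sqrtWeight, ← Complex.ofReal_mul, Real.mul_self_sqrt (norm_nonneg _)]
  rw [mul_left_comm, h, phase]
  by_cases h0 : Q x = 0
  · simp [h0]
  · rw [div_mul_cancel₀]
    simpa using h0

lemma memLp_phase {Q : EuclideanSpace ℝ (Fin n) → ℂ} (hQ : AEStronglyMeasurable Q volume) :
    MemLp (phase Q) ⊤ volume := by
  have hm : AEStronglyMeasurable (phase Q) volume :=
    (hQ.aemeasurable.div
      (Complex.measurable_ofReal.comp_aemeasurable hQ.norm.aemeasurable)).aestronglyMeasurable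
  refine memLp_top_of_bound hm 1 (Eventually.of_forall fun x => ?_)
  rw [phase, norm_div, Complex.norm_real, norm_norm]
  exact div_self_le_one _

/-- The difference of two weak solutions for different potentials. -/
lemma WeakSol.sub {Ω : Set (EuclideanSpace ℝ (Fin n))} {a b : ℝ}
    {V₁ V₂ : EuclideanSpace ℝ (Fin n) → ℂ} {w₁ w₂ F : ℝ → L2Space n} (hc₁ : Continuous w₁)
    (hc₂ : Continuous w₂) (h₁ : WeakSol Ω a b V₁ w₁ (fun _ => 0))
    (h₂ : WeakSol Ω a b V₂ w₂ (fun _ => 0))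
    (hF : ∀ t, F t = mulOp V₁ (w₁ t) - mulOp V₂ (w₁ t)) :
    WeakSol Ω a b V₂ (fun t => w₁ t - w₂ t) F := by
  intro ψ hψ hs s hs' t ht
  have e₁ := h₁ ψ hψ hs s hs' t ht
  have e₂ := h₂ ψ hψ hs s hs' t ht
  have e : ⟪toL2 ψ, w₁ t - w₂ t⟫_ℂ - ⟪toL2 ψ, w₁ s - w₂ s⟫_ℂ =
      (⟪toL2 ψ, w₁ t⟫_ℂ - ⟪toL2 ψ, w₁ s⟫_ℂ) - (⟪toL2 ψ, w₂ t⟫_ℂ - ⟪toL2 ψ, w₂ s⟫_ℂ) := by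
    rw [inner_sub_right, inner_sub_right]
    ring
  rw [e, e₁, e₂, ← intervalIntegral.integral_sub
    (Continuous.intervalIntegrable (by fun_prop) _ _)
    (Continuous.intervalIntegrable (by fun_prop) _ _)]
  congr 1
  ext1 τ
  simp only [hF, map_sub, inner_sub_right, inner_add_right, add_zero]
  ring

lemma mulOp_sub_apply {V₁ V₂ : EuclideanSpace ℝ (Fin n) → ℂ} (hV₁ : MemLp V₁ ⊤ volume)
    (hV₂ : MemLp V₂ ⊤ volume) (f : L2Space n) :
    mulOp (fun x => V₁ x - V₂ x) f = mulOp V₁ f - mulOp V₂ f := by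
  have h : MemLp (fun x => V₁ x - V₂ x) ⊤ volume := hV₁.sub hV₂
  rw [mulOp_eq_toL2 h]
  symm
  apply eq_toL2_of_ae
  filter_upwards [Lp.coeFn_sub (mulOp V₁ f) (mulOp V₂ f), coeFn_mulOp hV₁ f, coeFn_mulOp hV₂ f]
    with x h1 h2 h3
  rw [h1, Pi.sub_apply, h2, h3, sub_mul]

/-- A space-time function whose slices are products of continuous curves in `L²` is integrable on
bounded time intervals. -/
lemma integrableOn_and_integral_eq {T : ℝ} (hT : 0 ≤ T) {f : ℝ × EuclideanSpace ℝ (Fin n) → ℂ}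
    (hf : AEStronglyMeasurable f volume) {p q : ℝ → L2Space n} (hp : Continuous p)
    (hq : Continuous q) (h : ∀ t, (fun x => f (t, x)) =ᵐ[volume] fun x => q t x * conj (p t x)) :
    IntegrableOn f (Ioo 0 T ×ˢ univ) volume ∧
      ∫ z in Ioo 0 T ×ˢ (univ : Set (EuclideanSpace ℝ (Fin n))), f z =
        ∫ t in (0 : ℝ)..T, ⟪p t, q t⟫_ℂ := by
  have hμ : (volume : Measure (ℝ × EuclideanSpace ℝ (Fin n))).restrict (Ioo 0 T ×ˢ univ) =
      ((volume : Measure ℝ).restrict (Ioo 0 T)).prod volume := by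
    rw [Measure.volume_eq_prod, ← Measure.prod_restrict, Measure.restrict_univ]
  have hfm : AEStronglyMeasurable f (((volume : Measure ℝ).restrict (Ioo 0 T)).prod volume) := by
    rw [← hμ]
    exact hf.restrict
  have hslice : ∀ t, Integrable (fun x => f (t, x)) volume := fun t =>
    (integrable_L2_mul_conj (p t) (q t)).congr (h t).symm
  have hsq : ∀ g : L2Space n, Integrable (fun x => ‖g x‖ ^ 2) volume := fun g =>
    (memLp_two_iff_integrable_sq_norm (Lp.aestronglyMeasurable g)).1 (Lp.memLp g)
  have hint : Integrable f (((volume : Measure ℝ).restrict (Ioo 0 T)).prod volume) := by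
    rw [integrable_prod_iff hfm]
    refine ⟨Eventually.of_forall hslice, ?_⟩
    -- From `|q conj p| ≤ |q|² + |p|²`, the `L¹` norms of the slices are dominated by a continuous
    -- function of time.
    have hb : IntegrableOn (fun t => ‖q t‖ ^ 2 + ‖p t‖ ^ 2) (Ioo 0 T) volume :=
      (Continuous.integrableOn_Icc (by fun_prop)).mono_set Ioo_subset_Icc_self
    refine hb.mono' hfm.norm.integral_prod_right' (Eventually.of_forall fun t => ?_)
    rw [Real.norm_of_nonneg (integral_nonneg fun x => norm_nonneg _), norm_sq_L2, norm_sq_L2,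
      ← integral_add (hsq _) (hsq _)]
    refine integral_mono_ae (hslice t).norm ((hsq _).add (hsq _)) ?_
    filter_upwards [h t] with x hx
    rw [show f (t, x) = q t x * conj (p t x) from hx, norm_mul, RCLike.norm_conj]
    nlinarith [sq_nonneg (‖q t x‖ - ‖p t x‖), sq_nonneg ‖q t x‖, sq_nonneg ‖p t x‖]
  refine ⟨by rw [IntegrableOn, hμ]; exact hint, ?_⟩
  rw [hμ, integral_prod _ hint, intervalIntegral.integral_of_le hT,
    ← integral_Ioc_eq_integral_Ioo]
  congr 1
  ext1 t
  rw [L2_inner_eq]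
  exact integral_congr_ae (h t)

end Main

theorem mainTheorem2 (n : ℕ) (T : ℝ) (hT : 0 < T)
    (V₁ V₂ : EuclideanSpace ℝ (Fin n) → ℂ)
    (hV₁ : MemLp V₁ ⊤ volume) (hV₂ : MemLp V₂ ⊤ volume)
    (hV₁' : tripleNorm V₁ < ⊤) (hV₂' : tripleNorm V₂ < ⊤)
    (hU : initialToFinalStateMap T V₁ = initialToFinalStateMap T V₂)
    (u₁ v₂ : ℝ × EuclideanSpace ℝ (Fin n) → ℂ)
    (hu₁ : IsContinuousBStarCurve u₁) (hv₂ : IsContinuousBStarCurve v₂)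
    (hu₁_eq : SolvesSchrodinger univ V₁ (fun t x => u₁ (t, x)))
    (hv₂_eq : SolvesSchrodinger univ (fun x => conj (V₂ x)) (fun t x => v₂ (t, x))) :
    IntegrableOn (fun p : ℝ × EuclideanSpace ℝ (Fin n) =>
        (V₁ p.2 - V₂ p.2) * u₁ p * conj (v₂ p)) (Ioo 0 T ×ˢ univ) volume ∧
      ∫ p in Ioo 0 T ×ˢ (univ : Set (EuclideanSpace ℝ (Fin n))),
        (V₁ p.2 - V₂ p.2) * u₁ p * conj (v₂ p) = 0 := by
  set Q : EuclideanSpace ℝ (Fin n) → ℂ := fun x => V₁ x - V₂ x with hQdef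
  have hQ : MemLp Q ⊤ volume := hV₁.sub hV₂
  have hQ' : tripleNorm Q < ⊤ := tripleNorm_sub_lt_top hV₁.1 hV₂.1 hV₁' hV₂'
  set P := sqrtWeight Q with hPdef
  have hP : MemLp P ⊤ volume := memLp_sqrtWeight hQ
  have hσ : MemLp (phase Q) ⊤ volume := memLp_phase hQ.1
  have hσP : MemLp (fun x => phase Q x * P x) ⊤ volume := hP.mul (p := ⊤) (q := ⊤) (r := ⊤) hσ
  have hPc : ∀ x, conj (P x) = P x := conj_sqrtWeight Q
  have hPσ : ∀ x, P x * (phase Q x * P x) = Q x := sqrtWeight_mul_phase_mul Q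
  obtain ⟨hm₁, hc₁⟩ := hu₁.continuous_toL2_mul hP.1 hQ' (eLpNorm_sqrtWeight_mul_le hQ)
  obtain ⟨hm₂, hc₂⟩ := hv₂.continuous_toL2_mul hP.1 hQ' (eLpNorm_sqrtWeight_mul_le hQ)
  set q₁ : ℝ → L2Space n := fun t => toL2 (fun x => P x * u₁ (t, x)) with hq₁
  set q₂ : ℝ → L2Space n := fun t => toL2 (fun x => P x * v₂ (t, x)) with hq₂
  -- Physical solutions are orthogonal to the source `conj Q * v₂`.
  have h_orth_physical : ∀ w : ℝ → L2Space n, Continuous w → WeakSol univ 0 T V₁ w (fun _ => 0) →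
      w T = initialToFinalStateMap T V₁ (w 0) →
      ∫ t in (0 : ℝ)..T, ⟪q₂ t, mulOp (fun x => phase Q x * P x) (w t)⟫_ℂ = 0 := by
    intro w hwc hw hwT
    -- The competitor solves the `V₂`-equation from the same initial state. By `hU` it ends at the
    -- same final state, so the difference has zero data at both ends and source `Q w`.
    obtain ⟨u, hu, huT⟩ := exists_isPhysicalSolution_final hV₂ T (w 0)
    obtain ⟨w', hwc', hw0', hwT', hw'⟩ := hu.exists_weakSol hT hV₂
    have hd : WeakSol univ 0 T V₂ (fun t => w t - w' t)
        (fun t => mulOp P (mulOp (fun x => phase Q x * P x) (w t))) := by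
      refine WeakSol.sub hwc hwc' hw hw' fun t => ?_
      rw [mulOp_mulOp hP hσP]
      simp only [hPσ]
      exact mulOp_sub_apply hV₁ hV₂ (w t)
    have := hd.integral_inner_eq_zero hV₂ hP (by fun_prop) (by fun_prop) hT
      (by rw [hw0', sub_self]) (by rw [hwT', huT, hwT, hU, sub_self]) hv₂ hv₂_eq
      (by simpa only [hPc] using hm₂) (by simpa only [hPc] using hc₂)
    simpa only [hPc] using this
  -- Chosen so that `P * p` is the source `conj Q * v₂`, with `p` itself still in `L²`.
  set p : ℝ → L2Space n := fun t => mulOp (fun x => conj (phase Q x)) (q₂ t) with hp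
  have hpc : Continuous p := by fun_prop
  have h_orth : ∫ t in (0 : ℝ)..T, ⟪q₁ t, p t⟫_ℂ = 0 := by
    have hmem : ∀ t ∈ Icc 0 T, (projIcc 0 T hT.le t : ℝ) = t := fun t ht => by
      rw [projIcc_of_mem hT.le ht]
    -- Freezing the source outside `[0, T]` makes it bounded on all of `ℝ`, as the existence result
    -- requires.
    have hpc' : Continuous fun t => p (projIcc 0 T hT.le t) := by fun_prop
    obtain ⟨B, hB⟩ : ∃ B, ∀ t, ‖mulOp P (p (projIcc 0 T hT.le t))‖ ≤ B := by
      obtain ⟨B, hB⟩ := isCompact_Icc.exists_bound_of_continuousOn (s := Icc 0 T)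
        (show Continuous fun t => mulOp P (p t) by fun_prop).continuousOn
      exact ⟨B, fun t => hB _ (projIcc 0 T hT.le t).2⟩
    -- The adjoint equation is solved backwards from the value `0` at time `T`.
    obtain ⟨w, hwc, hwT, hw⟩ := exists_weakSol (fun x => conj (V₁ x))
      (F := fun t => mulOp P (p (projIcc 0 T hT.le t))) (by fun_prop) hB 0 T
    have hw0 : w 0 = 0 := by
      -- Each `f` is the initial state of a physical `V₁`-solution; Green's formula and the
      -- orthogonality above give `⟪w 0, f⟫ = 0`.
      refine ext_inner_right ℂ fun f => ?_
      obtain ⟨u, hu, huT⟩ := exists_isPhysicalSolution_final hV₁ T f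
      obtain ⟨u', huc, hu0, huT', hu'⟩ := hu.exists_weakSol hT hV₁
      have h1 := WeakSol.inner_sub_inner hV₁ huc hwc
        (G := fun t => mulOp P (p (projIcc 0 T hT.le t))) (by fun_prop) hT.le hu' (hw 0 (T + 1))
      have h2 : ∫ t in (0 : ℝ)..T, Complex.I * ⟪mulOp P (p (projIcc 0 T hT.le t)), u' t⟫_ℂ =
          Complex.I * ∫ t in (0 : ℝ)..T, ⟪q₂ t, mulOp (fun x => phase Q x * P x) (u' t)⟫_ℂ := by
        rw [← intervalIntegral.integral_const_mul]
        apply intervalIntegral.integral_congr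
        intro t ht
        rw [uIcc_of_le hT.le] at ht
        simp only [hmem t ht, hp]
        rw [inner_mulOp_left hP, inner_mulOp_left hσ.conj_top]
        simp only [hPc, Complex.conj_conj]
        rw [mulOp_mulOp hσ hP]
      rw [h2, h_orth_physical u' huc hu' (by rw [huT', huT, hu0]), mul_zero, hwT, inner_zero_left, zero_sub,
        neg_eq_zero, hu0] at h1
      rw [h1, inner_zero_left]
    -- The roles are exchanged: `w` solves the equation with potential `conj V₁`, whose adjoint
    -- equation is the one satisfied by `u₁`.
    have h1 := (hw 0 T).integral_inner_eq_zero hV₁.conj_top hP hwc hpc' hT hw0 hwT hu₁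
      (by simpa only [Complex.conj_conj] using hu₁_eq) (by simpa only [hPc] using hm₁)
      (by simpa only [hPc] using hc₁)
    simp only [hPc] at h1
    rw [← h1]
    apply intervalIntegral.integral_congr
    intro t ht
    rw [uIcc_of_le hT.le] at ht
    simp only [hmem t ht, hq₁]
  obtain ⟨hI, hE⟩ := integrableOn_and_integral_eq hT.le
    (f := fun z : ℝ × EuclideanSpace ℝ (Fin n) => (V₁ z.2 - V₂ z.2) * u₁ z * conj (v₂ z))
    (by
      have h1 : AEStronglyMeasurable (fun z : ℝ × EuclideanSpace ℝ (Fin n) => Q z.2) volume :=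
        hQ.1.comp_snd
      exact (h1.mul hu₁.aestronglyMeasurable).mul
        (Complex.continuous_conj.comp_aestronglyMeasurable hv₂.aestronglyMeasurable))
    hpc hc₁ (by
      intro t
      filter_upwards [coeFn_mulOp hσ.conj_top (q₂ t), coeFn_toL2 (hm₁ t), coeFn_toL2 (hm₂ t)]
        with x h1 h2 h3
      simp only [hp, hq₁, hq₂] at h1 ⊢
      rw [h1, h2, h3, map_mul, map_mul, hPc, Complex.conj_conj]
      have := hPσ x
      simp only [hQdef] at this
      rw [← this]
      ring)
  refine ⟨hI, ?_⟩
  rw [hE]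
  have h1 := congrArg conj h_orth
  rw [← intervalIntegral.intervalIntegral_conj] at h1
  simpa using h1
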